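/- Let $\alpha,\beta>0$ and $1<q<\tfrac32$. Let $H^1_r$ be the space of radial complex-valued functions in $H^1(\mathbb R^3)$, with $\|u\|_{H^1}^2=\|\nabla u\|_2^2+\|u\|_2^2$, and equip $X=H^1_r\times H^1_r$ with the norm $\|(u,v)\|_{H^1}^2=\|u\|_{H^1}^2+\|v\|_{H^1}^2$. For $(u,v)\in X$ put $$\phi_{u,v}(x)=\int_{\mathbb R^3}\frac{|u(y)|^2+|v(y)|^2}{|x-y|}\,dy,$$ $$I(u,v)=\tfrac12\|\nabla u\|_2^2+\tfrac12\|\nabla v\|_2^2+\tfrac{\alpha}{4}\int_{\mathbb R^3}(|u|^2+|v|^2)\phi_{u,v}\,dx-\tfrac1{2q}\big(\|u\|_{2q}^{2q}+\|v\|_{2q}^{2q}\big)-\tfrac{\beta}{q}\int_{\mathbb R^3}|u|^q|v|^q\,dx .$$ For $a_1,a_2>0$ let $S(a_1,a_2)=\{(u,v)\in X:\ \|u\|_2^2=a_1,\ \|v\|_2^2=a_2\}$, $m(a_1,a_2)=\inf_{S(a_1,a_2)}I$ and $G(a_1,a_2)=\{(u,v)\in S(a_1,a_2): I(u,v)=m(a_1,a_2)\}$.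 Consider the evolution system $$i\partial_t\Psi_1=-\Delta\Psi_1+\alpha\,\phi_{\Psi_1,\Psi_2}\Psi_1-|\Psi_1|^{2q-2}\Psi_1-\beta|\Psi_2|^q|\Psi_1|^{q-2}\Psi_1,$$ $$i\partial_t\Psi_2=-\Delta\Psi_2+\alpha\,\phi_{\Psi_1,\Psi_2}\Psi_2-|\Psi_2|^{2q-2}\Psi_2-\beta|\Psi_1|^q|\Psi_2|^{q-2}\Psi_2 .$$ A solution on $[0,T)$, $0<T\le\infty$, is a $\Psi=(\Psi_1,\Psi_2)\in C([0,T);X)$ that satisfies both equations in the sense of distributions on $\mathbb R^3$ at every time $t\in[0,T)$ (that is, for each real test function $\varphi\in C_c^\infty(\mathbb R^3)$ the functions $t\mapsto\int\Psi_j(t)\varphi\,dx$ are differentiable on $[0,T)$, with the derivatives that the equations prescribe). Assume the following local theory in $X$: every datum $w\in X$ has a solution $\Psi$ with $\Psi(0)=w$ on some interval $[0,T)$, $0<T\le\infty$, such that $\|\Psi(t)\|_{H^1}\to\infty$ as $t\uparrow T$ if $T<\infty$; and every solution conserves $\|\Psi_1(t)\|_2^2$, $\|\Psi_2(t)\|_2^2$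 and $I(\Psi_1(t),\Psi_2(t))$. (Uniqueness is not assumed.) Call $G(a_1,a_2)$ orbitally stable if for every $\varepsilon>0$ there is $\delta>0$ such that for every $w\in X$ with $\inf_{g\in G(a_1,a_2)}\|w-g\|_{H^1}<\delta$ there is a solution on $[0,\infty)$ with initial datum $w$, and every solution $\Psi$ with initial datum $w$, on any interval $[0,T)$, satisfies $$\inf_{g\in G(a_1,a_2)}\|\Psi(t)-g\|_{H^1}<\varepsilon\qquad\text{for all }0<t<T .$$ Then: (i) if $1<q<\tfrac43$, then for all $a_1,a_2>0$ the set $G(a_1,a_2)$ is non-empty and orbitally stable; (ii) if $\tfrac43\le q<\tfrac32$, then there are $\rho_1,\rho_2>0$ such that for all $a_1\in(0,\rho_1)$ and $a_2\in(0,\rho_2)$ the set $G(a_1,a_2)$ is non-empty and orbitally stable. -/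

import Mathlib

open MeasureTheory Set Filter Topology
open scoped ContDiff

noncomputable section

namespace HartreeFock

/-- Physical space `ℝ³` with the Euclidean norm. -/
abbrev E3 : Type := EuclideanSpace ℝ (Fin 3)

/-- `L²(ℝ³; ℂ)`. -/
abbrev L2 : Type := Lp ℂ 2 (volume : Measure E3)

/-- Real test functions `C_c^∞(ℝ³)`. -/
def IsTest (φ : E3 → ℝ) : Prop := ContDiff ℝ ∞ φ ∧ HasCompactSupport φ

/-- The classical partial derivative `∂ᵢφ`. -/
def partialDeriv (i : Fin 3) (φ : E3 → ℝ) (x : E3) : ℝ :=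
  fderiv ℝ φ x (EuclideanSpace.single i 1)

/-- `g` is the weak partial derivative `∂ᵢu`: `∫ u ∂ᵢφ = - ∫ g φ` for all test functions `φ`. -/
def IsWeakPartial (i : Fin 3) (u g : L2) : Prop :=
  ∀ φ : E3 → ℝ, IsTest φ → ∫ x, partialDeriv i φ x • u x = - ∫ x, φ x • g x

lemma IsTest.integrable_smul {φ : E3 → ℝ} (hc : Continuous φ) (hs : HasCompactSupport φ)
    (u : L2) : Integrable (fun x => φ x • u x) := by
  have h1 : MemLp φ 2 volume := hc.memLp_of_hasCompactSupport hs
  have h2 : MemLp (u : E3 → ℂ) 2 volume := Lp.memLp u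
  exact memLp_one_iff_integrable.mp (h2.smul h1)

lemma IsTest.continuous_partialDeriv {φ : E3 → ℝ} (h : IsTest φ) (i : Fin 3) :
    Continuous (partialDeriv i φ) :=
  (h.1.continuous_fderiv (by simp)).clm_apply continuous_const

lemma IsTest.hasCompactSupport_partialDeriv {φ : E3 → ℝ} (h : IsTest φ) (i : Fin 3) :
    HasCompactSupport (partialDeriv i φ) :=
  h.2.fderiv_apply (𝕜 := ℝ) (EuclideanSpace.single i 1)

lemma IsWeakPartial.zero (i : Fin 3) : IsWeakPartial i 0 0 := by
  intro φ _
  have h0 : ((0 : L2) : E3 → ℂ) =ᵐ[volume] 0 := Lp.coeFn_zero ℂ 2 volume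
  have h1 : ∫ x, partialDeriv i φ x • (0 : L2) x = 0 :=
    integral_eq_zero_of_ae (by filter_upwards [h0] with x hx; simp only [hx, Pi.zero_apply, smul_zero])
  have h2 : ∫ x, φ x • (0 : L2) x = 0 :=
    integral_eq_zero_of_ae (by filter_upwards [h0] with x hx; simp only [hx, Pi.zero_apply, smul_zero])
  rw [h1, h2, neg_zero]

lemma integral_smul_add (φ : E3 → ℝ) (hc : Continuous φ) (hs : HasCompactSupport φ)
    (u v : L2) :
    ∫ x, φ x • (u + v : L2) x = (∫ x, φ x • u x) + ∫ x, φ x • v x := by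
  rw [← integral_add (IsTest.integrable_smul hc hs u) (IsTest.integrable_smul hc hs v)]
  refine integral_congr_ae ?_
  filter_upwards [Lp.coeFn_add u v] with x hx
  rw [hx, Pi.add_apply, smul_add]

lemma integral_smul_smul (φ : E3 → ℝ) (c : ℂ) (u : L2) :
    ∫ x, φ x • (c • u : L2) x = c * ∫ x, φ x • u x := by
  rw [← integral_const_mul]
  refine integral_congr_ae ?_
  filter_upwards [Lp.coeFn_smul c u] with x hx
  rw [hx, Pi.smul_apply, smul_eq_mul, mul_smul_comm]

lemma IsWeakPartial.add {i : Fin 3} {u v g h : L2} (hu : IsWeakPartial i u g)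
    (hv : IsWeakPartial i v h) : IsWeakPartial i (u + v) (g + h) := by
  intro φ hφ
  rw [integral_smul_add _ (hφ.continuous_partialDeriv i) (hφ.hasCompactSupport_partialDeriv i),
    integral_smul_add _ hφ.1.continuous hφ.2, hu φ hφ, hv φ hφ]
  ring

lemma IsWeakPartial.smul {i : Fin 3} {u g : L2} (c : ℂ) (hu : IsWeakPartial i u g) :
    IsWeakPartial i (c • u) (c • g) := by
  intro φ hφ
  rw [integral_smul_smul, integral_smul_smul, hu φ hφ]
  ring

/-- The Sobolev space `H¹(ℝ³; ℂ)`, as the space of pairs `(u, ∇u)` in `L² × (L²)³` in which `∇u`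
is the weak gradient of `u` (which `u` determines). The inherited Hilbert norm is
`(∫ |u|² + ∫ |∇u|²)^(1/2)`. -/
def H1 : Submodule ℂ (WithLp 2 (L2 × PiLp 2 (fun _ : Fin 3 => L2))) where
  carrier := {p | ∀ i, IsWeakPartial i p.fst (p.snd i)}
  zero_mem' := fun i => IsWeakPartial.zero i
  add_mem' := fun hp hr i => (hp i).add (hr i)
  smul_mem' := fun c _ hp i => (hp i).smul c

/-- The function underlying an element of `H¹`. -/
def fn (u : H1) : E3 → ℂ := (u.1.fst : L2)

/-- The weak partial derivative `∂ᵢu` of an element of `H¹`. -/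
def grad (u : H1) (i : Fin 3) : E3 → ℂ := (u.1.snd i : L2)

/-- The space `H¹_r(ℝ³; ℂ)` of those `u ∈ H¹` that are radial: `u(x) = f(|x|)` for a.e. `x`. -/
def H1r : Submodule ℂ H1 where
  carrier := {u | ∃ f : ℝ → ℂ, ∀ᵐ x : E3, fn u x = f ‖x‖}
  zero_mem' := ⟨0, by
    filter_upwards [Lp.coeFn_zero ℂ 2 (volume : Measure E3)] with x hx
    exact hx⟩
  add_mem' := by
    rintro u v ⟨f, hf⟩ ⟨g, hg⟩
    refine ⟨f + g, ?_⟩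
    filter_upwards [hf, hg, Lp.coeFn_add (u.1.fst : L2) v.1.fst] with x h1 h2 h3
    rw [Pi.add_apply, ← h1, ← h2]
    exact h3
  smul_mem' := by
    rintro c u ⟨f, hf⟩
    refine ⟨c • f, ?_⟩
    filter_upwards [hf, Lp.coeFn_smul c (u.1.fst : L2)] with x h1 h2
    rw [Pi.smul_apply, ← h1]
    exact h2

/-- The phase space `H¹_r × H¹_r`, with `‖(u, v)‖² = ‖u‖²_{H¹} + ‖v‖²_{H¹}`. -/
abbrev Phase : Type := WithLp 2 (H1r × H1r)

/-- The mass `‖u‖₂²`. -/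
def mass (u : H1) : ℝ := ∫ x, ‖fn u x‖ ^ 2

/-- The kinetic term `‖∇u‖₂²`. -/
def kinetic (u : H1) : ℝ := ∑ i, ∫ x, ‖grad u i x‖ ^ 2

/-- The Coulomb potential `φ_{u,v}(x) = ∫ (|u(y)|² + |v(y)|²) / |x - y| dy`. -/
def coulomb (u v : H1) (x : E3) : ℝ := ∫ y, (‖fn u y‖ ^ 2 + ‖fn v y‖ ^ 2) / ‖x - y‖

/-- The energy functional `I(u, v)`. -/
def energy (α β q : ℝ) (u v : H1) : ℝ :=
  1 / 2 * kinetic u + 1 / 2 * kinetic v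
    + α / 4 * (∫ x, (‖fn u x‖ ^ 2 + ‖fn v x‖ ^ 2) * coulomb u v x)
    - 1 / (2 * q) * ((∫ x, ‖fn u x‖ ^ (2 * q)) + ∫ x, ‖fn v x‖ ^ (2 * q))
    - β / q * (∫ x, ‖fn u x‖ ^ q * ‖fn v x‖ ^ q)

/-- The energy on the phase space. -/
def energyP (α β q : ℝ) (w : Phase) : ℝ := energy α β q w.fst w.snd

/-- The constraint set `S(a₁, a₂)`. -/
def S (a₁ a₂ : ℝ) : Set Phase := {w | mass w.fst = a₁ ∧ mass w.snd = a₂}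

/-- `m(a₁, a₂) = inf I` over `S(a₁, a₂)`. -/
def m (α β q a₁ a₂ : ℝ) : ℝ := sInf (energyP α β q '' S a₁ a₂)

/-- The set `G(a₁, a₂)` of constrained global minimizers. -/
def G (α β q a₁ a₂ : ℝ) : Set Phase :=
  {w | w ∈ S a₁ a₂ ∧ energyP α β q w = m α β q a₁ a₂}

/-- The pairing with `φ` of
`-Δu + α φ_{u,v} u - |u|^{2q-2} u - β |v|^q |u|^{q-2} u`, the Laplacian being taken weakly.
(`0 ^ (q - 2) * 0 = 0`, so the last term vanishes where `u` does.) -/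
def weakRHS (α β q : ℝ) (u v : H1) (φ : E3 → ℝ) : ℂ :=
  (∑ i, ∫ x, partialDeriv i φ x • grad u i x)
    + ∫ x, φ x • ((α * coulomb u v x - ‖fn u x‖ ^ (2 * q - 2)
        - β * ‖fn v x‖ ^ q * ‖fn u x‖ ^ (q - 2) : ℝ) • fn u x)

/-- The time interval `[0, T)`, `T ≤ ∞`. -/
def timeInterval (T : EReal) : Set ℝ := {t | 0 ≤ t ∧ (t : EReal) < T}

/-- `Ψ` is a solution on `[0, T)` of the evolution system
`i ∂ₜΨ₁ = -ΔΨ₁ + α (|x|⁻¹ ∗ (|Ψ₁|² + |Ψ₂|²)) Ψ₁ - |Ψ₁|^{2q-2} Ψ₁ - β |Ψ₂|^q |Ψ₁|^{q-2} Ψ₁`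
(and the same with the indices exchanged): `Ψ ∈ C([0, T); H¹_r × H¹_r)`, and at every time the
equations hold in the sense of distributions on `ℝ³`. -/
structure IsSolution (α β q : ℝ) (T : EReal) (Ψ : ℝ → Phase) : Prop where
  continuousOn : ContinuousOn Ψ (timeInterval T)
  eq_fst : ∀ φ : E3 → ℝ, IsTest φ → ∀ t ∈ timeInterval T,
    HasDerivWithinAt (fun s => ∫ x, φ x • fn (Ψ s).fst x)
      (-Complex.I * weakRHS α β q (Ψ t).fst (Ψ t).snd φ) (timeInterval T) t
  eq_snd : ∀ φ : E3 → ℝ, IsTest φ → ∀ t ∈ timeInterval T,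
    HasDerivWithinAt (fun s => ∫ x, φ x • fn (Ψ s).snd x)
      (-Complex.I * weakRHS α β q (Ψ t).snd (Ψ t).fst φ) (timeInterval T) t

/-- The local theory of the evolution system in `H¹_r × H¹_r`: every datum has a solution on some
`[0, T)`, `0 < T ≤ ∞`, which blows up in norm at `T` if `T < ∞`; and every solution conserves the
two masses and the energy. -/
structure LocalTheory (α β q : ℝ) : Prop where
  exists_maximal : ∀ w : Phase, ∃ T : EReal, 0 < T ∧ ∃ Ψ : ℝ → Phase,
    IsSolution α β q T Ψ ∧ Ψ 0 = w ∧
      (T ≠ ⊤ → Tendsto (fun t => ‖Ψ t‖) (𝓝[<] T.toReal) atTop)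
  mass_fst : ∀ (T : EReal) (Ψ : ℝ → Phase), IsSolution α β q T Ψ →
    ∀ t ∈ timeInterval T, mass (Ψ t).fst = mass (Ψ 0).fst
  mass_snd : ∀ (T : EReal) (Ψ : ℝ → Phase), IsSolution α β q T Ψ →
    ∀ t ∈ timeInterval T, mass (Ψ t).snd = mass (Ψ 0).snd
  energy_eq : ∀ (T : EReal) (Ψ : ℝ → Phase), IsSolution α β q T Ψ →
    ∀ t ∈ timeInterval T, energyP α β q (Ψ t) = energyP α β q (Ψ 0)

/-- Orbital stability of `G(a₁, a₂)`: for every `ε > 0` there is `δ > 0` such that for every datum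
`w` at distance less than `δ` from `G(a₁, a₂)` there is a solution on `[0, ∞)` starting at `w`, and
every solution starting at `w`, on whatever interval `[0, T)`, remains at distance less than `ε`
from `G(a₁, a₂)` at all its times `t > 0`. -/
def OrbitallyStable (α β q a₁ a₂ : ℝ) : Prop :=
  ∀ ε > 0, ∃ δ > 0, ∀ w : Phase, Metric.infDist w (G α β q a₁ a₂) < δ →
    (∃ Ψ : ℝ → Phase, IsSolution α β q ⊤ Ψ ∧ Ψ 0 = w) ∧
    ∀ (T : EReal) (Ψ : ℝ → Phase), IsSolution α β q T Ψ → Ψ 0 = w →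
      ∀ t ∈ timeInterval T, 0 < t → Metric.infDist (Ψ t) (G α β q a₁ a₂) < ε

end HartreeFock

end

/-! The proof is the Cazenave–Lions method, with the constraint relaxed to masses at most a₁ and a₂
(`IsMin`). Compactness comes from radial symmetry. Integrating the gradient against the
divergence-free field x/|x|³ gives sphereArea · u(x) = -∫_{|y|>|x|} ∇u(y)·y/|y|³ dy
(`ae_sphereArea_smul_eq`), so evaluation at a radius is a bounded functional on H¹. This yields the
decay |u(x)|² ≤ C ‖∇u‖₂²/|x| (`ae_norm_sq_le`) and turns weak convergence into a.e. convergence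
(`ae_tendsto_of_weakTendsto`). The two together make the power and coupling terms weakly continuous.
The decay also gives a Gagliardo–Nirenberg inequality whose kinetic exponent 3(q-1)/2 is below 1,
whence coercivity. The kinetic and Coulomb terms are weakly lower semicontinuous, so relaxed
minimizers exist. If each of them uses up both masses, every minimizing sequence has a subsequence
converging in norm to a point of G; with the conservation laws this gives existence and stability
(`nonempty_and_orbitallyStable`).

It remains to show that relaxed minimizers (u, v) saturate the constraints. Suppose mass u < a₁.
Competitors are built by adding densities: U = (|u|²+|w|²)^{1/2} has kinetic energy at most the sum
of the two (`exists_join`). If q < 4/3, let w be a bump of width R carrying the missing mass. It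
costs O(R⁻²) in kinetic and O(R⁻¹) in Coulomb energy and gains a multiple of R^{3-3q}, which wins
for large R (`IsMin.mass_eq_of_lt_four_thirds`).

For small masses let a = max(a₁, a₂), define L by a^{q-1}L^{5-3q} = 1 and put T = a/L². At length L
the kinetic and power terms both have size T and the Coulomb term has size αaL·T; the factor aL =
a^{(6-4q)/(5-3q)} vanishes with a because q < 3/2. The minimal energy is at most -cT, so the power
integrals of u and v are at least a fixed multiple of T. On the other hand, slack in the first mass
means that no Lagrange multiplier enters: with u ≥ 0, testing by cutoffs η(x/R) gives an inequality
of the form -Δu + αφu ≥ u^{2q-1} + β|v|^q u^{q-1}. With R = KL the Laplacian contributes only O(√a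
R^{-1/2}), so the right side has small integral on a large ball (`IsMin.setIntegral_forcing_le`).
Where u < θ|v|, adding s|v|² to |u|² shows that v carries little, since t ↦ t^{q/2} is steep near 0
(`IsMin.setIntegral_power_le`). Together with the decay near 0 and at infinity, this pushes the
power integrals below their lower bound (`exists_scale_mass_eq`). -/

noncomputable section

namespace HartreeFock

/-! ### Continuous linear maps on the spaces, norms, completeness -/

/-- Pairing with a square integrable real function. -/
def pairing (k : E3 → ℝ) (hk : MemLp k 2 (volume : Measure E3)) : L2 →L[ℂ] ℂ :=
  innerSL ℂ (hk.ofReal (K := ℂ)).toLp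

lemma pairing_apply (k : E3 → ℝ) (hk : MemLp k 2 (volume : Measure E3)) (u : L2) :
    pairing k hk u = ∫ x, k x • u x := by
  rw [pairing, innerSL_apply_apply, L2.inner_def]
  refine integral_congr_ae ?_
  filter_upwards [(hk.ofReal (K := ℂ)).coeFn_toLp] with x hx
  rw [hx]
  simp [mul_comm]

lemma norm_sq_eq_integral (u : L2) : ‖u‖ ^ 2 = ∫ x, ‖u x‖ ^ 2 := by
  have h := L2.inner_def (𝕜 := ℂ) u u
  rw [inner_self_eq_norm_sq_to_K] at h
  have h2 : ∀ x, inner ℂ (u x) (u x) = ((‖u x‖ ^ 2 : ℝ) : ℂ) := fun x => by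
    rw [inner_self_eq_norm_sq_to_K]; simp
  simp_rw [h2] at h
  rw [integral_complex_ofReal] at h
  have h3 : ((‖u‖ ^ 2 : ℝ) : ℂ) = ((∫ x, ‖u x‖ ^ 2 : ℝ) : ℂ) := by rw [← h]; norm_cast
  exact Complex.ofReal_injective h3

lemma norm_pairing_le (k : E3 → ℝ) (hk : MemLp k 2 (volume : Measure E3)) (u : L2) :
    ‖∫ x, k x • u x‖ ≤ Real.sqrt (∫ x, k x ^ 2) * ‖u‖ := by
  rw [← pairing_apply k hk]
  refine (norm_inner_le_norm (𝕜 := ℂ) (hk.ofReal (K := ℂ)).toLp u).trans ?_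
  gcongr
  apply Real.le_sqrt_of_sq_le
  rw [norm_sq_eq_integral]
  apply le_of_eq
  refine integral_congr_ae ?_
  filter_upwards [(hk.ofReal (K := ℂ)).coeFn_toLp] with x hx
  rw [hx]; simp

/-- The inclusion of `H¹` in `L²`. -/
def valL : H1 →L[ℂ] L2 := (WithLp.fstL 2 ℂ _ _).comp H1.subtypeL

/-- The weak partial derivative as a continuous linear map. -/
def gradL (i : Fin 3) : H1 →L[ℂ] L2 :=
  ((PiLp.proj 2 (fun _ : Fin 3 => L2) i).comp (WithLp.sndL 2 ℂ _ _)).comp H1.subtypeL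

lemma fn_eq (u : H1) : fn u = valL u := rfl
lemma grad_eq (u : H1) (i : Fin 3) : grad u i = gradL i u := rfl

lemma mass_eq (u : H1) : mass u = ‖valL u‖ ^ 2 := (norm_sq_eq_integral _).symm

lemma kinetic_eq (u : H1) : kinetic u = ∑ i, ‖gradL i u‖ ^ 2 := by
  simp_rw [norm_sq_eq_integral]; rfl

lemma mass_nonneg (u : H1) : 0 ≤ mass u := by rw [mass_eq]; positivity
lemma kinetic_nonneg (u : H1) : 0 ≤ kinetic u := by rw [kinetic_eq]; positivity

lemma norm_gradL_sq_le (u : H1) (i : Fin 3) : ‖gradL i u‖ ^ 2 ≤ kinetic u := by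
  rw [kinetic_eq]
  exact Finset.single_le_sum (f := fun i => ‖gradL i u‖ ^ 2) (fun _ _ => by positivity)
    (Finset.mem_univ i)

lemma norm_sq_H1 (u : H1) : ‖u‖ ^ 2 = mass u + kinetic u := by
  rw [mass_eq, kinetic_eq]
  have h1 : ‖u‖ ^ 2 = ‖u.1‖ ^ 2 := rfl
  rw [h1, WithLp.prod_norm_sq_eq_of_L2, PiLp.norm_sq_eq_of_L2]
  rfl

lemma isWeakPartial_gradL (u : H1) (i : Fin 3) : IsWeakPartial i (valL u) (gradL i u) := u.2 i

lemma IsTest.memLp {φ : E3 → ℝ} (h : IsTest φ) : MemLp φ 2 (volume : Measure E3) :=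
  h.1.continuous.memLp_of_hasCompactSupport h.2

lemma IsTest.memLp_partialDeriv {φ : E3 → ℝ} (h : IsTest φ) (i : Fin 3) :
    MemLp (partialDeriv i φ) 2 (volume : Measure E3) :=
  (h.continuous_partialDeriv i).memLp_of_hasCompactSupport (h.hasCompactSupport_partialDeriv i)

/-- For each test function the weak derivative identity equates two continuous functionals, so `H1`
is an intersection of closed sets. -/
lemma isClosed_H1 :
    IsClosed (H1 : Set (WithLp 2 (L2 × PiLp 2 (fun _ : Fin 3 => L2)))) := by
  have h : (H1 : Set (WithLp 2 (L2 × PiLp 2 (fun _ : Fin 3 => L2)))) =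
      ⋂ (i : Fin 3) (φ : E3 → ℝ) (h : IsTest φ), {p |
        pairing _ (h.memLp_partialDeriv i) (WithLp.fstL 2 ℂ L2 (PiLp 2 (fun _ : Fin 3 => L2)) p) =
        - pairing _ h.memLp (PiLp.proj (𝕜 := ℂ) 2 (fun _ : Fin 3 => L2) i
            (WithLp.sndL 2 ℂ L2 (PiLp 2 (fun _ : Fin 3 => L2)) p))} := by
    ext p
    simp only [mem_iInter, mem_ofPred_eq, pairing_apply]
    rfl
  rw [h]
  refine isClosed_iInter fun i => isClosed_iInter fun φ => isClosed_iInter fun h => ?_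
  exact isClosed_eq (by fun_prop) (by fun_prop)

instance : CompleteSpace H1 := isClosed_H1.completeSpace_coe

instance : SecondCountableTopology (WithLp 2 (L2 × PiLp 2 (fun _ : Fin 3 => L2))) :=
  have : Fact ((2 : ENNReal) ≠ ⊤) := ⟨ENNReal.ofNat_ne_top⟩
  have : SecondCountableTopology L2 := inferInstance
  have : SecondCountableTopology (PiLp 2 (fun _ : Fin 3 => L2)) :=
    (PiLp.homeomorph 2 (fun _ : Fin 3 => L2)).secondCountableTopology
  (WithLp.homeomorphProd 2 L2 (PiLp 2 (fun _ : Fin 3 => L2))).secondCountableTopology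

instance : SecondCountableTopology H1 :=
  inferInstanceAs (SecondCountableTopology
    ((H1 : Set (WithLp 2 (L2 × PiLp 2 (fun _ : Fin 3 => L2))))))

/-- An L² limit is an a.e. limit along a subsequence, and the pointwise limit of the radial profiles
serves as a profile of the limit; no measurability of profiles is required. -/
lemma isClosed_H1r : IsClosed (H1r : Set H1) := by
  refine isClosed_of_closure_subset fun u hu => ?_
  obtain ⟨w, hw, hwu⟩ := mem_closure_iff_seq_limit.mp hu
  have h1 : Tendsto (fun n => valL (w n)) atTop (𝓝 (valL u)) := (valL.continuous.tendsto u).comp hwu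
  have h2 := tendstoInMeasure_of_tendsto_Lp h1
  obtain ⟨ns, -, hns⟩ := h2.exists_seq_tendsto_ae
  choose f hf using hw
  refine ⟨fun r => limUnder atTop (fun k => f (ns k) r), ?_⟩
  filter_upwards [hns, ae_all_iff.mpr hf] with x hx hfx
  have h3 : Tendsto (fun k => f (ns k) ‖x‖) atTop (𝓝 (valL u x)) := by
    refine hx.congr fun k => ?_
    exact hfx (ns k)
  exact h3.limUnder_eq.symm

instance : CompleteSpace H1r := isClosed_H1r.completeSpace_coe
instance : SecondCountableTopology H1r :=
  inferInstanceAs (SecondCountableTopology ((H1r : Set H1)))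
instance : SecondCountableTopology Phase :=
  (WithLp.homeomorphProd 2 H1r H1r).secondCountableTopology

/-! ### Weak sequential compactness in separable Hilbert spaces -/

section Weak

variable {H : Type*} [NormedAddCommGroup H] [InnerProductSpace ℂ H]

/-- Weak convergence of a sequence. -/
def WeakTendsto (w : ℕ → H) (w₀ : H) : Prop :=
  ∀ ℓ : H →L[ℂ] ℂ, Tendsto (fun n => ℓ (w n)) atTop (𝓝 (ℓ w₀))

/-- The Riesz isomorphism carries the sequence into a ball of the dual, which is weak-* sequentially
compact by separability. The isomorphism is conjugate-linear, hence the `star` on the way back. -/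
lemma exists_weakTendsto_subseq [CompleteSpace H] [SecondCountableTopology H] {w : ℕ → H} {C : ℝ}
    (hw : ∀ n, ‖w n‖ ≤ C) : ∃ w₀ : H, ∃ ns : ℕ → ℕ, StrictMono ns ∧ WeakTendsto (w ∘ ns) w₀ := by
  have hs := WeakDual.isSeqCompact_closedBall ℂ H 0 C
  have hmem : ∀ n, StrongDual.toWeakDual (InnerProductSpace.toDual ℂ H (w n)) ∈
      (WeakDual.toStrongDual ⁻¹' Metric.closedBall (0 : StrongDual ℂ H) C) := by
    intro n
    rw [mem_preimage, mem_closedBall_zero_iff]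
    refine le_trans (le_of_eq ?_) (hw n)
    exact (InnerProductSpace.toDual ℂ H).norm_map (w n)
  obtain ⟨a, -, ns, hns, hlim⟩ := hs hmem
  refine ⟨(InnerProductSpace.toDual ℂ H).symm (WeakDual.toStrongDual a), ns, hns, fun ℓ => ?_⟩
  have h1 : ∀ y : H, Tendsto (fun n => inner ℂ (w (ns n)) y) atTop
      (𝓝 (inner ℂ ((InnerProductSpace.toDual ℂ H).symm (WeakDual.toStrongDual a)) y)) := by
    intro y
    rw [InnerProductSpace.toDual_symm_apply]
    exact (tendsto_iff_forall_eval_tendsto_topDualPairing).mp hlim y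
  have h2 := (continuous_star.tendsto _).comp (h1 ((InnerProductSpace.toDual ℂ H).symm ℓ))
  have h3 : ∀ z : H, ℓ z = star (inner ℂ z ((InnerProductSpace.toDual ℂ H).symm ℓ)) := by
    intro z
    rw [← InnerProductSpace.toDual_symm_apply (y := ℓ)]
    exact (inner_conj_symm _ _).symm
  simp_rw [h3]
  exact h2

lemma WeakTendsto.map {H' : Type*} [NormedAddCommGroup H'] [InnerProductSpace ℂ H'] {w : ℕ → H}
    {w₀ : H} (h : WeakTendsto w w₀) (T : H →L[ℂ] H') : WeakTendsto (fun n => T (w n)) (T w₀) :=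
  fun ℓ => h (ℓ.comp T)

/-- This is the affine minorant of the squared norm that touches it at w₀ (see
`two_mul_inner_sub_le`). Passing to the limit in it gives weak lower semicontinuity without a
liminf. -/
lemma WeakTendsto.tendsto_inner {w : ℕ → H} {w₀ : H} (h : WeakTendsto w w₀) :
    Tendsto (fun n => 2 * (inner ℂ w₀ (w n)).re - ‖w₀‖ ^ 2) atTop (𝓝 (‖w₀‖ ^ 2)) := by
  have h1 : Tendsto (fun n => 2 * (inner ℂ w₀ (w n)).re - ‖w₀‖ ^ 2) atTop
      (𝓝 (2 * (inner ℂ w₀ w₀).re - ‖w₀‖ ^ 2)) :=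
    (((Complex.continuous_re.tendsto _).comp (h (innerSL ℂ w₀))).const_mul 2).sub_const _
  have h2 : (inner ℂ w₀ w₀ : ℂ).re = ‖w₀‖ ^ 2 := by
    rw [inner_self_eq_norm_sq_to_K]; norm_cast
  rwa [h2, two_mul, add_sub_cancel_right] at h1

lemma two_mul_inner_sub_le (w w₀ : H) : 2 * (inner ℂ w₀ w).re - ‖w₀‖ ^ 2 ≤ ‖w‖ ^ 2 := by
  have h4 : ‖w - w₀‖ ^ 2 = ‖w‖ ^ 2 - 2 * (inner ℂ w w₀ : ℂ).re + ‖w₀‖ ^ 2 :=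
    norm_sub_sq (𝕜 := ℂ) _ _
  have h5 : (inner ℂ w w₀ : ℂ).re = (inner ℂ w₀ w : ℂ).re := inner_re_symm (𝕜 := ℂ) _ _
  nlinarith [sq_nonneg ‖w - w₀‖]

lemma WeakTendsto.norm_sq_le {w : ℕ → H} {w₀ : H} (h : WeakTendsto w w₀) {c : ℕ → ℝ} {c₀ : ℝ}
    (hc : Tendsto c atTop (𝓝 c₀)) (hle : ∀ᶠ n in atTop, ‖w n‖ ^ 2 ≤ c n) : ‖w₀‖ ^ 2 ≤ c₀ :=
  le_of_tendsto_of_tendsto h.tendsto_inner hc (by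
    filter_upwards [hle] with n hn using (two_mul_inner_sub_le _ _).trans hn)

lemma WeakTendsto.norm_sq_add_le {H' : Type*} [NormedAddCommGroup H'] [InnerProductSpace ℂ H']
    {w : ℕ → H} {w₀ : H} (h : WeakTendsto w w₀) {z : ℕ → H'} {z₀ : H'} (h' : WeakTendsto z z₀)
    {c : ℕ → ℝ} {c₀ : ℝ} (hc : Tendsto c atTop (𝓝 c₀))
    (hle : ∀ᶠ n in atTop, ‖w n‖ ^ 2 + ‖z n‖ ^ 2 ≤ c n) : ‖w₀‖ ^ 2 + ‖z₀‖ ^ 2 ≤ c₀ :=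
  le_of_tendsto_of_tendsto (h.tendsto_inner.add h'.tendsto_inner) hc (by
    filter_upwards [hle] with n hn using
      (add_le_add (two_mul_inner_sub_le _ _) (two_mul_inner_sub_le _ _)).trans hn)

/-- The Radon–Riesz property: expand ‖w n - w₀‖² and pass to the limit in each term. -/
lemma WeakTendsto.tendsto {w : ℕ → H} {w₀ : H} (h : WeakTendsto w w₀)
    (hn : Tendsto (fun n => ‖w n‖ ^ 2) atTop (𝓝 (‖w₀‖ ^ 2))) : Tendsto w atTop (𝓝 w₀) := by
  have h1 : Tendsto (fun n => ‖w n‖ ^ 2 - 2 * (inner ℂ w₀ (w n)).re + ‖w₀‖ ^ 2) atTop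
      (𝓝 (‖w₀‖ ^ 2 - 2 * (inner ℂ w₀ w₀).re + ‖w₀‖ ^ 2)) :=
    (hn.sub (((Complex.continuous_re.tendsto _).comp (h (innerSL ℂ w₀))).const_mul 2)).add_const _
  have h2 : (inner ℂ w₀ w₀ : ℂ).re = ‖w₀‖ ^ 2 := by
    rw [inner_self_eq_norm_sq_to_K]; norm_cast
  have h3 : Tendsto (fun n => ‖w n - w₀‖ ^ 2) atTop (𝓝 0) := by
    refine (h1.congr fun n => ?_).trans (by rw [h2]; ring_nf; exact le_rfl)
    rw [norm_sub_sq (𝕜 := ℂ), ← inner_re_symm (𝕜 := ℂ)]; rfl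
  rw [tendsto_iff_norm_sub_tendsto_zero]
  have h4 := h3.sqrt
  simpa using h4

end Weak

/-! ### Radial functions: polar coordinates -/

/-- The area of the unit sphere. -/
def sphereArea : ℝ := 3 * (volume : Measure E3).real (Metric.ball 0 1)

lemma sphereArea_pos : 0 < sphereArea := by
  have : 0 < (volume : Measure E3).real (Metric.ball 0 1) := by
    rw [Measure.real]
    exact ENNReal.toReal_pos (Metric.measure_ball_pos _ _ one_pos).ne' measure_ball_lt_top.ne
  unfold sphereArea; positivity

lemma integral_radial {F : Type*} [NormedAddCommGroup F] [NormedSpace ℝ F] (f : ℝ → F) :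
    ∫ x : E3, f ‖x‖ = sphereArea • ∫ y in Ioi (0 : ℝ), y ^ 2 • f y := by
  rw [integral_fun_norm_addHaar (volume : Measure E3) f]
  simp only [finrank_euclideanSpace, Fintype.card_fin, sphereArea]
  rw [mul_smul]
  norm_num
  rw [← Nat.cast_smul_eq_nsmul ℝ]
  norm_num

lemma integrable_radial {F : Type*} [NormedAddCommGroup F] [NormedSpace ℝ F] {f : ℝ → F} :
    Integrable (fun x : E3 => f ‖x‖) ↔ IntegrableOn (fun y => y ^ 2 • f y) (Ioi 0) := by
  rw [integrable_fun_norm_addHaar (volume : Measure E3)]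
  simp [finrank_euclideanSpace]

/-- In polar coordinates the indicator of a null set of radii integrates to zero; the origin, where
nothing is assumed, is itself null. -/
lemma ae_norm_of_ae {p : ℝ → Prop} (h : ∀ᵐ r : ℝ, 0 < r → p r) : ∀ᵐ x : E3, p ‖x‖ := by
  have h0 : volume {r : ℝ | ¬ (0 < r → p r)} = 0 := h
  obtain ⟨N, hN, hNm, hN0⟩ := exists_measurable_superset_of_null h0
  have h1 : IntegrableOn (fun y : ℝ => y ^ 2 • N.indicator (fun _ => (1 : ℝ)) y) (Ioi 0) := by
    refine (integrable_zero _ _ _).congr ?_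
    refine ae_restrict_of_ae ?_
    filter_upwards [compl_mem_ae_iff.mpr hN0] with y hy
    simp [indicator_of_notMem hy]
  have h2 := integrable_radial.mpr h1
  have h3 : ∫ x : E3, N.indicator (fun _ => (1 : ℝ)) ‖x‖ = 0 := by
    rw [integral_radial]
    have : ∫ y in Ioi (0 : ℝ), y ^ 2 • N.indicator (fun _ => (1 : ℝ)) y = 0 := by
      refine integral_eq_zero_of_ae (ae_restrict_of_ae ?_)
      filter_upwards [compl_mem_ae_iff.mpr hN0] with y hy
      simp [indicator_of_notMem hy]
    rw [this, smul_zero]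
  rw [integral_eq_zero_iff_of_nonneg (fun x => indicator_nonneg (fun _ _ => zero_le_one) _) h2] at h3
  have h4 : ∀ᵐ x : E3, x ≠ 0 := by
    simp [ae_iff]
  filter_upwards [h3, h4] with x hx hx0
  by_contra hp
  have : ‖x‖ ∈ N := hN (by simp [hx0, hp])
  simp [indicator_of_mem this] at hx

/-- The kernel `|x|⁻²` outside the ball of radius `r`. -/
def tailKernel (r : ℝ) (x : E3) : ℝ := (Ioi r).indicator (fun s => (s ^ 2)⁻¹) ‖x‖

lemma measurable_tailKernel (r : ℝ) : Measurable (tailKernel r) :=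
  (((measurable_id.pow_const 2).inv).indicator measurableSet_Ioi).comp measurable_norm

lemma tailKernel_nonneg (r : ℝ) (x : E3) : 0 ≤ tailKernel r x :=
  indicator_nonneg (fun _ _ => by positivity) _

/-- The kernel squared times the polar weight is s⁻⁴ s² = s⁻², whose integral over (r, ∞) is 1/r.
This is the source of the decay rate of radial functions. -/
lemma tailKernel_sq {r : ℝ} (hr : 0 < r) :
    Integrable (fun x => tailKernel r x ^ 2) ∧ ∫ x, tailKernel r x ^ 2 = sphereArea / r := by
  have h0 : ∀ x, tailKernel r x ^ 2 = (fun s => (Ioi r).indicator (fun s : ℝ => (s ^ 2)⁻¹) s ^ 2) ‖x‖ :=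
    fun x => rfl
  have h1 : ∀ y ∈ Ioi (0 : ℝ), y ^ 2 • (Ioi r).indicator (fun s : ℝ => (s ^ 2)⁻¹) y ^ 2 =
      (Ioi r).indicator (fun s : ℝ => s ^ (-2 : ℝ)) y := by
    intro y hy
    have hy : 0 < y := hy
    by_cases hyr : y ∈ Ioi r
    · simp only [indicator_of_mem hyr, smul_eq_mul]
      rw [Real.rpow_neg hy.le]
      norm_cast
      field_simp
    · simp [indicator_of_notMem hyr]
  have h2 : IntegrableOn (fun s : ℝ => s ^ (-2 : ℝ)) (Ioi r) :=
    integrableOn_Ioi_rpow_of_lt (by norm_num) hr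
  have h3 : Ioi (0 : ℝ) ∩ Ioi r = Ioi r := by
    rw [Ioi_inter_Ioi, max_eq_right hr.le]
  constructor
  · simp_rw [h0]
    rw [integrable_radial (f := fun s => (Ioi r).indicator (fun s : ℝ => (s ^ 2)⁻¹) s ^ 2),
      integrableOn_congr_fun h1 measurableSet_Ioi]
    exact ((integrable_indicator_iff measurableSet_Ioi).mpr h2).integrableOn
  · simp_rw [h0]
    rw [integral_radial (fun s => (Ioi r).indicator (fun s : ℝ => (s ^ 2)⁻¹) s ^ 2),
      setIntegral_congr_fun measurableSet_Ioi h1, setIntegral_indicator measurableSet_Ioi, h3,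
      integral_Ioi_rpow_of_lt (by norm_num) hr, smul_eq_mul]
    norm_num
    rw [Real.rpow_neg hr.le, Real.rpow_one]
    rfl

lemma memLp_tailKernel {r : ℝ} (hr : 0 < r) : MemLp (tailKernel r) 2 (volume : Measure E3) :=
  (memLp_two_iff_integrable_sq (measurable_tailKernel r).aestronglyMeasurable).mpr (tailKernel_sq hr).1

/-- The components of the field `x / |x|³`. -/
def coulombField (i : Fin 3) (x : E3) : ℝ := x i * (‖x‖ ^ 3)⁻¹

lemma measurable_coulombField (i : Fin 3) : Measurable (coulombField i) := by
  unfold coulombField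
  fun_prop

lemma abs_coulombField_le (i : Fin 3) (x : E3) : |coulombField i x| ≤ (‖x‖ ^ 2)⁻¹ := by
  rcases eq_or_ne x 0 with rfl | hx
  · simp [coulombField]
  have h1 : |x i| ≤ ‖x‖ := by simpa using PiLp.norm_apply_le x i
  have h2 : 0 < ‖x‖ := norm_pos_iff.mpr hx
  rw [coulombField, abs_mul, abs_of_nonneg (by positivity : 0 ≤ (‖x‖ ^ 3)⁻¹)]
  calc |x i| * (‖x‖ ^ 3)⁻¹ ≤ ‖x‖ * (‖x‖ ^ 3)⁻¹ := by gcongr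
    _ = _ := by field_simp

/-- The field `x / |x|³` outside the ball of radius `r`. -/
def tailField (i : Fin 3) (r : ℝ) (x : E3) : ℝ := {x : E3 | r < ‖x‖}.indicator (coulombField i) x

lemma measurable_tailField (i : Fin 3) (r : ℝ) : Measurable (tailField i r) :=
  (measurable_coulombField i).indicator (measurableSet_lt measurable_const measurable_norm)

lemma abs_tailField_le (i : Fin 3) (r : ℝ) (x : E3) : |tailField i r x| ≤ tailKernel r x := by
  by_cases h : r < ‖x‖
  · simp [tailField, tailKernel, h, abs_coulombField_le i x]
  · simp [tailField, tailKernel, h]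

lemma memLp_tailField (i : Fin 3) {r : ℝ} (hr : 0 < r) :
    MemLp (tailField i r) 2 (volume : Measure E3) :=
  (memLp_tailKernel hr).of_le (measurable_tailField i r).aestronglyMeasurable
    (ae_of_all _ fun x => by
      rw [Real.norm_eq_abs, Real.norm_eq_abs, abs_of_nonneg (tailKernel_nonneg r x)]
      exact abs_tailField_le i r x)

lemma integral_tailField_sq_le (i : Fin 3) {r : ℝ} (hr : 0 < r) :
    ∫ x, tailField i r x ^ 2 ≤ sphereArea / r := by
  rw [← (tailKernel_sq hr).2]
  refine integral_mono (memLp_tailField i hr).integrable_sq (tailKernel_sq hr).1 fun x => ?_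
  exact sq_le_sq' (by linarith [neg_abs_le (tailField i r x), abs_tailField_le i r x])
    ((le_abs_self _).trans (abs_tailField_le i r x))

lemma integrable_mul_tailKernel {r : ℝ} (hr : 0 < r) (u : L2) :
    Integrable (fun x => tailKernel r x * ‖u x‖) :=
  (memLp_tailKernel hr).integrable_mul (Lp.memLp u).norm

/-! ### The divergence identity -/

/-- The field is singular only at the origin, and Q vanishes near it. -/
lemma contDiff_mul_coulombField {Q : ℝ → ℝ} (hQ : ContDiff ℝ ∞ Q) {r₀ : ℝ} (hr₀ : 0 < r₀)
    (h0 : ∀ r ≤ r₀, Q r = 0) (i : Fin 3) :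
    ContDiff ℝ ∞ (fun x : E3 => Q ‖x‖ * coulombField i x) := by
  rw [contDiff_iff_contDiffAt]
  intro x
  rcases eq_or_ne x 0 with rfl | hx
  · refine (contDiffAt_const (c := (0 : ℝ))).congr_of_eventuallyEq ?_
    filter_upwards [Metric.ball_mem_nhds (0 : E3) hr₀] with y hy
    rw [h0 _ (by simpa using (mem_ball_zero_iff.mp hy).le), zero_mul]
  · have h1 : ContDiffAt ℝ ∞ (fun y : E3 => ‖y‖) x := contDiffAt_norm ℝ hx
    have h2 : ContDiffAt ℝ ∞ (fun y : E3 => y i) x := by fun_prop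
    exact (hQ.contDiffAt.comp x h1).mul (h2.mul ((h1.pow 3).inv (by simpa using hx)))

lemma hasFDerivAt_norm_E3 {x : E3} (hx : x ≠ 0) :
    HasFDerivAt (fun y : E3 => ‖y‖) (‖x‖⁻¹ • innerSL ℝ x) x := by
  have h1 : HasFDerivAt (fun y : E3 => ‖y‖ ^ 2) (2 • innerSL ℝ x) x :=
    (hasStrictFDerivAt_norm_sq x).hasFDerivAt
  have h2 := h1.sqrt (by simpa using hx)
  simp only [Real.sqrt_sq (norm_nonneg _)] at h2
  refine h2.congr_fderiv ?_
  ext y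
  have := norm_pos_iff.mpr hx
  simp
  field_simp

/-- The field x/|x|³ is divergence-free off the origin, so only the derivative of Q survives,
multiplied by the radial component |x|⁻² of the field. -/
lemma sum_partialDeriv_mul_coulombField {Q : ℝ → ℝ} (hQ : ContDiff ℝ ∞ Q) {r₀ : ℝ} (hr₀ : 0 < r₀)
    (h0 : ∀ r ≤ r₀, Q r = 0) (x : E3) :
    ∑ i, partialDeriv i (fun x : E3 => Q ‖x‖ * coulombField i x) x =
      deriv Q ‖x‖ * (‖x‖ ^ 2)⁻¹ := by
  rcases eq_or_ne x 0 with rfl | hx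
  · have h1 : ∀ i, partialDeriv i (fun x : E3 => Q ‖x‖ * coulombField i x) 0 = 0 := by
      intro i
      have : (fun x : E3 => Q ‖x‖ * coulombField i x) =ᶠ[𝓝 0] fun _ => 0 := by
        filter_upwards [Metric.ball_mem_nhds (0 : E3) hr₀] with y hy
        rw [h0 _ (by simpa using (mem_ball_zero_iff.mp hy).le), zero_mul]
      rw [partialDeriv, this.fderiv_eq]
      simp
    simp [h1]
  · have hn : 0 < ‖x‖ := norm_pos_iff.mpr hx
    have h1 := hasFDerivAt_norm_E3 hx
    have h2 : HasDerivAt Q (deriv Q ‖x‖) ‖x‖ :=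
      (hQ.differentiable (by simp)).differentiableAt.hasDerivAt
    have h3 : HasDerivAt (fun s : ℝ => (s ^ 3)⁻¹) (-(3 * ‖x‖ ^ 2) / (‖x‖ ^ 3) ^ 2) ‖x‖ := by
      refine ((hasDerivAt_pow 3 ‖x‖).inv (by positivity)).congr_deriv ?_
      norm_num
    have h4 := h2.comp_hasFDerivAt x h1
    have h5 := h3.comp_hasFDerivAt x h1
    have key : ∀ i, partialDeriv i (fun x : E3 => Q ‖x‖ * coulombField i x) x =
        Q ‖x‖ * (x i * (-(3 * ‖x‖ ^ 2) / (‖x‖ ^ 3) ^ 2 * (‖x‖⁻¹ * x i)) + (‖x‖ ^ 3)⁻¹)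
        + (x i * (‖x‖ ^ 3)⁻¹) * (deriv Q ‖x‖ * (‖x‖⁻¹ * x i)) := by
      intro i
      have h6 : HasFDerivAt (fun y : E3 => y i)
          (EuclideanSpace.proj (𝕜 := ℝ) i : E3 →L[ℝ] ℝ) x :=
        (EuclideanSpace.proj (𝕜 := ℝ) i : E3 →L[ℝ] ℝ).hasFDerivAt
      have h7 := h4.mul (h6.mul h5)
      have h8 := h7.fderiv
      rw [partialDeriv]
      have h9 : (fun x : E3 => Q ‖x‖ * coulombField i x) =
          ((Q ∘ fun y : E3 => ‖y‖) * ((fun y : E3 => y i) * ((fun s : ℝ => (s ^ 3)⁻¹) ∘ fun y : E3 => ‖y‖))) := rfl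
      rw [h9, h8]
      simp [EuclideanSpace.inner_single_right]
      ring
    simp_rw [key]
    have hsum : ∑ i, x i ^ 2 = ‖x‖ ^ 2 := by
      rw [EuclideanSpace.norm_sq_eq]; simp
    have : ∀ i, Q ‖x‖ * (x i * (-(3 * ‖x‖ ^ 2) / (‖x‖ ^ 3) ^ 2 * (‖x‖⁻¹ * x i)) + (‖x‖ ^ 3)⁻¹)
        + (x i * (‖x‖ ^ 3)⁻¹) * (deriv Q ‖x‖ * (‖x‖⁻¹ * x i)) =
        x i ^ 2 * (Q ‖x‖ * (-(3 * ‖x‖ ^ 2) / (‖x‖ ^ 3) ^ 2 * ‖x‖⁻¹) +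
          (‖x‖ ^ 3)⁻¹ * deriv Q ‖x‖ * ‖x‖⁻¹) + Q ‖x‖ * (‖x‖ ^ 3)⁻¹ := fun i => by ring
    simp_rw [this]
    rw [Finset.sum_add_distrib, ← Finset.sum_mul, hsum]
    simp
    field_simp
    ring

lemma isTest_mul_coulombField {Q : ℝ → ℝ} (hQ : ContDiff ℝ ∞ Q) {r₀ r₁ : ℝ} (hr₀ : 0 < r₀)
    (h0 : ∀ r ≤ r₀, Q r = 0) (h1 : ∀ r, r₁ ≤ r → Q r = 0) (i : Fin 3) :
    IsTest (fun x : E3 => Q ‖x‖ * coulombField i x) := by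
  refine ⟨contDiff_mul_coulombField hQ hr₀ h0 i, ?_⟩
  refine HasCompactSupport.of_support_subset_isCompact (isCompact_closedBall (0 : E3) r₁) ?_
  intro x hx
  by_contra hx1
  apply hx
  have : r₁ ≤ ‖x‖ := by simpa using (not_le.mp (by simpa using hx1)).le
  simp [h1 _ this]

lemma integral_deriv_radial {Q : ℝ → ℝ} (hQ : ContDiff ℝ ∞ Q) {r₀ r₁ : ℝ} (hr₀ : 0 < r₀)
    (h0 : ∀ r ≤ r₀, Q r = 0) (h1 : ∀ r, r₁ ≤ r → Q r = 0) (u : H1) :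
    ∫ x, (deriv Q ‖x‖ * (‖x‖ ^ 2)⁻¹) • fn u x =
      - ∑ i, ∫ x, (Q ‖x‖ * coulombField i x) • grad u i x := by
  simp_rw [← sum_partialDeriv_mul_coulombField hQ hr₀ h0, Finset.sum_smul]
  rw [integral_finsetSum, ← Finset.sum_neg_distrib]
  · exact Finset.sum_congr rfl fun i _ => u.2 i _ (isTest_mul_coulombField hQ hr₀ h0 h1 i)
  · intro i _
    have ht := isTest_mul_coulombField hQ hr₀ h0 h1 i
    exact IsTest.integrable_smul (ht.continuous_partialDeriv i) (ht.hasCompactSupport_partialDeriv i) _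

/-! ### The radial representation formula -/

lemma exists_abs_deriv_smoothTransition_le : ∃ M, 0 ≤ M ∧ ∀ s, |deriv Real.smoothTransition s| ≤ M := by
  have hc : Continuous (deriv Real.smoothTransition) :=
    (Real.smoothTransition.contDiff (n := 1)).continuous_deriv le_rfl
  obtain ⟨M, hM⟩ := (isCompact_Icc (a := (0 : ℝ)) (b := 1)).exists_bound_of_continuousOn hc.continuousOn
  refine ⟨max M 0, le_max_right _ _, fun s => ?_⟩
  by_cases hs : s ∈ Icc (0 : ℝ) 1
  · exact (hM s hs).trans (le_max_left _ _)
  · have : deriv Real.smoothTransition s = 0 := by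
      rcases lt_or_ge s 0 with h | h
      · have : Real.smoothTransition =ᶠ[𝓝 s] fun _ => 0 := by
          filter_upwards [Iio_mem_nhds h] with y hy
          exact Real.smoothTransition.zero_of_nonpos (le_of_lt hy)
        rw [this.deriv_eq]; simp
      · have h1 : 1 < s := by
          by_contra h2
          exact hs ⟨h, not_lt.mp h2⟩
        have : Real.smoothTransition =ᶠ[𝓝 s] fun _ => 1 := by
          filter_upwards [Ioi_mem_nhds h1] with y hy
          exact Real.smoothTransition.one_of_one_le (le_of_lt hy)
        rw [this.deriv_eq]; simp
    rw [this, abs_zero]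
    exact le_max_right _ _

section Rep

variable {κ : ℝ → ℝ} {r₀ r₁ : ℝ}

lemma contDiff_primitive (hκ : ContDiff ℝ ∞ κ) : ContDiff ℝ ∞ (fun r => ∫ s in r₀..r, κ s) := by
  have h1 : ∀ r, HasDerivAt (fun r => ∫ s in r₀..r, κ s) (κ r) r := fun r =>
    intervalIntegral.integral_hasDerivAt_right (hκ.continuous.intervalIntegrable _ _)
      (hκ.continuous.stronglyMeasurableAtFilter _ _) hκ.continuous.continuousAt
  rw [contDiff_infty_iff_deriv]
  refine ⟨fun r => (h1 r).differentiableAt, ?_⟩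
  rw [show deriv (fun r => ∫ s in r₀..r, κ s) = κ from funext fun r => (h1 r).deriv]
  exact hκ

lemma deriv_primitive (hκ : ContDiff ℝ ∞ κ) (r : ℝ) : deriv (fun r => ∫ s in r₀..r, κ s) r = κ r :=
  (intervalIntegral.integral_hasDerivAt_right (hκ.continuous.intervalIntegrable _ _)
      (hκ.continuous.stronglyMeasurableAtFilter _ _) hκ.continuous.continuousAt).deriv

lemma primitive_eq_zero (h0 : ∀ r ≤ r₀, κ r = 0) {r : ℝ} (hr : r ≤ r₀) :
    ∫ s in r₀..r, κ s = 0 := by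
  refine intervalIntegral.integral_zero_ae (ae_of_all _ fun s hs => ?_)
  rw [uIoc_of_ge hr] at hs
  exact h0 s hs.2

lemma hasCompactSupport_of_eq_zero (h0 : ∀ r ≤ r₀, κ r = 0) (h1 : ∀ r, r₁ ≤ r → κ r = 0) :
    HasCompactSupport κ :=
  HasCompactSupport.of_support_subset_isCompact (isCompact_Icc (a := r₀) (b := r₁)) fun r hr => by
    by_contra h
    rw [mem_Icc, not_and_or, not_le, not_le] at h
    rcases h with h | h
    · exact hr (h0 r h.le)
    · exact hr (h1 r h.le)

lemma abs_primitive_le (hc : Continuous κ) (hs : HasCompactSupport κ) (r : ℝ) :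
    |∫ s in r₀..r, κ s| ≤ ∫ s, |κ s| := by
  rw [← Real.norm_eq_abs]
  refine (intervalIntegral.norm_integral_le_integral_norm_uIoc).trans ?_
  exact setIntegral_le_integral (hc.integrable_of_hasCompactSupport hs).norm
    (ae_of_all _ fun s => norm_nonneg _)

/-- The primitive Q of κ need not vanish at infinity, so `integral_deriv_radial` does not apply to
it. It is truncated at radius n and the truncation removed by dominated convergence: |x|⁻² is square
integrable at infinity, so even a merely bounded Q is harmless. -/
lemma integral_radial_test (hκ : ContDiff ℝ ∞ κ) (hr₀ : 0 < r₀)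
    (h0 : ∀ r ≤ r₀, κ r = 0) (h1 : ∀ r, r₁ ≤ r → κ r = 0) (u : H1) :
    ∫ x, (κ ‖x‖ * (‖x‖ ^ 2)⁻¹) • fn u x =
      - ∑ i, ∫ x, ((∫ s in r₀..‖x‖, κ s) * coulombField i x) • grad u i x := by
  obtain ⟨M, hM0, hM⟩ := exists_abs_deriv_smoothTransition_le
  have hs := hasCompactSupport_of_eq_zero h0 h1
  set Q : ℝ → ℝ := fun r => ∫ s in r₀..r, κ s with hQ
  have hQs : ContDiff ℝ ∞ Q := contDiff_primitive hκ
  set A := ∫ s, |κ s|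
  have hA : ∀ r, |Q r| ≤ A := abs_primitive_le hκ.continuous hs
  have hA0 : 0 ≤ A := (abs_nonneg _).trans (hA 0)
  have hQ0 : ∀ r ≤ r₀, Q r = 0 := fun r hr => primitive_eq_zero h0 hr
  obtain ⟨B, hB⟩ := hκ.continuous.bounded_above_of_compact_support hs
  -- χ n equals 1 up to radius n + 1 and 0 from radius 2(n + 1) on, with derivative bounded
  -- uniformly in n.
  set χ : ℕ → ℝ → ℝ := fun n r => Real.smoothTransition (2 - r / (n + 1))
  have hχs : ∀ n, ContDiff ℝ ∞ (χ n) := fun n => by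
    refine Real.smoothTransition.contDiff.comp ?_
    fun_prop
  have hχ1 : ∀ n r, |χ n r| ≤ 1 := fun n r => by
    rw [abs_of_nonneg (Real.smoothTransition.nonneg _)]
    exact Real.smoothTransition.le_one _
  have hχd : ∀ n r, |deriv (χ n) r| ≤ M := fun n r => by
    have : HasDerivAt (χ n) (deriv Real.smoothTransition (2 - r / (n + 1)) * (-(1 / (n + 1)))) r := by
      have e1 : HasDerivAt (fun r : ℝ => 2 - r / ((n : ℝ) + 1)) (-(1 / (n + 1))) r :=
        ((hasDerivAt_id r).div_const _).const_sub 2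
      exact ((Real.smoothTransition.contDiff (n := 1)).differentiable
        (by simp)).differentiableAt.hasDerivAt.comp r e1
    rw [this.deriv, abs_mul, abs_neg, abs_of_nonneg (by positivity : (0 : ℝ) ≤ 1 / (n + 1))]
    calc _ ≤ M * 1 := by
          gcongr
          · exact hM _
          · rw [div_le_one (by positivity)]; linarith [(Nat.cast_nonneg n : (0 : ℝ) ≤ n)]
      _ = M := mul_one M
  have hχe : ∀ r : ℝ, ∀ᶠ n : ℕ in atTop, ∀ᶠ s in 𝓝 r, χ n s = 1 := by
    intro r
    obtain ⟨N, hN⟩ := exists_nat_gt r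
    filter_upwards [eventually_ge_atTop N] with n hn
    have h2 : r < n + 1 := by
      have : (N : ℝ) ≤ n := by exact_mod_cast hn
      linarith
    filter_upwards [Iio_mem_nhds h2] with s hs
    refine Real.smoothTransition.one_of_one_le ?_
    have : s / ((n : ℝ) + 1) ≤ 1 := (div_le_one (by positivity)).mpr (le_of_lt hs)
    linarith
  have hz : ∀ n : ℕ, ∀ r, 2 * ((n : ℝ) + 1) ≤ r → (Q * χ n) r = 0 := by
    intro n r hr
    have : χ n r = 0 := Real.smoothTransition.zero_of_nonpos (by
      have : 2 ≤ r / ((n : ℝ) + 1) := (le_div_iff₀ (by positivity)).mpr hr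
      linarith)
    simp [this]
  have hz0 : ∀ n : ℕ, ∀ r ≤ r₀, (Q * χ n) r = 0 := fun n r hr => by simp [hQ0 r hr]
  have hid : ∀ n : ℕ, _ := fun n =>
    integral_deriv_radial (Q := Q * χ n) (hQs.mul (hχs n)) hr₀ (hz0 n) (hz n) u
  have hd : ∀ n r, deriv (Q * χ n) r = κ r * χ n r + Q r * deriv (χ n) r := by
    intro n r
    rw [deriv_mul (hQs.differentiable (by simp)).differentiableAt
      ((hχs n).differentiable (by simp)).differentiableAt, deriv_primitive hκ]
  have hl1 : Tendsto (fun n => ∫ x, (deriv (Q * χ n) ‖x‖ * (‖x‖ ^ 2)⁻¹) • fn u x) atTop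
      (𝓝 (∫ x, (κ ‖x‖ * (‖x‖ ^ 2)⁻¹) • fn u x)) := by
    refine tendsto_integral_of_dominated_convergence
      (fun x => (B + A * M) * (tailKernel (r₀ / 2) x * ‖fn u x‖)) ?_ ?_ ?_ ?_
    · intro n
      have : Continuous (deriv (Q * χ n)) := (hQs.mul (hχs n)).continuous_deriv (by simp)
      refine AEStronglyMeasurable.smul (f := fun x : E3 => deriv (Q * χ n) ‖x‖ * (‖x‖ ^ 2)⁻¹) ?_
        (Lp.aestronglyMeasurable (valL u))
      exact Measurable.aestronglyMeasurable (by fun_prop)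
    · exact (integrable_mul_tailKernel (half_pos hr₀) _).const_mul _
    · intro n
      refine ae_of_all _ fun x => ?_
      rw [norm_smul, norm_mul, ← mul_assoc]
      refine mul_le_mul_of_nonneg_right ?_ (norm_nonneg _)
      by_cases hx : r₀ / 2 < ‖x‖
      · have e1 : tailKernel (r₀ / 2) x = (‖x‖ ^ 2)⁻¹ := by simp [tailKernel, hx]
        rw [e1, Real.norm_of_nonneg (by positivity : 0 ≤ (‖x‖ ^ 2)⁻¹)]
        gcongr
        rw [hd, Real.norm_eq_abs]
        refine (abs_add_le _ _).trans ?_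
        rw [abs_mul, abs_mul]
        have := hB ‖x‖
        rw [Real.norm_eq_abs] at this
        nlinarith [hχ1 n ‖x‖, hA ‖x‖, hχd n ‖x‖, abs_nonneg (κ ‖x‖), abs_nonneg (χ n ‖x‖),
          abs_nonneg (Q ‖x‖), abs_nonneg (deriv (χ n) ‖x‖)]
      · have e2 : ‖x‖ ≤ r₀ := by linarith
        have e3 : tailKernel (r₀ / 2) x = 0 := by simp [tailKernel, hx]
        rw [hd, h0 _ e2, hQ0 _ e2, e3]
        simp
    · refine ae_of_all _ fun x => ?_
      refine Tendsto.congr' ?_ tendsto_const_nhds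
      filter_upwards [hχe ‖x‖] with n hn
      have e1 : χ n =ᶠ[𝓝 ‖x‖] fun _ => 1 := hn
      rw [hd, e1.deriv_eq, e1.eq_of_nhds]
      simp
  have hl2 : Tendsto (fun n => - ∑ i, ∫ x, ((Q * χ n) ‖x‖ * coulombField i x) • grad u i x) atTop
      (𝓝 (- ∑ i, ∫ x, (Q ‖x‖ * coulombField i x) • grad u i x)) := by
    refine (tendsto_finsetSum _ fun i _ => ?_).neg
    refine tendsto_integral_of_dominated_convergence
      (fun x => A * (tailKernel (r₀ / 2) x * ‖grad u i x‖)) ?_ ?_ ?_ ?_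
    · intro n
      have : Continuous (Q * χ n) := (hQs.mul (hχs n)).continuous
      refine AEStronglyMeasurable.smul (f := fun x : E3 => (Q * χ n) ‖x‖ * coulombField i x) ?_
        (Lp.aestronglyMeasurable (gradL i u))
      have := measurable_coulombField i
      exact Measurable.aestronglyMeasurable (by fun_prop)
    · exact (integrable_mul_tailKernel (half_pos hr₀) _).const_mul _
    · intro n
      refine ae_of_all _ fun x => ?_
      rw [norm_smul, norm_mul, ← mul_assoc]
      refine mul_le_mul_of_nonneg_right ?_ (norm_nonneg _)
      by_cases hx : r₀ / 2 < ‖x‖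
      · have e1 : tailKernel (r₀ / 2) x = (‖x‖ ^ 2)⁻¹ := by simp [tailKernel, hx]
        rw [e1]
        gcongr
        · rw [Pi.mul_apply, norm_mul]
          calc _ ≤ A * 1 := mul_le_mul (hA _) (hχ1 n _) (abs_nonneg _) hA0
            _ = A := mul_one A
        · exact abs_coulombField_le i x
      · have e2 : ‖x‖ ≤ r₀ := by linarith
        have e3 : tailKernel (r₀ / 2) x = 0 := by simp [tailKernel, hx]
        rw [hz0 n _ e2, e3]
        simp
    · refine ae_of_all _ fun x => ?_
      refine Tendsto.congr' ?_ tendsto_const_nhds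
      filter_upwards [hχe ‖x‖] with n hn
      rw [Pi.mul_apply, hn.self_of_nhds, mul_one]
  exact tendsto_nhds_unique hl1 (hl2.congr fun n => (hid n).symm)

lemma measurable_tailField_uncurry (i : Fin 3) :
    Measurable (fun p : E3 × ℝ => tailField i p.2 p.1) := by
  have : (fun p : E3 × ℝ => tailField i p.2 p.1) =
      {p : E3 × ℝ | p.2 < ‖p.1‖}.indicator (fun p => coulombField i p.1) := by
    ext p
    by_cases h : p.2 < ‖p.1‖ <;> simp [tailField, h]
  rw [this]
  exact ((measurable_coulombField i).comp measurable_fst).indicator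
    (measurableSet_lt measurable_snd (measurable_norm.comp measurable_fst))

/-- Fubini, after writing the primitive at |x| as the integral of κ(r) over r < |x|: the indicator
of that condition truncates the Coulomb field to the exterior of the ball of radius r. -/
lemma integral_primitive_mul (hκ : Continuous κ) (hr₀ : 0 < r₀)
    (h0 : ∀ r ≤ r₀, κ r = 0) (h1 : ∀ r, r₁ ≤ r → κ r = 0) (i : Fin 3) (g : L2) :
    ∫ x, ((∫ s in r₀..‖x‖, κ s) * coulombField i x) • g x =
      ∫ r, κ r • ∫ x, tailField i r x • g x := by
  have hs := hasCompactSupport_of_eq_zero h0 h1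
  have hi := hκ.integrable_of_hasCompactSupport (μ := volume) hs
  have e1 : ∀ x, ((∫ s in r₀..‖x‖, κ s) * coulombField i x) • g x =
      ∫ r, (κ r * tailField i r x) • g x := by
    intro x
    rw [integral_smul_const]
    congr 1
    have e2 : ∀ r, κ r * tailField i r x = (Iio ‖x‖).indicator κ r * coulombField i x := by
      intro r
      by_cases h : r < ‖x‖ <;> simp [tailField, h]
    simp_rw [e2]
    rw [integral_mul_const, integral_indicator measurableSet_Iio]
    congr 1
    rw [← integral_Iic_eq_integral_Iio]
    rw [← intervalIntegral.integral_Iic_sub_Iic hi.integrableOn hi.integrableOn]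
    have : ∫ x in Iic r₀, κ x = 0 := setIntegral_eq_zero_of_forall_eq_zero fun r hr => h0 r hr
    rw [this, sub_zero]
  simp_rw [e1]
  rw [integral_integral_swap]
  · simp_rw [← integral_smul, mul_smul]
  · have hdom : Integrable (fun p : E3 × ℝ => (tailKernel r₀ p.1 * ‖g p.1‖) * |κ p.2|)
        ((volume : Measure E3).prod (volume : Measure ℝ)) :=
      (integrable_mul_tailKernel hr₀ g).mul_prod hi.norm
    refine hdom.mono ?_ (ae_of_all _ fun p => ?_)
    · have m1 := measurable_tailField_uncurry i
      have m2 := (Lp.stronglyMeasurable g).measurable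
      have m3 := hκ.measurable
      exact (Measurable.smul ((m3.comp measurable_snd).mul m1) (m2.comp measurable_fst)).aestronglyMeasurable
    · rcases le_or_gt p.2 r₀ with h | h
      · simp [Function.uncurry, h0 _ h]
      · have : |tailField i p.2 p.1| ≤ tailKernel r₀ p.1 := by
          refine (abs_tailField_le _ _ _).trans ?_
          by_cases h' : p.2 < ‖p.1‖
          · simp [tailKernel, h', h.trans h']
          · rw [tailKernel, indicator_of_notMem (by simpa using h')]
            exact tailKernel_nonneg _ _
        simp only [Function.uncurry, norm_smul, norm_mul, Real.norm_eq_abs, abs_abs, abs_norm]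
        rw [abs_of_nonneg (tailKernel_nonneg r₀ p.1)]
        calc |κ p.2| * |tailField i p.2 p.1| * ‖g p.1‖ ≤ |κ p.2| * tailKernel r₀ p.1 * ‖g p.1‖ := by
              gcongr
          _ = _ := by ring

end Rep

/-- The value at radius `r` of a radial function, up to the factor `sphereArea`, in terms of its
gradient outside the ball of radius `r`. -/
def tailValue (u : H1) (r : ℝ) : ℂ := - ∑ i, ∫ x, tailField i r x • grad u i x

/-- `tailValue` as a continuous linear functional. -/
def tailValueL (r : ℝ) (hr : 0 < r) : H1 →L[ℂ] ℂ :=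
  - ∑ i, (pairing _ (memLp_tailField i hr)).comp (gradL i)

lemma tailValueL_apply (r : ℝ) (hr : 0 < r) (u : H1) : tailValueL r hr u = tailValue u r := by
  simp [tailValueL, tailValue, pairing_apply, grad_eq]

lemma measurable_tailValue (u : H1) : Measurable (tailValue u) := by
  refine (Finset.measurable_fun_sum _ fun i _ => ?_).neg
  have m1 := measurable_tailField_uncurry i
  have m2 := (Lp.stronglyMeasurable (gradL i u)).measurable
  have m3 : StronglyMeasurable (Function.uncurry fun (r : ℝ) (x : E3) => tailField i r x • grad u i x) := by
    refine Measurable.stronglyMeasurable ?_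
    exact Measurable.smul (m1.comp measurable_swap) (m2.comp measurable_snd)
  exact m3.integral_prod_right.measurable

lemma norm_tailValue_le (u : H1) {r : ℝ} (hr : 0 < r) :
    ‖tailValue u r‖ ≤ 3 * Real.sqrt (sphereArea / r) * Real.sqrt (kinetic u) := by
  rw [tailValue, norm_neg]
  refine (norm_sum_le _ _).trans ?_
  have : ∀ i ∈ (Finset.univ : Finset (Fin 3)), ‖∫ x, tailField i r x • grad u i x‖ ≤
      Real.sqrt (sphereArea / r) * Real.sqrt (kinetic u) := by
    intro i _
    refine (norm_pairing_le _ (memLp_tailField i hr) (gradL i u)).trans ?_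
    gcongr
    · exact integral_tailField_sq_le i hr
    · exact Real.le_sqrt_of_sq_le (norm_gradL_sq_le u i)
  refine (Finset.sum_le_card_nsmul _ _ _ this).trans ?_
  simp [mul_assoc]

/-- The representation formula. Both sides have the same integral against every κ in C_c^∞(0, ∞):
polar coordinates treat the profile, Fubini the tail, and `integral_radial_test` links the two.
Hence they agree for a.e. radius, and so at a.e. point. -/
lemma ae_sphereArea_smul_eq {u : H1} {f : ℝ → ℂ} (hf : ∀ᵐ x : E3, fn u x = f ‖x‖) :
    ∀ᵐ x : E3, sphereArea • fn u x = tailValue u ‖x‖ := by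
  -- The weight y² of polar coordinates cancels the factor y⁻² of the tail kernel, and the kernel
  -- times |u| is integrable by Cauchy–Schwarz.
  have hfi : ∀ r, 0 < r → IntegrableOn f (Ioi r) := by
    intro r hr
    have h1 : Integrable (fun x : E3 => (fun s => (Ioi r).indicator (fun s : ℝ => (s ^ 2)⁻¹) s • f s) ‖x‖) := by
      have : Integrable (fun x => tailKernel r x • fn u x) := by
        refine (integrable_mul_tailKernel hr (valL u)).mono
          ((measurable_tailKernel r).aestronglyMeasurable.smul (Lp.aestronglyMeasurable _))
          (ae_of_all _ fun x => ?_)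
        simp [fn_eq]
      refine this.congr ?_
      filter_upwards [hf] with x hx
      rw [hx]; rfl
    rw [integrable_radial (f := fun s => (Ioi r).indicator (fun s : ℝ => (s ^ 2)⁻¹) s • f s)] at h1
    refine IntegrableOn.congr_fun (h1.mono_set (Ioi_subset_Ioi hr.le)) ?_ measurableSet_Ioi
    intro y hy
    have hy' : 0 < y := hr.trans hy
    simp only [indicator_of_mem hy]
    rw [smul_smul, mul_inv_cancel₀ (by positivity), one_smul]
  have hloc : LocallyIntegrableOn (fun r => sphereArea • f r - tailValue u r) (Ioi (0 : ℝ)) := by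
    intro r hr
    have hr : 0 < r := hr
    refine ⟨Ioo (r / 2) (2 * r), mem_nhdsWithin_of_mem_nhds (Ioo_mem_nhds (by linarith) (by linarith)), ?_⟩
    refine Integrable.sub ?_ ?_
    · exact ((hfi (r / 2) (half_pos hr)).mono_set Ioo_subset_Ioi_self).smul (sphereArea : ℝ)
    · refine Measure.integrableOn_of_bounded (M := 3 * Real.sqrt (sphereArea / (r / 2)) * Real.sqrt (kinetic u))
        (by simp) (measurable_tailValue u).aestronglyMeasurable ?_
      refine (ae_restrict_iff' measurableSet_Ioo).mpr (ae_of_all _ fun s hs => ?_)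
      refine (norm_tailValue_le u ((half_pos hr).trans hs.1)).trans ?_
      have := sphereArea_pos
      gcongr
      exact hs.1.le
  have hmain := isOpen_Ioi.ae_eq_zero_of_integral_contDiff_smul_eq_zero hloc (by
    intro κ hκ hκs hκ0
    -- The compact support of κ in (0, ∞) is bounded away from 0; the case of empty support is
    -- separate because it has no least element.
    have hr : ∃ r₀ r₁ : ℝ, 0 < r₀ ∧ (∀ r ≤ r₀, κ r = 0) ∧ ∀ r, r₁ ≤ r → κ r = 0 := by
      rcases (tsupport κ).eq_empty_or_nonempty with he | hne
      · have : ∀ r, κ r = 0 := fun r => by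
          have := tsupport_eq_empty_iff.mp he
          simp [this]
        exact ⟨1, 1, one_pos, fun r _ => this r, fun r _ => this r⟩
      · obtain ⟨a, ha, hmin⟩ := hκs.isCompact.exists_isLeast hne
        obtain ⟨b, hb⟩ := hκs.isCompact.bddAbove
        have ha0 : 0 < a := hκ0 ha
        refine ⟨a / 2, b + 1, half_pos ha0, fun r hr => ?_, fun r hr => ?_⟩
        · refine image_eq_zero_of_notMem_tsupport fun h => ?_
          have := hmin h
          linarith
        · refine image_eq_zero_of_notMem_tsupport fun h => ?_
          have := hb h
          linarith
    obtain ⟨r₀, r₁, hr₀, h0, h1⟩ := hr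
    have e1 := integral_radial_test hκ hr₀ h0 h1 u
    have hL : ∫ x, (κ ‖x‖ * (‖x‖ ^ 2)⁻¹) • fn u x = ∫ r, κ r • (sphereArea • f r) := by
      have : ∫ x, (κ ‖x‖ * (‖x‖ ^ 2)⁻¹) • fn u x =
          ∫ x : E3, (fun r => (κ r * (r ^ 2)⁻¹) • f r) ‖x‖ := by
        refine integral_congr_ae ?_
        filter_upwards [hf] with x hx
        rw [hx]
      rw [this, integral_radial (fun r => (κ r * (r ^ 2)⁻¹) • f r), ← integral_smul]
      rw [← setIntegral_eq_integral_of_forall_compl_eq_zero (s := Ioi 0)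
        (f := fun r => κ r • (sphereArea • f r))]
      · refine setIntegral_congr_fun measurableSet_Ioi fun y hy => ?_
        have hy : (0 : ℝ) < y := hy
        simp only [smul_smul]
        congr 1
        field_simp
      · intro r hr
        rw [h0 r (by have : r ≤ 0 := by simpa using hr
                     linarith), zero_smul]
    have hi : ∀ i, Integrable (fun r => κ r • ∫ x, tailField i r x • grad u i x) := by
      intro i
      have m1 := measurable_tailField_uncurry i
      have m2 := (Lp.stronglyMeasurable (gradL i u)).measurable
      have m3 : StronglyMeasurable (Function.uncurry fun (r : ℝ) (x : E3) => tailField i r x • grad u i x) := by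
        refine Measurable.stronglyMeasurable ?_
        exact Measurable.smul (m1.comp measurable_swap) (m2.comp measurable_snd)
      refine ((hκ.continuous.integrable_of_hasCompactSupport (μ := volume) hκs).mul_const
        (Real.sqrt (sphereArea / r₀) * ‖gradL i u‖)).mono
        (hκ.continuous.aestronglyMeasurable.smul m3.integral_prod_right.aestronglyMeasurable) ?_
      refine ae_of_all _ fun r => ?_
      rcases le_or_gt r r₀ with h | h
      · simp [h0 r h]
      · rw [norm_smul, norm_mul]
        gcongr
        refine (norm_pairing_le _ (memLp_tailField i (hr₀.trans h)) (gradL i u)).trans ?_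
        rw [Real.norm_of_nonneg (by positivity)]
        gcongr
        refine (integral_tailField_sq_le i (hr₀.trans h)).trans ?_
        have := sphereArea_pos
        gcongr
    have hR : ∫ r, κ r • tailValue u r =
        - ∑ i, ∫ x, ((∫ s in r₀..‖x‖, κ s) * coulombField i x) • grad u i x := by
      simp_rw [tailValue, smul_neg, Finset.smul_sum]
      rw [integral_neg, integral_finsetSum _ fun i _ => hi i]
      congr 1
      exact Finset.sum_congr rfl fun i _ =>
        (integral_primitive_mul hκ.continuous hr₀ h0 h1 i (gradL i u)).symm
    have hi2 : Integrable (fun r => κ r • tailValue u r) := by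
      have := (integrable_finsetSum Finset.univ fun i _ => hi i).neg
      refine this.congr (ae_of_all _ fun r => ?_)
      simp [tailValue, Finset.smul_sum]
    have hi1 : Integrable (fun r => κ r • (sphereArea • f r)) := by
      have hfr : IntegrableOn (fun r => κ r • (sphereArea • f r)) (Ioi (r₀ / 2)) := by
        obtain ⟨B, hB⟩ := hκ.continuous.bounded_above_of_compact_support hκs
        exact Integrable.bdd_smul ((hfi (r₀ / 2) (half_pos hr₀)).smul sphereArea) B
          hκ.continuous.aestronglyMeasurable (ae_of_all _ hB)
      refine (integrableOn_iff_integrable_of_support_subset ?_).mp hfr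
      intro r hr
      by_contra h
      apply hr
      have : r ≤ r₀ / 2 := by simpa using h
      simp [h0 r (by linarith)]
    simp_rw [smul_sub]
    rw [integral_sub hi1 hi2, ← hL, hR, e1, sub_self])
  have h2 := ae_norm_of_ae (p := fun r => sphereArea • f r - tailValue u r = 0) (by
    filter_upwards [hmain] with r hr h using hr h)
  filter_upwards [hf, h2] with x hx hx2
  rw [hx]
  exact sub_eq_zero.mp hx2

/-! ### Pointwise decay of radial functions and its consequences -/

/-- The constant in the pointwise decay estimate. -/
def decayConst : ℝ := 9 / sphereArea

lemma decayConst_pos : 0 < decayConst := div_pos (by norm_num) sphereArea_pos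

lemma ae_ne_zero_E3 : ∀ᵐ x : E3, x ≠ 0 := by simp [ae_iff]

/-- Cauchy–Schwarz in the representation formula, the truncated field having squared norm at most
sphereArea/|x|. The 9 in `decayConst` is 3², from summing the three components by the triangle
inequality. -/
lemma ae_norm_sq_le {u : H1} (hu : u ∈ H1r) :
    ∀ᵐ x : E3, ‖fn u x‖ ^ 2 ≤ decayConst * kinetic u / ‖x‖ := by
  obtain ⟨f, hf⟩ := hu
  filter_upwards [ae_sphereArea_smul_eq hf, ae_ne_zero_E3] with x hx hx0
  have hn : 0 < ‖x‖ := norm_pos_iff.mpr hx0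
  have hs := sphereArea_pos
  have h1 := norm_tailValue_le u hn
  rw [← hx, norm_smul, Real.norm_of_nonneg hs.le] at h1
  have h2 := pow_le_pow_left₀ (by positivity) h1 2
  rw [mul_pow, mul_pow, mul_pow, Real.sq_sqrt (by positivity), Real.sq_sqrt (kinetic_nonneg u)] at h2
  rw [decayConst]
  have h3 : ‖fn u x‖ ^ 2 * sphereArea ^ 2 ≤ (9 / sphereArea * kinetic u / ‖x‖) * sphereArea ^ 2 := by
    calc _ = sphereArea ^ 2 * ‖fn u x‖ ^ 2 := by ring
      _ ≤ _ := h2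
      _ = _ := by field_simp; ring
  exact le_of_mul_le_mul_right h3 (by positivity)

/-- The value at a given radius is the continuous functional `tailValueL` divided by the sphere
area, so weak convergence gives pointwise convergence directly, without a compact embedding or a
subsequence. -/
lemma ae_tendsto_of_weakTendsto {w : ℕ → H1} {u : H1} (hw : ∀ n, w n ∈ H1r) (hu : u ∈ H1r)
    (h : WeakTendsto w u) : ∀ᵐ x : E3, Tendsto (fun n => fn (w n) x) atTop (𝓝 (fn u x)) := by
  obtain ⟨f, hf⟩ := hu
  have h1 : ∀ n, ∀ᵐ x : E3, sphereArea • fn (w n) x = tailValue (w n) ‖x‖ := fun n => by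
    obtain ⟨g, hg⟩ := hw n
    exact ae_sphereArea_smul_eq hg
  filter_upwards [ae_all_iff.mpr h1, ae_sphereArea_smul_eq hf, ae_ne_zero_E3] with x hx hxu hx0
  have hn : 0 < ‖x‖ := norm_pos_iff.mpr hx0
  have h2 := h (tailValueL ‖x‖ hn)
  simp_rw [tailValueL_apply, ← hx, ← hxu] at h2
  have h3 := h2.const_smul sphereArea⁻¹
  simpa only [smul_smul, inv_mul_cancel₀ sphereArea_pos.ne', one_smul] using h3

lemma integrable_norm_sq (u : H1) : Integrable (fun x => ‖fn u x‖ ^ 2) :=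
  (Lp.memLp (valL u)).norm.integrable_sq

lemma measurable_fn (u : H1) : Measurable (fn u) := (Lp.stronglyMeasurable (valL u)).measurable

/-- The kernel `|x|⁻ˢ` on the ball of radius `δ`. -/
def nearKernel (s δ : ℝ) (x : E3) : ℝ := (Iio δ).indicator (fun r => r ^ (-s)) ‖x‖

lemma nearKernel_nonneg (s δ : ℝ) (x : E3) : 0 ≤ nearKernel s δ x := by
  by_cases h : ‖x‖ < δ
  · simp only [nearKernel, indicator_of_mem (mem_Iio.mpr h)]; positivity
  · simp [nearKernel, h]

lemma nearKernel_integral {s δ : ℝ} (hs : s < 3) (hδ : 0 < δ) :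
    Integrable (nearKernel s δ) ∧ ∫ x, nearKernel s δ x = sphereArea * (δ ^ (3 - s) / (3 - s)) := by
  have h1 : ∀ y ∈ Ioi (0 : ℝ), y ^ 2 • (Iio δ).indicator (fun r : ℝ => r ^ (-s)) y =
      (Iio δ).indicator (fun r : ℝ => r ^ (2 - s)) y := by
    intro y hy
    have hy : 0 < y := hy
    by_cases hyr : y ∈ Iio δ
    · simp only [indicator_of_mem hyr, smul_eq_mul]
      rw [← Real.rpow_natCast, ← Real.rpow_add hy]
      norm_num
      rfl
    · simp [indicator_of_notMem hyr]
  have h2 : IntegrableOn (fun r : ℝ => r ^ (2 - s)) (Ioo 0 δ) :=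
    (intervalIntegral.integrableOn_Ioo_rpow_iff hδ).mpr (by linarith)
  have h4 : IntegrableOn ((Iio δ).indicator (fun r : ℝ => r ^ (2 - s))) (Ioi 0) := by
    rw [IntegrableOn, integrable_indicator_iff measurableSet_Iio, IntegrableOn,
      Measure.restrict_restrict measurableSet_Iio, Iio_inter_Ioi]
    exact h2
  constructor
  · exact (integrable_radial (f := (Iio δ).indicator (fun r : ℝ => r ^ (-s)))).mpr
      ((integrableOn_congr_fun h1 measurableSet_Ioi).mpr h4)
  · have := integral_radial ((Iio δ).indicator (fun r : ℝ => r ^ (-s)))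
    refine this.trans ?_
    rw [setIntegral_congr_fun measurableSet_Ioi h1, setIntegral_indicator measurableSet_Iio,
      Ioi_inter_Iio, ← integral_Ioc_eq_integral_Ioo, ← intervalIntegral.integral_of_le hδ.le,
      integral_rpow (by left; linarith), smul_eq_mul]
    congr 1
    rw [Real.zero_rpow (by linarith), sub_zero]
    ring_nf

/-! ### Integrals of powers: Gagliardo–Nirenberg and compactness. -/

section Power

variable {q : ℝ}

/-- Inside the ball of radius δ the decay estimate is used for all q factors |u|². Outside it is
used for q - 1 of them, and the remaining |u|² is kept for the mass. -/
lemma ae_power_le {u : H1} (hu : u ∈ H1r) (hq : 1 < q) {δ : ℝ} (hδ : 0 < δ) :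
    ∀ᵐ x, ‖fn u x‖ ^ (2 * q) ≤ (decayConst * kinetic u) ^ q * nearKernel q δ x +
      (Ici δ).indicator (fun _ => (decayConst * kinetic u / δ) ^ (q - 1)) ‖x‖ * ‖fn u x‖ ^ 2 := by
  have hk := mul_nonneg decayConst_pos.le (kinetic_nonneg u)
  filter_upwards [ae_norm_sq_le hu, ae_ne_zero_E3] with x hx hx0
  have hn : 0 < ‖x‖ := norm_pos_iff.mpr hx0
  have h1 : ‖fn u x‖ ^ (2 * q) = (‖fn u x‖ ^ 2) ^ q := by
    rw [← Real.rpow_natCast, ← Real.rpow_mul (norm_nonneg _)]; norm_num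
  rw [h1]
  rcases lt_or_ge ‖x‖ δ with h | h
  · have h2 : nearKernel q δ x = ‖x‖ ^ (-q) := indicator_of_mem (mem_Iio.mpr h) _
    rw [h2, indicator_of_notMem (by simpa using h), zero_mul, add_zero]
    calc (‖fn u x‖ ^ 2) ^ q ≤ (decayConst * kinetic u / ‖x‖) ^ q :=
          Real.rpow_le_rpow (by positivity) hx (by linarith)
      _ = _ := by rw [Real.div_rpow hk hn.le, Real.rpow_neg hn.le]; rfl
  · have h2 : nearKernel q δ x = 0 := indicator_of_notMem (by simpa using h) _
    rw [h2, mul_zero, zero_add, indicator_of_mem (mem_Ici.mpr h)]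
    calc (‖fn u x‖ ^ 2) ^ q = (‖fn u x‖ ^ 2) ^ (q - 1) * ‖fn u x‖ ^ 2 := by
          rcases eq_or_ne (‖fn u x‖ ^ 2) 0 with h0 | h0
          · rw [h0, Real.zero_rpow (by linarith), mul_zero]
          · conv_rhs => rw [← Real.rpow_add_one h0]
            norm_num
      _ ≤ _ := by
          have : ‖fn u x‖ ^ 2 ≤ decayConst * kinetic u / δ := hx.trans (by gcongr)
          gcongr

lemma integrable_power {u : H1} (hu : u ∈ H1r) (hq : 1 < q) (hq2 : q < 3 / 2) :
    Integrable (fun x => ‖fn u x‖ ^ (2 * q)) := by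
  have h1 := ((nearKernel_integral (s := q) (δ := 1) (by linarith) one_pos).1.const_mul
    ((decayConst * kinetic u) ^ q)).add
    ((integrable_norm_sq u).const_mul ((decayConst * kinetic u / 1) ^ (q - 1)))
  refine h1.mono' ((measurable_fn u).norm.pow_const _).aestronglyMeasurable ?_
  filter_upwards [ae_power_le hu hq one_pos] with x hx
  rw [Real.norm_of_nonneg (by positivity)]
  refine hx.trans ?_
  simp only [Pi.add_apply]
  gcongr
  refine indicator_le_self' (fun _ _ => ?_) _
  have := decayConst_pos
  have := kinetic_nonneg u
  positivity

lemma integral_power_ball_le {u : H1} (hu : u ∈ H1r) (hq : 1 < q) (hq2 : q < 3 / 2) {δ : ℝ}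
    (hδ : 0 < δ) : ∫ x in Metric.ball 0 δ, ‖fn u x‖ ^ (2 * q) ≤
      (decayConst * kinetic u) ^ q * (sphereArea * (δ ^ (3 - q) / (3 - q))) := by
  obtain ⟨h1, h2⟩ := nearKernel_integral (s := q) (by linarith) hδ
  rw [← h2, ← integral_const_mul]
  have h3 : ∫ x in Metric.ball 0 δ, (decayConst * kinetic u) ^ q * nearKernel q δ x ≤
      ∫ x, (decayConst * kinetic u) ^ q * nearKernel q δ x := by
    refine setIntegral_le_integral (h1.const_mul _) (ae_of_all _ fun x => ?_)
    have := decayConst_pos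
    have := kinetic_nonneg u
    have := nearKernel_nonneg q δ x
    simp only [Pi.zero_apply]
    positivity
  refine le_trans ?_ h3
  refine setIntegral_mono_on_ae (integrable_power hu hq hq2).integrableOn
    (h1.const_mul _).integrableOn measurableSet_ball ?_
  filter_upwards [ae_power_le hu hq hδ] with x hx hxb
  refine hx.trans ?_
  rw [indicator_of_notMem (by simpa using hxb), zero_mul, add_zero]

lemma integral_power_compl_ball_le {u : H1} (hu : u ∈ H1r) (hq : 1 < q) (hq2 : q < 3 / 2) {δ : ℝ}
    (hδ : 0 < δ) : ∫ x in (Metric.ball 0 δ)ᶜ, ‖fn u x‖ ^ (2 * q) ≤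
      (decayConst * kinetic u / δ) ^ (q - 1) * mass u := by
  have h0 : 0 ≤ (decayConst * kinetic u / δ) ^ (q - 1) := by
    have := decayConst_pos
    have := kinetic_nonneg u
    positivity
  rw [mass, ← integral_const_mul]
  have h3 : ∫ x in (Metric.ball 0 δ)ᶜ, (decayConst * kinetic u / δ) ^ (q - 1) * ‖fn u x‖ ^ 2 ≤
      ∫ x, (decayConst * kinetic u / δ) ^ (q - 1) * ‖fn u x‖ ^ 2 := by
    refine setIntegral_le_integral ((integrable_norm_sq u).const_mul _) (ae_of_all _ fun x => ?_)
    simp only [Pi.zero_apply]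
    positivity
  refine le_trans ?_ h3
  refine setIntegral_mono_on_ae (integrable_power hu hq hq2).integrableOn
    ((integrable_norm_sq u).const_mul _).integrableOn measurableSet_ball.compl ?_
  filter_upwards [ae_power_le hu hq hδ] with x hx hxb
  refine hx.trans ?_
  have h : δ ≤ ‖x‖ := by simpa using hxb
  rw [indicator_of_mem (mem_Ici.mpr h)]
  have : nearKernel q δ x = 0 := indicator_of_notMem (by simpa using h) _
  rw [this, mul_zero, zero_add]

lemma integral_power_split {u : H1} (hu : u ∈ H1r) (hq : 1 < q) (hq2 : q < 3 / 2) (s : Set E3)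
    (hs : MeasurableSet s) : ∫ x, ‖fn u x‖ ^ (2 * q) =
      (∫ x in s, ‖fn u x‖ ^ (2 * q)) + ∫ x in sᶜ, ‖fn u x‖ ^ (2 * q) :=
  (integral_add_compl hs (integrable_power hu hq hq2)).symm

/-- The constant in the Gagliardo–Nirenberg inequality. -/
def gnConst (q : ℝ) : ℝ := decayConst ^ q * sphereArea / (3 - q) + decayConst ^ (q - 1)

lemma gnConst_pos (hq2 : q < 3 / 2) : 0 < gnConst q := by
  have := decayConst_pos
  have := sphereArea_pos
  have : 0 < 3 - q := by linarith
  unfold gnConst; positivity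

/-- The Gagliardo–Nirenberg inequality for radial functions. -/
lemma integral_power_le {u : H1} (hu : u ∈ H1r) (hq : 1 < q) (hq2 : q < 3 / 2) :
    ∫ x, ‖fn u x‖ ^ (2 * q) ≤
      gnConst q * kinetic u ^ (3 * (q - 1) / 2) * mass u ^ ((3 - q) / 2) := by
  have hD := decayConst_pos
  rcases (kinetic_nonneg u).eq_or_lt with hk | hk
  · have h : ∫ x, ‖fn u x‖ ^ (2 * q) = 0 := by
      refine integral_eq_zero_of_ae ?_
      filter_upwards [ae_norm_sq_le hu] with x hx
      rw [← hk] at hx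
      have : ‖fn u x‖ = 0 := by
        have h1 : ‖fn u x‖ ^ 2 ≤ 0 := by simpa using hx
        nlinarith [norm_nonneg (fn u x)]
      rw [this, Real.zero_rpow (by linarith)]; rfl
    rw [h, ← hk, Real.zero_rpow (by linarith)]
    simp
  rcases (mass_nonneg u).eq_or_lt with hm | hm
  · have h : ∫ x, ‖fn u x‖ ^ (2 * q) = 0 := by
      refine integral_eq_zero_of_ae ?_
      have := (integral_eq_zero_iff_of_nonneg (fun x => by positivity) (integrable_norm_sq u)).mp hm.symm
      filter_upwards [this] with x hx
      have : ‖fn u x‖ = 0 := by simpa using hx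
      rw [this, Real.zero_rpow (by linarith)]; rfl
    rw [h, ← hm, Real.zero_rpow (by linarith)]
    simp
  set k := kinetic u with hkd
  set a := mass u with had
  -- The radius √(mass/kinetic) balances the two regions: both contributions become multiples of
  -- k^{3(q-1)/2} a^{(3-q)/2}.
  have hδ : 0 < (a / k) ^ (1 / 2 : ℝ) := by positivity
  rw [integral_power_split hu hq hq2 _ measurableSet_ball]
  refine (add_le_add (integral_power_ball_le hu hq hq2 hδ)
    (integral_power_compl_ball_le hu hq hq2 hδ)).trans (le_of_eq ?_)
  rw [← hkd, ← had, gnConst]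
  have e1 : (decayConst * k) ^ q * (sphereArea * (((a / k) ^ (1 / 2 : ℝ)) ^ (3 - q) / (3 - q))) =
      decayConst ^ q * sphereArea / (3 - q) * (k ^ (3 * (q - 1) / 2) * a ^ ((3 - q) / 2)) := by
    rw [Real.mul_rpow hD.le hk.le, ← Real.rpow_mul (by positivity), Real.div_rpow hm.le hk.le]
    have : k ^ q / k ^ (1 / 2 * (3 - q)) = k ^ (3 * (q - 1) / 2) := by
      rw [← Real.rpow_sub hk]; ring_nf
    rw [← this]
    have h2 : (3 - q) / 2 = 1 / 2 * (3 - q) := by ring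
    rw [h2]
    field_simp
  have e2 : (decayConst * k / (a / k) ^ (1 / 2 : ℝ)) ^ (q - 1) * a =
      decayConst ^ (q - 1) * (k ^ (3 * (q - 1) / 2) * a ^ ((3 - q) / 2)) := by
    rw [Real.div_rpow (by positivity) (by positivity), Real.mul_rpow hD.le hk.le,
      ← Real.rpow_mul (by positivity), Real.div_rpow hm.le hk.le]
    have h1 : k ^ (3 * (q - 1) / 2) = k ^ (q - 1) * k ^ (1 / 2 * (q - 1)) := by
      rw [← Real.rpow_add hk]; ring_nf
    have h2 : a = a ^ ((3 - q) / 2) * a ^ (1 / 2 * (q - 1)) := by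
      rw [← Real.rpow_add hm]
      ring_nf
      exact (Real.rpow_one a).symm
    have h3 : 0 < a ^ (1 / 2 * (q - 1)) := by positivity
    rw [h1]
    nth_rw 2 [h2]
    field_simp
  rw [e1, e2]
  ring

lemma coupling_le {s t : ℝ} (hs : 0 ≤ s) (ht : 0 ≤ t) :
    s ^ q * t ^ q ≤ 1 / 2 * (s ^ (2 * q) + t ^ (2 * q)) := by
  have h1 : s ^ (2 * q) = (s ^ q) ^ 2 := by
    rw [← Real.rpow_natCast, ← Real.rpow_mul hs]; ring_nf
  have h2 : t ^ (2 * q) = (t ^ q) ^ 2 := by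
    rw [← Real.rpow_natCast, ← Real.rpow_mul ht]; ring_nf
  rw [h1, h2]
  nlinarith [sq_nonneg (s ^ q - t ^ q)]

lemma integrable_coupling {u v : H1} (hu : u ∈ H1r) (hv : v ∈ H1r) (hq : 1 < q) (hq2 : q < 3 / 2) :
    Integrable (fun x => ‖fn u x‖ ^ q * ‖fn v x‖ ^ q) := by
  refine (((integrable_power hu hq hq2).add (integrable_power hv hq hq2)).const_mul (1 / 2)).mono'
    (((measurable_fn u).norm.pow_const _).mul
      ((measurable_fn v).norm.pow_const _)).aestronglyMeasurable (ae_of_all _ fun x => ?_)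
  rw [Real.norm_of_nonneg (by positivity)]
  exact coupling_le (norm_nonneg _) (norm_nonneg _)

lemma integral_coupling_le {u v : H1} (hu : u ∈ H1r) (hv : v ∈ H1r) (hq : 1 < q) (hq2 : q < 3 / 2) :
    ∫ x, ‖fn u x‖ ^ q * ‖fn v x‖ ^ q ≤
      1 / 2 * ((∫ x, ‖fn u x‖ ^ (2 * q)) + ∫ x, ‖fn v x‖ ^ (2 * q)) := by
  rw [← integral_add (integrable_power hu hq hq2) (integrable_power hv hq hq2), ← integral_const_mul]
  exact integral_mono (integrable_coupling hu hv hq hq2)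
    (((integrable_power hu hq hq2).add (integrable_power hv hq hq2)).const_mul (1 / 2))
    fun x => coupling_le (norm_nonneg _) (norm_nonneg _)

/-- Compactness: the coupling term is continuous under bounded a.e. convergence of radial
functions. -/
lemma tendsto_integral_coupling {w z : ℕ → H1} {u v : H1} (hw : ∀ n, w n ∈ H1r)
    (hz : ∀ n, z n ∈ H1r) (hu : u ∈ H1r) (hv : v ∈ H1r) (hq : 1 < q) (hq2 : q < 3 / 2) {A : ℝ}
    (hwA : ∀ n, kinetic (w n) ≤ A ∧ mass (w n) ≤ A) (hzA : ∀ n, kinetic (z n) ≤ A ∧ mass (z n) ≤ A)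
    (hwu : ∀ᵐ x : E3, Tendsto (fun n => fn (w n) x) atTop (𝓝 (fn u x)))
    (hzv : ∀ᵐ x : E3, Tendsto (fun n => fn (z n) x) atTop (𝓝 (fn v x))) :
    Tendsto (fun n => ∫ x, ‖fn (w n) x‖ ^ q * ‖fn (z n) x‖ ^ q) atTop
      (𝓝 (∫ x, ‖fn u x‖ ^ q * ‖fn v x‖ ^ q)) := by
  have hD := decayConst_pos
  have hA : 0 ≤ A := (kinetic_nonneg _).trans (hwA 0).1
  -- B bounds the limits as well, so the tail estimate applies to them without any semicontinuity.
  set B := max A (max (max (kinetic u) (mass u)) (max (kinetic v) (mass v))) with hB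
  have hB0 : 0 ≤ B := hA.trans (le_max_left _ _)
  have htail : ∀ M : ℝ, 0 < M → ∀ f g : H1, f ∈ H1r → g ∈ H1r → kinetic f ≤ B → mass f ≤ B →
      kinetic g ≤ B → mass g ≤ B →
      ∫ x in (Metric.ball 0 M)ᶜ, ‖fn f x‖ ^ q * ‖fn g x‖ ^ q ≤ (decayConst * B / M) ^ (q - 1) * B := by
    intro M hM f g hf hg hf1 hf2 hg1 hg2
    have e1 : ∀ h : H1, h ∈ H1r → kinetic h ≤ B → mass h ≤ B →
        ∫ x in (Metric.ball 0 M)ᶜ, ‖fn h x‖ ^ (2 * q) ≤ (decayConst * B / M) ^ (q - 1) * B := by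
      intro h hh h1 h2
      refine (integral_power_compl_ball_le hh hq hq2 hM).trans ?_
      have := kinetic_nonneg h
      have := mass_nonneg h
      gcongr
    have e2 : ∫ x in (Metric.ball 0 M)ᶜ, ‖fn f x‖ ^ q * ‖fn g x‖ ^ q ≤
        ∫ x in (Metric.ball 0 M)ᶜ, 1 / 2 * (‖fn f x‖ ^ (2 * q) + ‖fn g x‖ ^ (2 * q)) :=
      integral_mono (integrable_coupling hf hg hq hq2).integrableOn
        (((integrable_power hf hq hq2).add (integrable_power hg hq hq2)).const_mul (1 / 2)).integrableOn
        fun x => coupling_le (norm_nonneg _) (norm_nonneg _)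
    rw [integral_const_mul, integral_add (integrable_power hf hq hq2).integrableOn
      (integrable_power hg hq hq2).integrableOn] at e2
    linarith [e1 f hf hf1 hf2, e1 g hg hg1 hg2]
  have hball : ∀ M : ℝ, 0 < M →
      Tendsto (fun n => ∫ x in Metric.ball 0 M, ‖fn (w n) x‖ ^ q * ‖fn (z n) x‖ ^ q) atTop
      (𝓝 (∫ x in Metric.ball 0 M, ‖fn u x‖ ^ q * ‖fn v x‖ ^ q)) := by
    intro M hM
    refine tendsto_integral_of_dominated_convergence
      -- On a ball the decay estimate dominates the integrands by a multiple of |x|^{-q}, integrable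
      -- since q < 3.
      (fun x => (decayConst * A) ^ q * nearKernel q M x) ?_ ?_ ?_ ?_
    · intro n
      exact (((measurable_fn _).norm.pow_const _).mul
        ((measurable_fn _).norm.pow_const _)).aestronglyMeasurable
    · exact ((nearKernel_integral (by linarith) hM).1.const_mul _).integrableOn
    · intro n
      refine (ae_restrict_iff' measurableSet_ball).mpr ?_
      filter_upwards [ae_norm_sq_le (hw n), ae_norm_sq_le (hz n), ae_ne_zero_E3] with x h1 h2 hx0 hx
      have hn : 0 < ‖x‖ := norm_pos_iff.mpr hx0
      rw [Real.norm_of_nonneg (by positivity)]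
      have h3 : nearKernel q M x = ‖x‖ ^ (-q) := indicator_of_mem (by simpa using hx) _
      rw [h3, Real.rpow_neg hn.le, ← div_eq_mul_inv, ← Real.div_rpow (by positivity) hn.le,
        ← Real.mul_rpow (norm_nonneg _) (norm_nonneg _)]
      refine Real.rpow_le_rpow (by positivity) ?_ (by linarith)
      have h4 : decayConst * kinetic (w n) / ‖x‖ ≤ decayConst * A / ‖x‖ := by
        gcongr; exact (hwA n).1
      have h5 : decayConst * kinetic (z n) / ‖x‖ ≤ decayConst * A / ‖x‖ := by
        gcongr; exact (hzA n).1
      nlinarith [sq_nonneg (‖fn (w n) x‖ - ‖fn (z n) x‖)]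
    · refine ae_restrict_of_ae ?_
      filter_upwards [hwu, hzv] with x h1 h2
      exact (h1.norm.rpow_const (Or.inr (by linarith))).mul (h2.norm.rpow_const (Or.inr (by linarith)))
  -- The tails are uniformly small because q > 1: this is where radial decay prevents loss at
  -- infinity.
  have hlim : Tendsto (fun M : ℝ => (decayConst * B / M) ^ (q - 1) * B) atTop (𝓝 0) := by
    have h1 : Tendsto (fun M : ℝ => decayConst * B / M) atTop (𝓝 0) :=
      tendsto_const_nhds.div_atTop tendsto_id
    have h2 := (h1.rpow_const (p := q - 1) (Or.inr (by linarith))).mul_const B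
    rwa [Real.zero_rpow (by linarith), zero_mul] at h2
  rw [Metric.tendsto_atTop]
  intro ε hε
  obtain ⟨M, hMε, hM⟩ := ((hlim.eventually_lt_const (by positivity : (0 : ℝ) < ε / 3)).and
    (eventually_gt_atTop 0)).exists
  obtain ⟨N, hN⟩ := (Metric.tendsto_atTop.mp (hball M hM)) (ε / 3) (by positivity)
  refine ⟨N, fun n hn => ?_⟩
  have h1 := hN n hn
  have h2 := htail M hM (w n) (z n) (hw n) (hz n) ((hwA n).1.trans (le_max_left _ _))
    ((hwA n).2.trans (le_max_left _ _)) ((hzA n).1.trans (le_max_left _ _))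
    ((hzA n).2.trans (le_max_left _ _))
  have h3 := htail M hM u v hu hv (by simp [hB]) (by simp [hB]) (by simp [hB]) (by simp [hB])
  have h4 : 0 ≤ ∫ x in (Metric.ball 0 M)ᶜ, ‖fn (w n) x‖ ^ q * ‖fn (z n) x‖ ^ q :=
    integral_nonneg fun x => by positivity
  have h5 : 0 ≤ ∫ x in (Metric.ball 0 M)ᶜ, ‖fn u x‖ ^ q * ‖fn v x‖ ^ q :=
    integral_nonneg fun x => by positivity
  rw [← integral_add_compl (measurableSet_ball (x := (0 : E3)) (ε := M))
    (integrable_coupling (hw n) (hz n) hq hq2),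
    ← integral_add_compl (measurableSet_ball (x := (0 : E3)) (ε := M))
    (integrable_coupling hu hv hq hq2), Real.dist_eq, abs_lt]
  rw [Real.dist_eq, abs_lt] at h1
  constructor <;> linarith [h1.1, h1.2]

lemma rpow_two_mul_eq {s : ℝ} (hs : 0 ≤ s) (hq : 1 < q) : s ^ (2 * q) = s ^ q * s ^ q := by
  rw [two_mul, Real.rpow_add_of_nonneg hs (by linarith) (by linarith)]

lemma tendsto_integral_power {w : ℕ → H1} {u : H1} (hw : ∀ n, w n ∈ H1r) (hu : u ∈ H1r)
    (hq : 1 < q) (hq2 : q < 3 / 2) {A : ℝ} (hwA : ∀ n, kinetic (w n) ≤ A ∧ mass (w n) ≤ A)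
    (hwu : ∀ᵐ x : E3, Tendsto (fun n => fn (w n) x) atTop (𝓝 (fn u x))) :
    Tendsto (fun n => ∫ x, ‖fn (w n) x‖ ^ (2 * q)) atTop (𝓝 (∫ x, ‖fn u x‖ ^ (2 * q))) := by
  simp_rw [rpow_two_mul_eq (norm_nonneg _) hq]
  exact tendsto_integral_coupling hw hw hu hu hq hq2 hwA hwA hwu hwu

end Power

/-! ### The Coulomb energy as a bilinear form -/

/-- The Coulomb potential of a density. -/
def pot (σ : E3 → ℝ) (x : E3) : ℝ := ∫ y, σ y / ‖x - y‖

/-- The Coulomb energy of a pair of densities. -/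
def coulombD (σ τ : E3 → ℝ) : ℝ := ∫ x, σ x * pot τ x

/-- Nonnegative integrable densities with bounded Coulomb potential. -/
structure IsDensity (σ : E3 → ℝ) : Prop where
  meas : Measurable σ
  nonneg : ∀ x, 0 ≤ σ x
  integrable : Integrable σ
  integrable_div : ∀ x, Integrable (fun y => σ y / ‖x - y‖)
  bdd : ∃ C, ∀ x, pot σ x ≤ C

lemma pot_nonneg {σ : E3 → ℝ} (h : ∀ x, 0 ≤ σ x) (x : E3) : 0 ≤ pot σ x :=
  integral_nonneg fun y => div_nonneg (h y) (norm_nonneg _)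

lemma measurable_pot {σ : E3 → ℝ} (h : Measurable σ) : Measurable (pot σ) := by
  have : StronglyMeasurable (Function.uncurry fun (x y : E3) => σ y / ‖x - y‖) :=
    Measurable.stronglyMeasurable (by unfold Function.uncurry; fun_prop)
  exact this.integral_prod_right.measurable

namespace IsDensity

variable {σ τ σ' τ' : E3 → ℝ}

lemma mono (hσ : IsDensity σ) (hm : Measurable τ) (h0 : ∀ x, 0 ≤ τ x) (hle : ∀ᵐ x, τ x ≤ σ x) :
    IsDensity τ := by
  have hd : ∀ x, Integrable (fun y => τ y / ‖x - y‖) := fun x => by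
    refine (hσ.integrable_div x).mono' (Measurable.aestronglyMeasurable (by fun_prop)) ?_
    filter_upwards [hle] with y hy
    rw [Real.norm_of_nonneg (div_nonneg (h0 y) (norm_nonneg _))]
    gcongr
  obtain ⟨C, hC⟩ := hσ.bdd
  refine ⟨hm, h0, ?_, hd, C, fun x => ?_⟩
  · refine hσ.integrable.mono' hm.aestronglyMeasurable ?_
    filter_upwards [hle] with y hy
    rwa [Real.norm_of_nonneg (h0 y)]
  · refine le_trans (integral_mono_ae (hd x) (hσ.integrable_div x) ?_) (hC x)
    filter_upwards [hle] with y hy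
    gcongr

lemma pot_mono (hσ : IsDensity σ) (hτ : IsDensity τ) (hle : ∀ᵐ x, τ x ≤ σ x) (x : E3) :
    pot τ x ≤ pot σ x := by
  refine integral_mono_ae (hτ.integrable_div x) (hσ.integrable_div x) ?_
  filter_upwards [hle] with y hy
  gcongr

lemma pot_add (hσ : IsDensity σ) (hτ : IsDensity τ) (x : E3) :
    pot (σ + τ) x = pot σ x + pot τ x := by
  rw [pot, pot, pot, ← integral_add (hσ.integrable_div x) (hτ.integrable_div x)]
  simp only [Pi.add_apply, add_div]

lemma add (hσ : IsDensity σ) (hτ : IsDensity τ) : IsDensity (σ + τ) := by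
  obtain ⟨C, hC⟩ := hσ.bdd
  obtain ⟨C', hC'⟩ := hτ.bdd
  refine ⟨hσ.meas.add hτ.meas, fun x => add_nonneg (hσ.nonneg x) (hτ.nonneg x),
    hσ.integrable.add hτ.integrable, fun x => ?_, C + C', fun x => ?_⟩
  · refine ((hσ.integrable_div x).add (hτ.integrable_div x)).congr (ae_of_all _ fun y => ?_)
    simp [add_div]
  · rw [hσ.pot_add hτ]
    exact add_le_add (hC x) (hC' x)

lemma pot_smul (c : ℝ) (x : E3) : pot (c • σ) x = c * pot σ x := by
  rw [pot, pot, ← integral_const_mul]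
  simp [mul_div_assoc]

lemma smul (hσ : IsDensity σ) {c : ℝ} (hc : 0 ≤ c) : IsDensity (c • σ) := by
  obtain ⟨C, hC⟩ := hσ.bdd
  refine ⟨hσ.meas.const_smul c, fun x => mul_nonneg hc (hσ.nonneg x), hσ.integrable.smul c,
    fun x => ?_, c * C, fun x => ?_⟩
  · refine ((hσ.integrable_div x).const_mul c).congr (ae_of_all _ fun y => ?_)
    simp [mul_div_assoc]
  · rw [pot_smul]
    exact mul_le_mul_of_nonneg_left (hC x) hc

lemma integrable_mul_pot (hσ : IsDensity σ) (hτ : IsDensity τ) :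
    Integrable (fun x => σ x * pot τ x) := by
  obtain ⟨C, hC⟩ := hτ.bdd
  refine (hσ.integrable.mul_const C).mono'
    (hσ.meas.mul (measurable_pot hτ.meas)).aestronglyMeasurable (ae_of_all _ fun x => ?_)
  rw [Real.norm_of_nonneg (mul_nonneg (hσ.nonneg x) (pot_nonneg hτ.nonneg x))]
  exact mul_le_mul_of_nonneg_left (hC x) (hσ.nonneg x)

lemma coulombD_le (hσ : IsDensity σ) (hτ : IsDensity τ) {C : ℝ} (hC : ∀ x, pot τ x ≤ C) :
    coulombD σ τ ≤ (∫ x, σ x) * C := by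
  rw [← integral_mul_const]
  exact integral_mono (hσ.integrable_mul_pot hτ) (hσ.integrable.mul_const C)
    fun x => mul_le_mul_of_nonneg_left (hC x) (hσ.nonneg x)

lemma coulombD_mono (hσ : IsDensity σ) (hτ : IsDensity τ) (hσ' : IsDensity σ') (hτ' : IsDensity τ')
    (h1 : ∀ᵐ x, σ x ≤ σ' x) (h2 : ∀ᵐ x, τ x ≤ τ' x) : coulombD σ τ ≤ coulombD σ' τ' := by
  refine integral_mono_ae (hσ.integrable_mul_pot hτ) (hσ'.integrable_mul_pot hτ') ?_
  filter_upwards [h1] with x hx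
  exact mul_le_mul hx (hτ'.pot_mono hτ h2 x) (pot_nonneg hτ.nonneg x) (hσ'.nonneg x)

/-- Tonelli: the inner integral of the norm is σ times the potential of τ, which is bounded.
Symmetry and the Fatou argument both work on the product space. -/
lemma integrable_prod (hσ : IsDensity σ) (hτ : IsDensity τ) :
    Integrable (fun p : E3 × E3 => σ p.1 * (τ p.2 / ‖p.1 - p.2‖))
      ((volume : Measure E3).prod volume) := by
  have m1 := hσ.meas
  have m2 := hτ.meas
  rw [integrable_prod_iff (Measurable.aestronglyMeasurable (by fun_prop))]
  refine ⟨ae_of_all _ fun x => (hτ.integrable_div x).const_mul (σ x), ?_⟩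
  refine (hσ.integrable_mul_pot hτ).congr (ae_of_all _ fun x => ?_)
  simp only [pot]
  rw [← integral_const_mul]
  refine integral_congr_ae (ae_of_all _ fun y => ?_)
  exact (Real.norm_of_nonneg (mul_nonneg (hσ.nonneg x) (div_nonneg (hτ.nonneg y) (norm_nonneg _)))).symm

lemma coulombD_eq (hσ : IsDensity σ) (hτ : IsDensity τ) :
    coulombD σ τ = ∫ p : E3 × E3, σ p.1 * (τ p.2 / ‖p.1 - p.2‖) ∂((volume : Measure E3).prod volume) := by
  rw [integral_prod _ (hσ.integrable_prod hτ)]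
  simp only [coulombD, pot, integral_const_mul]

lemma coulombD_comm (hσ : IsDensity σ) (hτ : IsDensity τ) : coulombD σ τ = coulombD τ σ := by
  rw [hσ.coulombD_eq hτ, hτ.coulombD_eq hσ, ← integral_prod_swap]
  refine integral_congr_ae (ae_of_all _ fun p => ?_)
  simp only [Prod.fst_swap, Prod.snd_swap]
  rw [norm_sub_rev]
  ring

lemma coulombD_add_left (hσ : IsDensity σ) (hτ : IsDensity τ) (hσ' : IsDensity σ') :
    coulombD (σ + σ') τ = coulombD σ τ + coulombD σ' τ := by
  rw [coulombD, coulombD, coulombD,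
    ← integral_add (hσ.integrable_mul_pot hτ) (hσ'.integrable_mul_pot hτ)]
  simp only [Pi.add_apply, add_mul]

lemma coulombD_add_self (hσ : IsDensity σ) (hτ : IsDensity τ) :
    coulombD (σ + τ) (σ + τ) = coulombD σ σ + 2 * coulombD σ τ + coulombD τ τ := by
  rw [hσ.coulombD_add_left (hσ.add hτ) hτ, hσ.coulombD_comm (hσ.add hτ),
    hτ.coulombD_comm (hσ.add hτ), hσ.coulombD_add_left hσ hτ, hσ.coulombD_add_left hτ hτ,
    hτ.coulombD_comm hσ]
  ring

lemma coulombD_nonneg (hσ : ∀ x, 0 ≤ σ x) (hτ : ∀ x, 0 ≤ τ x) : 0 ≤ coulombD σ τ :=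
  integral_nonneg fun x => mul_nonneg (hσ x) (pot_nonneg hτ x)

/-- Lower semicontinuity of the Coulomb energy. -/
lemma coulombD_le_of_tendsto {s : ℕ → E3 → ℝ} (hs : ∀ n, IsDensity (s n)) (hσ : IsDensity σ)
    (hlim : ∀ᵐ x, Tendsto (fun n => s n x) atTop (𝓝 (σ x))) {c : ℕ → ℝ} {c₀ : ℝ}
    (hc : Tendsto c atTop (𝓝 c₀)) (hle : ∀ n, coulombD (s n) (s n) ≤ c n) :
    coulombD σ σ ≤ c₀ := by
  have key : ∀ {t : E3 → ℝ}, IsDensity t → ENNReal.ofReal (coulombD t t) =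
      ∫⁻ p : E3 × E3, ENNReal.ofReal (t p.1 * (t p.2 / ‖p.1 - p.2‖))
        ∂((volume : Measure E3).prod volume) := by
    intro t ht
    rw [ht.coulombD_eq ht, ofReal_integral_eq_lintegral_ofReal (ht.integrable_prod ht)]
    exact ae_of_all _ fun p => mul_nonneg (ht.nonneg _) (div_nonneg (ht.nonneg _) (norm_nonneg _))
  have h1 : ENNReal.ofReal (coulombD σ σ) ≤ ENNReal.ofReal c₀ := by
    rw [key hσ]
    have h2 : ∫⁻ p : E3 × E3, ENNReal.ofReal (σ p.1 * (σ p.2 / ‖p.1 - p.2‖))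
        ∂((volume : Measure E3).prod volume) =
        ∫⁻ p : E3 × E3, liminf (fun n => ENNReal.ofReal (s n p.1 * (s n p.2 / ‖p.1 - p.2‖))) atTop
        ∂((volume : Measure E3).prod volume) := by
      refine lintegral_congr_ae ?_
      filter_upwards [Measure.quasiMeasurePreserving_fst.ae hlim,
        Measure.quasiMeasurePreserving_snd.ae hlim] with p h3 h4
      refine (Tendsto.liminf_eq ?_).symm
      exact (ENNReal.continuous_ofReal.tendsto _).comp (h3.mul (h4.div_const _))
    -- Fatou's lemma on the product space; a.e. convergence transfers to pairs through the two
    -- projections.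
    rw [h2]
    refine (lintegral_liminf_le fun n => ?_).trans ?_
    · have := (hs n).meas
      fun_prop
    · simp_rw [← key (hs _)]
      have h5 : Tendsto (fun n => ENNReal.ofReal (c n)) atTop (𝓝 (ENNReal.ofReal c₀)) :=
        (ENNReal.continuous_ofReal.tendsto _).comp hc
      rw [← h5.liminf_eq]
      exact liminf_le_liminf (Eventually.of_forall fun n => ENNReal.ofReal_le_ofReal (hle n))
  have hc0 : 0 ≤ c₀ := ge_of_tendsto' hc fun n =>
    (coulombD_nonneg (hs n).nonneg (hs n).nonneg).trans (hle n)
  exact (ENNReal.ofReal_le_ofReal_iff hc0).mp h1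

end IsDensity

/-! ### Densities of radial functions and bounds for their potentials. -/

/-- The density `|u|²`. -/
def dens (u : H1) (x : E3) : ℝ := ‖fn u x‖ ^ 2

lemma integral_dens (u : H1) : ∫ x, dens u x = mass u := rfl

lemma measurable_dens (u : H1) : Measurable (dens u) := (measurable_fn u).norm.pow_const 2

/-- Far from x the denominator is at least δ. Near x, the product |y| |x - y| is at least the square
of the smaller factor, and that factor is below δ, so one of the two kernels |·|⁻² absorbs the term.
-/
lemma dens_div_le {k a δ : ℝ} {x y : E3} (hk : 0 ≤ k) (ha0 : 0 ≤ a) (hδ : 0 < δ) (hy : y ≠ 0)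
    (ha : a ≤ k / ‖y‖) :
    a / ‖x - y‖ ≤ k * (nearKernel 2 δ (x - y) + nearKernel 2 δ y) + a / δ := by
  have hn1 := nearKernel_nonneg 2 δ y
  have hn2 := nearKernel_nonneg 2 δ (x - y)
  have hyn : 0 < ‖y‖ := norm_pos_iff.mpr hy
  have e : ∀ z : E3, ‖z‖ < δ → nearKernel 2 δ z = (‖z‖ ^ 2)⁻¹ := fun z hz => by
    rw [nearKernel, indicator_of_mem (mem_Iio.mpr hz), Real.rpow_neg (norm_nonneg _)]
    norm_cast
  have hr : 0 ≤ a / δ := by positivity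
  rcases (norm_nonneg (x - y)).eq_or_lt with h0 | h0
  · rw [← h0, div_zero]; positivity
  rcases lt_or_ge ‖x - y‖ δ with h | h
  · have hmain : k / ‖y‖ / ‖x - y‖ ≤ k * (nearKernel 2 δ (x - y) + nearKernel 2 δ y) := by
      rw [div_div, div_eq_mul_inv]
      refine mul_le_mul_of_nonneg_left ?_ hk
      rcases le_or_gt ‖x - y‖ ‖y‖ with h2 | h2
      · refine le_trans ?_ (le_add_of_nonneg_right hn1)
        rw [e _ h]
        gcongr
        nlinarith
      · refine le_trans ?_ (le_add_of_nonneg_left hn2)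
        rw [e _ (h2.trans h)]
        gcongr
        nlinarith
    have : a / ‖x - y‖ ≤ k / ‖y‖ / ‖x - y‖ := by gcongr
    linarith
  · have : a / ‖x - y‖ ≤ a / δ := by gcongr
    have : 0 ≤ k * (nearKernel 2 δ (x - y) + nearKernel 2 δ y) := by positivity
    linarith

/-- Each of the two kernels has integral sphereArea · δ, and decayConst · sphereArea = 9, whence 18.
The bound is independent of x by translation invariance. -/
lemma integrable_potBound (u : H1) {δ : ℝ} (hδ : 0 < δ) (x : E3) :
    Integrable (fun y => decayConst * kinetic u *
      (nearKernel 2 δ (x - y) + nearKernel 2 δ y) + dens u y / δ) ∧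
    ∫ y, (decayConst * kinetic u *
      (nearKernel 2 δ (x - y) + nearKernel 2 δ y) + dens u y / δ) =
      18 * kinetic u * δ + mass u / δ := by
  obtain ⟨h1, h2⟩ := nearKernel_integral (s := 2) (by norm_num) hδ
  have h3 : Integrable (fun y => nearKernel 2 δ (x - y)) := h1.comp_sub_left x
  have h4 : ∫ y, nearKernel 2 δ (x - y) = ∫ y, nearKernel 2 δ y := integral_sub_left_eq_self _ _ x
  have h5 : Integrable (fun y => dens u y / δ) := (integrable_norm_sq u).div_const δ
  have h8 : Integrable (fun y => decayConst * kinetic u *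
      (nearKernel 2 δ (x - y) + nearKernel 2 δ y)) := (h3.add h1).const_mul _
  refine ⟨h8.add h5, ?_⟩
  rw [integral_add h8 h5, integral_const_mul]
  have h6 : ∫ y, (nearKernel 2 δ (x - y) + nearKernel 2 δ y) = 2 * (sphereArea * δ) := by
    rw [integral_add h3 h1, h4, h2]
    norm_num
    ring
  have h7 : ∫ y, dens u y / δ = mass u / δ := integral_div _ _
  rw [h6, h7, decayConst]
  have := sphereArea_pos
  field_simp
  ring

lemma isDensity_dens_aux {u : H1} (hu : u ∈ H1r) {δ : ℝ} (hδ : 0 < δ) (x : E3) :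
    Integrable (fun y => dens u y / ‖x - y‖) ∧ pot (dens u) x ≤ 18 * kinetic u * δ + mass u / δ := by
  obtain ⟨h1, h2⟩ := integrable_potBound u hδ x
  have hle : ∀ᵐ y, dens u y / ‖x - y‖ ≤ decayConst * kinetic u *
      (nearKernel 2 δ (x - y) + nearKernel 2 δ y) + dens u y / δ := by
    filter_upwards [ae_norm_sq_le hu, ae_ne_zero_E3] with y hy hy0
    exact dens_div_le (mul_nonneg decayConst_pos.le (kinetic_nonneg u)) (by unfold dens; positivity) hδ hy0 hy
  have hi : Integrable (fun y => dens u y / ‖x - y‖) := by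
    have := measurable_dens u
    refine h1.mono' (Measurable.aestronglyMeasurable (by fun_prop)) ?_
    filter_upwards [hle] with y hy
    rwa [Real.norm_of_nonneg (by unfold dens; positivity)]
  refine ⟨hi, ?_⟩
  rw [← h2]
  exact integral_mono_ae hi h1 hle

lemma isDensity_dens {u : H1} (hu : u ∈ H1r) : IsDensity (dens u) :=
  ⟨measurable_dens u, fun x => by unfold dens; positivity, integrable_norm_sq u,
    fun x => (isDensity_dens_aux hu one_pos x).1, _, fun x => (isDensity_dens_aux hu one_pos x).2⟩

/-- The length δ is left free, to be matched later to the width of a bump or to the natural scale.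
-/
lemma pot_dens_le {u : H1} (hu : u ∈ H1r) {δ : ℝ} (hδ : 0 < δ) (x : E3) :
    pot (dens u) x ≤ 18 * kinetic u * δ + mass u / δ := (isDensity_dens_aux hu hδ x).2

/-- The density `|u|² + |v|²`. -/
def rho (u v : H1) : E3 → ℝ := dens u + dens v

lemma isDensity_rho {u v : H1} (hu : u ∈ H1r) (hv : v ∈ H1r) : IsDensity (rho u v) :=
  (isDensity_dens hu).add (isDensity_dens hv)

lemma integral_rho (u v : H1) : ∫ x, rho u v x = mass u + mass v :=
  integral_add (integrable_norm_sq u) (integrable_norm_sq v)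

lemma energy_eq_coulombD (α β q : ℝ) (u v : H1) : energy α β q u v =
    1 / 2 * kinetic u + 1 / 2 * kinetic v + α / 4 * coulombD (rho u v) (rho u v)
    - 1 / (2 * q) * ((∫ x, ‖fn u x‖ ^ (2 * q)) + ∫ x, ‖fn v x‖ ^ (2 * q))
    - β / q * (∫ x, ‖fn u x‖ ^ q * ‖fn v x‖ ^ q) := rfl

lemma energy_comm (α β q : ℝ) (u v : H1) : energy α β q u v = energy α β q v u := by
  have : rho u v = rho v u := add_comm _ _
  rw [energy_eq_coulombD, energy_eq_coulombD, this]
  have : ∀ x, ‖fn u x‖ ^ q * ‖fn v x‖ ^ q = ‖fn v x‖ ^ q * ‖fn u x‖ ^ q := fun x => mul_comm _ _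
  simp_rw [this]
  ring

/-! ### Translations and the modulus of pairs of `H¹` functions -/

instance : SecondCountableTopology L2 :=
  have : Fact ((2 : ENNReal) ≠ ⊤) := ⟨ENNReal.ofNat_ne_top⟩
  inferInstance

/-- The `i`-th coordinate vector. -/
abbrev unitVec (i : Fin 3) : E3 := EuclideanSpace.single i 1

/-- Translation of `L²` functions. -/
def transl (h : E3) (u : L2) : L2 :=
  Lp.compMeasurePreserving (fun x => x + h) (measurePreserving_add_right volume h) u

lemma coeFn_transl (h : E3) (u : L2) : transl h u =ᵐ[volume] fun x => u (x + h) :=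
  Lp.coeFn_compMeasurePreserving u (measurePreserving_add_right volume h)

lemma norm_transl (h : E3) (u : L2) : ‖transl h u‖ = ‖u‖ :=
  Lp.norm_compMeasurePreserving u (measurePreserving_add_right volume h)

lemma continuous_transl (e : E3) (u : L2) : Continuous fun t : ℝ => transl (t • e) u := by
  have h1 : Continuous fun t : ℝ => (⟨fun x => x + t • e, by fun_prop⟩ : C(E3, E3)) :=
    ContinuousMap.continuous_of_continuous_uncurry _
      (show Continuous fun p : ℝ × E3 => p.2 + p.1 • e by fun_prop)
  exact Continuous.compMeasurePreservingLp (f := fun _ : ℝ => u) continuous_const h1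
    (fun t => measurePreserving_add_right volume (t • e)) (by simp)

lemma integral_smul_transl (φ : E3 → ℝ) (h : E3) (u : L2) :
    ∫ x, φ x • transl h u x = ∫ x, φ (x - h) • u x := by
  rw [← integral_add_right_eq_self (fun x => φ (x - h) • u x) h]
  refine integral_congr_ae ?_
  filter_upwards [coeFn_transl h u] with x hx
  rw [hx, add_sub_cancel_right]

lemma hasDerivAt_comp_sub_smul {φ : E3 → ℝ} (hφ : IsTest φ) (i : Fin 3) (x : E3) (t : ℝ) :
    HasDerivAt (fun t : ℝ => φ (x - t • unitVec i)) (-partialDeriv i φ (x - t • unitVec i)) t := by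
  have h1 : HasDerivAt (fun t : ℝ => x - t • unitVec i) (-unitVec i) t := by
    simpa using ((hasDerivAt_id t).smul_const (unitVec i)).const_sub x
  have h2 := (hφ.1.differentiable (by simp)).differentiableAt (x := x - t • unitVec i)
  have h3 := h2.hasFDerivAt.comp_hasDerivAt t h1
  rw [map_neg] at h3
  exact h3

lemma hasDerivAt_integral_translate {φ : E3 → ℝ} (hφ : IsTest φ) (i : Fin 3) (u : L2) (t : ℝ) :
    HasDerivAt (fun t : ℝ => ∫ x, φ (x - t • unitVec i) • u x)
      (- ∫ x, partialDeriv i φ (x - t • unitVec i) • u x) t := by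
  have hc := hφ.continuous_partialDeriv i
  have hs := hφ.hasCompactSupport_partialDeriv i
  obtain ⟨M, hM⟩ := hc.bounded_above_of_compact_support hs
  obtain ⟨R, hR⟩ := hs.isCompact.isBounded.subset_closedBall (0 : E3)
  have hM0 : 0 ≤ M := (norm_nonneg _).trans (hM 0)
  have hmu := (Lp.stronglyMeasurable u).measurable
  have hcφ := hφ.1.continuous
  -- For parameters within distance 1 of t, the shifted derivatives of φ are all supported in this
  -- ball.
  set K : Set E3 := Metric.closedBall 0 (R + |t| + 1)
  have hu : IntegrableOn (fun x => ‖u x‖) K :=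
    (((Lp.memLp u).locallyIntegrable (by norm_num)).integrableOn_isCompact (isCompact_closedBall _ _)).norm
  rw [← integral_neg]
  refine (hasDerivAt_integral_of_dominated_loc_of_deriv_le (μ := volume)
    (F := fun t x => φ (x - t • unitVec i) • u x)
    (F' := fun t x => -(partialDeriv i φ (x - t • unitVec i) • u x))
    (bound := fun x => M * K.indicator (fun x => ‖u x‖) x)
    (Metric.ball_mem_nhds t one_pos) ?_ ?_ ?_ ?_ ?_ ?_).2
  · refine Eventually.of_forall fun s => Measurable.aestronglyMeasurable ?_
    have h1 : Measurable fun x => φ (x - s • unitVec i) :=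
      (hcφ.comp (by fun_prop : Continuous fun x : E3 => x - s • unitVec i)).measurable
    exact h1.smul hmu
  · refine IsTest.integrable_smul (φ := fun x => φ (x - t • unitVec i)) (by fun_prop) ?_ u
    exact hφ.2.comp_isClosedEmbedding (Homeomorph.subRight (t • unitVec i)).isClosedEmbedding
  · have h1 : Measurable fun x => partialDeriv i φ (x - t • unitVec i) :=
      (hc.comp (by fun_prop : Continuous fun x : E3 => x - t • unitVec i)).measurable
    exact (h1.smul hmu).neg.aestronglyMeasurable
  · refine ae_of_all _ fun x s hs' => ?_
    rw [norm_neg, norm_smul]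
    by_cases hx : x ∈ K
    · rw [indicator_of_mem hx]
      gcongr
      exact hM _
    · have : partialDeriv i φ (x - s • unitVec i) = 0 := by
        refine image_eq_zero_of_notMem_tsupport fun h => hx ?_
        have h1 := mem_closedBall_zero_iff.mp (hR h)
        have h2 : ‖s • unitVec i‖ = |s| := by simp [norm_smul]
        have h3 : |s| ≤ |t| + 1 := by
          have : |s - t| < 1 := by simpa [Real.dist_eq] using hs'
          have := abs_sub_abs_le_abs_sub s t
          linarith
        have h4 : ‖x‖ ≤ ‖x - s • unitVec i‖ + ‖s • unitVec i‖ := by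
          simpa using norm_add_le (x - s • unitVec i) (s • unitVec i)
        rw [mem_closedBall_zero_iff]
        linarith
      simp [this, indicator_of_notMem hx]
  · exact ((integrable_indicator_iff Metric.isClosed_closedBall.measurableSet).mpr hu).const_mul M
  · refine ae_of_all _ fun x s _ => ?_
    have := (hasDerivAt_comp_sub_smul hφ i x s).smul_const (u x)
    simpa using this

lemma IsTest.translate {φ : E3 → ℝ} (hφ : IsTest φ) (h : E3) : IsTest (fun x => φ (x - h)) :=
  ⟨hφ.1.comp (by fun_prop),
    hφ.2.comp_isClosedEmbedding (Homeomorph.subRight h).isClosedEmbedding⟩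

lemma partialDeriv_translate {φ : E3 → ℝ} (i : Fin 3) (h x : E3) :
    partialDeriv i (fun x => φ (x - h)) x = partialDeriv i φ (x - h) := by
  unfold partialDeriv
  rw [fderiv_comp_sub]

/-- The fundamental theorem of calculus in L², checked by pairing with test functions: moving the
translation onto φ makes the pairing differentiable in t, and the weak derivative identity turns its
derivative into the pairing with g. -/
lemma transl_sub_eq_integral {i : Fin 3} {u g : L2} (hug : IsWeakPartial i u g) (h : ℝ) :
    transl (h • unitVec i) u - u = ∫ t in (0 : ℝ)..h, transl (t • unitVec i) g := by
  have hcont := continuous_transl (unitVec i) g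
  rw [← sub_eq_zero]
  set c : L2 := transl (h • unitVec i) u - u - ∫ t in (0 : ℝ)..h, transl (t • unitVec i) g with hc
  have hz : ∀ φ : E3 → ℝ, ContDiff ℝ ∞ φ → HasCompactSupport φ → ∫ x, φ x • c x = 0 := by
    intro φ h1 h2
    have hφ : IsTest φ := ⟨h1, h2⟩
    rw [← pairing_apply φ hφ.memLp, hc, map_sub, map_sub]
    rw [← ContinuousLinearMap.intervalIntegral_comp_comm _ (hcont.intervalIntegrable _ _)]
    simp_rw [pairing_apply, integral_smul_transl]
    have hd : ∀ t : ℝ, HasDerivAt (fun t : ℝ => ∫ x, φ (x - t • unitVec i) • u x)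
        (∫ x, φ (x - t • unitVec i) • g x) t := by
      intro t
      have e := hug _ (hφ.translate (t • unitVec i))
      simp_rw [partialDeriv_translate] at e
      have e2 := hasDerivAt_integral_translate hφ i u t
      rwa [e, neg_neg] at e2
    rw [intervalIntegral.integral_eq_sub_of_hasDerivAt (fun t _ => hd t)]
    · simp
    · refine Continuous.intervalIntegrable ?_ _ _
      have := (pairing φ hφ.memLp).continuous.comp hcont
      refine this.congr fun t => ?_
      rw [Function.comp_apply, pairing_apply, integral_smul_transl]
  have := ae_eq_zero_of_integral_contDiff_smul_eq_zero ((Lp.memLp c).locallyIntegrable (by norm_num)) hz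
  exact Lp.eq_zero_iff_ae_eq_zero.mpr this

lemma norm_transl_sub_le {i : Fin 3} {u g : L2} (hug : IsWeakPartial i u g) (h : ℝ) :
    ‖transl (h • unitVec i) u - u‖ ≤ ‖g‖ * |h| := by
  rw [transl_sub_eq_integral hug]
  refine (intervalIntegral.norm_integral_le_of_norm_le_const (C := ‖g‖) fun t _ => ?_).trans ?_
  · rw [norm_transl]
  · simp

/-- Bounded difference quotients yield a weak derivative. -/
lemma exists_isWeakPartial_of_norm_transl_sub_le {i : Fin 3} {u : L2} {N : ℝ}
    (h : ∀ t : ℝ, ‖transl (t • unitVec i) u - u‖ ^ 2 ≤ N * t ^ 2) :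
    ∃ g : L2, IsWeakPartial i u g ∧ ‖g‖ ^ 2 ≤ N := by
  set s : ℕ → ℝ := fun n => 1 / ((n : ℝ) + 1) with hs
  have hs0 : ∀ n, 0 < s n := fun n => by positivity
  have hst : Tendsto s atTop (𝓝[≠] 0) := by
    refine tendsto_nhdsWithin_iff.mpr ⟨tendsto_one_div_add_atTop_nhds_zero_nat, ?_⟩
    exact Eventually.of_forall fun n => (hs0 n).ne'
  set d : ℕ → L2 := fun n => ((s n)⁻¹ : ℂ) • (transl (s n • unitVec i) u - u) with hd
  have hdn : ∀ n, ‖d n‖ ^ 2 ≤ N := by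
    intro n
    have h2 : ‖((s n)⁻¹ : ℂ)‖ = (s n)⁻¹ := by
      rw [norm_inv, Complex.norm_real, Real.norm_of_nonneg (hs0 n).le]
    simp only [hd]
    rw [norm_smul, h2, mul_pow]
    calc (s n)⁻¹ ^ 2 * ‖transl (s n • unitVec i) u - u‖ ^ 2 ≤ (s n)⁻¹ ^ 2 * (N * s n ^ 2) := by
          gcongr; exact h _
      _ = N := by have := hs0 n; field_simp
  -- The difference quotients are bounded in L²; a weak limit of them is the derivative and inherits
  -- the bound N.
  obtain ⟨g, ns, hns, hg⟩ := exists_weakTendsto_subseq (w := d) (C := Real.sqrt N)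
    fun n => Real.le_sqrt_of_sq_le (hdn n)
  refine ⟨g, fun φ hφ => ?_, hg.norm_sq_le tendsto_const_nhds (Eventually.of_forall fun n => hdn _)⟩
  have h1 := hg (pairing φ hφ.memLp)
  have h2 : Tendsto (fun n => pairing φ hφ.memLp (d n)) atTop
      (𝓝 (- ∫ x, partialDeriv i φ x • u x)) := by
    have e := hasDerivAt_integral_translate hφ i u 0
    rw [hasDerivAt_iff_tendsto_slope_zero] at e
    have e2 := e.comp hst
    simp only [zero_smul, sub_zero, zero_add] at e2
    refine e2.congr fun n => ?_
    simp only [hd, Function.comp_apply]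
    rw [map_smul, map_sub, pairing_apply, pairing_apply, integral_smul_transl]
    rw [Complex.real_smul, smul_eq_mul, Complex.ofReal_inv]
  have h3 := tendsto_nhds_unique h1 (h2.comp hns.tendsto_atTop)
  rw [pairing_apply] at h3
  rw [h3, neg_neg]

/-- Constructor for `H¹`. -/
def mkH1 (u : L2) (g : Fin 3 → L2) (h : ∀ i, IsWeakPartial i u (g i)) : H1 :=
  ⟨WithLp.toLp 2 (u, WithLp.toLp 2 g), h⟩

/-- The reverse triangle inequality in the Euclidean space ℂ². -/
lemma abs_sqrt_sub_sqrt_sq_le (a b c d : ℂ) :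
    (Real.sqrt (‖a‖ ^ 2 + ‖b‖ ^ 2) - Real.sqrt (‖c‖ ^ 2 + ‖d‖ ^ 2)) ^ 2 ≤
      ‖a - c‖ ^ 2 + ‖b - d‖ ^ 2 := by
  have h := abs_norm_sub_norm_le (WithLp.toLp 2 (a, b)) (WithLp.toLp 2 (c, d))
  have h2 := pow_le_pow_left₀ (abs_nonneg _) h 2
  rw [sq_abs, WithLp.prod_norm_sq_eq_of_L2, WithLp.prod_norm_eq_of_L2, WithLp.prod_norm_eq_of_L2] at h2
  exact h2

/-- The modulus `(|u|² + |w|²)^(1/2)` of a pair of radial `H¹` functions belongs to `H¹`, with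
kinetic energy at most the sum of those of `u` and `w`. -/
lemma exists_join {u w : H1} (hu : u ∈ H1r) (hw : w ∈ H1r) : ∃ U ∈ H1r,
    (∀ᵐ x, fn U x = (Real.sqrt (‖fn u x‖ ^ 2 + ‖fn w x‖ ^ 2) : ℝ)) ∧
    kinetic U ≤ kinetic u + kinetic w := by
  set f : E3 → ℂ := fun x => ((Real.sqrt (‖fn u x‖ ^ 2 + ‖fn w x‖ ^ 2) : ℝ) : ℂ) with hf
  have hfm : Measurable f := by
    have h1 := measurable_fn u
    have h2 := measurable_fn w
    exact Complex.measurable_ofReal.comp (by fun_prop)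
  have hfn : ∀ x, ‖f x‖ = Real.sqrt (‖fn u x‖ ^ 2 + ‖fn w x‖ ^ 2) := fun x => by
    rw [hf, Complex.norm_real, Real.norm_of_nonneg (Real.sqrt_nonneg _)]
  have hfL : MemLp f 2 (volume : Measure E3) := by
    refine ((Lp.memLp (valL u)).norm.add (Lp.memLp (valL w)).norm).of_le hfm.aestronglyMeasurable
      (ae_of_all _ fun x => ?_)
    rw [hfn]
    refine (Real.sqrt_le_iff.mpr ⟨by positivity, ?_⟩).trans (le_abs_self (‖fn u x‖ + ‖fn w x‖))
    nlinarith [norm_nonneg (fn u x), norm_nonneg (fn w x)]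
  set U : L2 := hfL.toLp with hU
  have hUf : U =ᵐ[volume] f := hfL.coeFn_toLp
  have key : ∀ i, ∃ g : L2, IsWeakPartial i U g ∧ ‖g‖ ^ 2 ≤ ‖gradL i u‖ ^ 2 + ‖gradL i w‖ ^ 2 := by
    intro i
    refine exists_isWeakPartial_of_norm_transl_sub_le fun t => ?_
    have h1 := norm_transl_sub_le (isWeakPartial_gradL u i) t
    have h2 := norm_transl_sub_le (isWeakPartial_gradL w i) t
    -- The modulus is 1-Lipschitz on ℂ², so increments of U are controlled by those of the pair (u,
    -- w). Working with increments avoids a chain rule at the zeros of the pair.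
    have h3 : ‖transl (t • unitVec i) U - U‖ ^ 2 ≤
        ‖transl (t • unitVec i) (valL u) - valL u‖ ^ 2 +
        ‖transl (t • unitVec i) (valL w) - valL w‖ ^ 2 := by
      simp_rw [norm_sq_eq_integral]
      rw [← integral_add (Lp.memLp _).norm.integrable_sq (Lp.memLp _).norm.integrable_sq]
      refine integral_mono_ae (Lp.memLp _).norm.integrable_sq
        ((Lp.memLp _).norm.integrable_sq.add (Lp.memLp _).norm.integrable_sq) ?_
      have hqm := (measurePreserving_add_right (volume : Measure E3) (t • unitVec i)).quasiMeasurePreserving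
      filter_upwards [Lp.coeFn_sub (transl (t • unitVec i) U) U,
        Lp.coeFn_sub (transl (t • unitVec i) (valL u)) (valL u),
        Lp.coeFn_sub (transl (t • unitVec i) (valL w)) (valL w),
        coeFn_transl (t • unitVec i) U, coeFn_transl (t • unitVec i) (valL u),
        coeFn_transl (t • unitVec i) (valL w), hUf, hqm.ae hUf] with x e1 e2 e3 e4 e5 e6 e7 e8
      rw [e1, e2, e3, Pi.sub_apply, Pi.sub_apply, Pi.sub_apply, e4, e5, e6, e7, e8, hf,
        ← Complex.ofReal_sub, Complex.norm_real, Real.norm_eq_abs, sq_abs]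
      exact abs_sqrt_sub_sqrt_sq_le _ _ _ _
    have h4 := pow_le_pow_left₀ (norm_nonneg _) h1 2
    have h5 := pow_le_pow_left₀ (norm_nonneg _) h2 2
    rw [mul_pow, sq_abs] at h4 h5
    linarith
  choose g hg hgn using key
  refine ⟨mkH1 U g hg, ?_, hUf, ?_⟩
  · obtain ⟨f1, hf1⟩ := hu
    obtain ⟨f2, hf2⟩ := hw
    refine ⟨fun r => ((Real.sqrt (‖f1 r‖ ^ 2 + ‖f2 r‖ ^ 2) : ℝ) : ℂ), ?_⟩
    filter_upwards [hf1, hf2, hUf] with x h1 h2 h3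
    refine h3.trans ?_
    rw [hf]; simp only [h1, h2]
  · rw [kinetic_eq, kinetic_eq, kinetic_eq, ← Finset.sum_add_distrib]
    exact Finset.sum_le_sum fun i _ => hgn i

/-! ### Radial test functions -/

lemma IsTest.isWeakPartial {φ : E3 → ℝ} (hφ : IsTest φ) (i : Fin 3) :
    IsWeakPartial i ((hφ.memLp.ofReal (K := ℂ)).toLp)
      (((hφ.memLp_partialDeriv i).ofReal (K := ℂ)).toLp) := by
  intro ψ hψ
  have e1 : ∫ x, partialDeriv i ψ x • ((hφ.memLp.ofReal (K := ℂ)).toLp : L2) x =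
      ((∫ x, partialDeriv i ψ x * φ x : ℝ) : ℂ) := by
    rw [← integral_complex_ofReal]
    refine integral_congr_ae ?_
    filter_upwards [(hφ.memLp.ofReal (K := ℂ)).coeFn_toLp] with x hx
    rw [hx]; simp
  have e2 : ∫ x, ψ x • (((hφ.memLp_partialDeriv i).ofReal (K := ℂ)).toLp : L2) x =
      ((∫ x, ψ x * partialDeriv i φ x : ℝ) : ℂ) := by
    rw [← integral_complex_ofReal]
    refine integral_congr_ae ?_
    filter_upwards [((hφ.memLp_partialDeriv i).ofReal (K := ℂ)).coeFn_toLp] with x hx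
    rw [hx]; simp
  rw [e1, e2, ← Complex.ofReal_neg]
  congr 1
  have hi : ∀ {f g : E3 → ℝ}, Continuous f → HasCompactSupport f → Continuous g →
      Integrable (fun x => f x * g x) := fun hf hs hg =>
    (hf.mul hg).integrable_of_hasCompactSupport hs.mul_right
  have := integral_mul_fderiv_eq_neg_fderiv_mul_of_integrable (μ := (volume : Measure E3)) (𝕜 := ℝ)
    (f := ψ) (g := φ) (v := unitVec i)
    (hi (hψ.continuous_partialDeriv i) (hψ.hasCompactSupport_partialDeriv i) hφ.1.continuous)
    (hi hψ.1.continuous hψ.2 (hφ.continuous_partialDeriv i))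
    (hi hψ.1.continuous hψ.2 hφ.1.continuous)
    (fun x _ => hψ.1.differentiable (by simp) x) (fun x _ => hφ.1.differentiable (by simp) x)
  unfold partialDeriv
  linarith

/-- A test function as an element of `H¹`. -/
def ofTest {φ : E3 → ℝ} (hφ : IsTest φ) : H1 := mkH1 _ _ hφ.isWeakPartial

lemma fn_ofTest {φ : E3 → ℝ} (hφ : IsTest φ) : ∀ᵐ x, fn (ofTest hφ) x = (φ x : ℂ) :=
  (hφ.memLp.ofReal (K := ℂ)).coeFn_toLp

lemma grad_ofTest {φ : E3 → ℝ} (hφ : IsTest φ) (i : Fin 3) :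
    ∀ᵐ x, grad (ofTest hφ) i x = (partialDeriv i φ x : ℂ) :=
  ((hφ.memLp_partialDeriv i).ofReal (K := ℂ)).coeFn_toLp

lemma mass_ofTest {φ : E3 → ℝ} (hφ : IsTest φ) : mass (ofTest hφ) = ∫ x, φ x ^ 2 := by
  refine integral_congr_ae ?_
  filter_upwards [fn_ofTest hφ] with x hx
  rw [hx, Complex.norm_real, Real.norm_eq_abs, sq_abs]

lemma kinetic_ofTest {φ : E3 → ℝ} (hφ : IsTest φ) :
    kinetic (ofTest hφ) = ∑ i, ∫ x, partialDeriv i φ x ^ 2 := by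
  refine Finset.sum_congr rfl fun i _ => integral_congr_ae ?_
  filter_upwards [grad_ofTest hφ i] with x hx
  rw [hx, Complex.norm_real, Real.norm_eq_abs, sq_abs]

lemma power_ofTest {φ : E3 → ℝ} (hφ : IsTest φ) (p : ℝ) :
    ∫ x, ‖fn (ofTest hφ) x‖ ^ p = ∫ x, |φ x| ^ p := by
  refine integral_congr_ae ?_
  filter_upwards [fn_ofTest hφ] with x hx
  rw [hx, Complex.norm_real, Real.norm_eq_abs]

/-! ### Coercivity, compactness, existence of minimizers -/

lemma integral_norm_mul_norm_le (f g : L2) : ∫ x, ‖f x‖ * ‖g x‖ ≤ ‖f‖ * ‖g‖ := by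
  have h := integral_mul_le_Lp_mul_Lq_of_nonneg (μ := (volume : Measure E3)) (p := 2) (q := 2)
    Real.HolderConjugate.two_two (ae_of_all _ fun x => norm_nonneg (f x))
    (ae_of_all _ fun x => norm_nonneg (g x)) (by simpa using (Lp.memLp f).norm)
    (by simpa using (Lp.memLp g).norm)
  have e : ∀ k : L2, (∫ x, ‖k x‖ ^ (2 : ℝ)) ^ (1 / 2 : ℝ) = ‖k‖ := fun k => by
    have h1 : ∀ x, ‖k x‖ ^ (2 : ℝ) = ‖k x‖ ^ 2 := fun x => by norm_cast
    simp_rw [h1]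
    rw [← norm_sq_eq_integral, ← Real.sqrt_eq_rpow, Real.sqrt_sq (norm_nonneg _)]
  rwa [e, e] at h

lemma integral_abs_sq_sub_le (f g : L2) :
    ∫ x, |‖f x‖ ^ 2 - ‖g x‖ ^ 2| ≤ ‖f - g‖ * (‖f‖ + ‖g‖) := by
  have hi : ∀ k l : L2, Integrable (fun x => ‖k x‖ * ‖l x‖) := fun k l =>
    (Lp.memLp k).norm.integrable_mul (Lp.memLp l).norm
  rw [mul_add]
  refine le_trans ?_ (add_le_add (integral_norm_mul_norm_le (f - g) f) (integral_norm_mul_norm_le (f - g) g))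
  rw [← integral_add (hi _ _) (hi _ _)]
  refine integral_mono_ae ((Lp.memLp f).norm.integrable_sq.sub (Lp.memLp g).norm.integrable_sq).abs
    ((hi _ _).add (hi _ _)) ?_
  filter_upwards [Lp.coeFn_sub f g] with x hx
  rw [hx, Pi.sub_apply, ← mul_add, sq_sub_sq, abs_mul, mul_comm,
    abs_of_nonneg (by positivity : 0 ≤ ‖f x‖ + ‖g x‖)]
  exact mul_le_mul_of_nonneg_right (abs_norm_sub_norm_le _ _) (by positivity)

/-- Either the sublinear term is at most A/2 and is absorbed, or A^{1-s} is at most 2k. The explicit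
form keeps track of how the bound scales with k. -/
lemma le_or_le_of_le_add_mul_rpow {A b k s : ℝ} (hA : 0 ≤ A) (hs1 : s < 1)
    (hs0 : 0 < s) (h : A ≤ b + k * A ^ s) : A ≤ 2 * b ∨ A ≤ (2 * k) ^ (1 / (1 - s)) := by
  rcases le_or_gt (k * A ^ s) (A / 2) with h1 | h1
  · left; linarith
  · right
    rcases hA.eq_or_lt with h0 | h0
    · rw [← h0, Real.zero_rpow hs0.ne'] at h1; linarith
    · have h2 : A ^ (1 - s) ≤ 2 * k := by
        rw [Real.rpow_sub h0, Real.rpow_one, div_le_iff₀ (by positivity)]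
        linarith
      have h3 := Real.rpow_le_rpow (by positivity) h2 (by
        have : 0 < 1 - s := by linarith
        positivity : 0 ≤ 1 / (1 - s))
      rwa [← Real.rpow_mul hA, mul_one_div_cancel (by linarith), Real.rpow_one] at h3

section Variational

set_option maxSynthPendingDepth 3

variable {α β q : ℝ}

lemma coulombD_rho_nonneg (u v : H1) : 0 ≤ coulombD (rho u v) (rho u v) :=
  IsDensity.coulombD_nonneg (fun x => by unfold rho dens; simp only [Pi.add_apply]; positivity)
    (fun x => by unfold rho dens; simp only [Pi.add_apply]; positivity)

/-- The Coulomb term is dropped and the coupling is bounded by the mean of the two power integrals,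
which changes the factor 1 into 1 + β. -/
lemma le_energy (hα : 0 < α) (hβ : 0 < β) (hq : 1 < q) (hq2 : q < 3 / 2) {u v : H1} (hu : u ∈ H1r)
    (hv : v ∈ H1r) : 1 / 2 * (kinetic u + kinetic v) - (1 + β) / (2 * q) *
      ((∫ x, ‖fn u x‖ ^ (2 * q)) + ∫ x, ‖fn v x‖ ^ (2 * q)) ≤ energy α β q u v := by
  have h1 := coulombD_rho_nonneg u v
  have h2 := integral_coupling_le hu hv hq hq2
  have h3 : β / q * (∫ x, ‖fn u x‖ ^ q * ‖fn v x‖ ^ q) ≤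
    β / q * (1 / 2 * ((∫ x, ‖fn u x‖ ^ (2 * q)) + ∫ x, ‖fn v x‖ ^ (2 * q))) := by gcongr
  have h4 : 0 ≤ α / 4 * coulombD (rho u v) (rho u v) := by positivity
  have h5 : (1 + β) / (2 * q) * ((∫ x, ‖fn u x‖ ^ (2 * q)) + ∫ x, ‖fn v x‖ ^ (2 * q)) =
    1 / (2 * q) * ((∫ x, ‖fn u x‖ ^ (2 * q)) + ∫ x, ‖fn v x‖ ^ (2 * q)) +
    β / q * (1 / 2 * ((∫ x, ‖fn u x‖ ^ (2 * q)) + ∫ x, ‖fn v x‖ ^ (2 * q))) := by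
    field_simp
  rw [energy_eq_coulombD, h5]
  linarith

lemma powers_le (hq : 1 < q) (hq2 : q < 3 / 2) {u v : H1} (hu : u ∈ H1r)
    (hv : v ∈ H1r) {a : ℝ} (hua : mass u ≤ a) (hva : mass v ≤ a) :
    (∫ x, ‖fn u x‖ ^ (2 * q)) + ∫ x, ‖fn v x‖ ^ (2 * q) ≤
      2 * gnConst q * a ^ ((3 - q) / 2) * (kinetic u + kinetic v) ^ (3 * (q - 1) / 2) := by
  have hC := gnConst_pos hq2
  have e : ∀ w : H1, w ∈ H1r → mass w ≤ a → kinetic w ≤ kinetic u + kinetic v →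
      ∫ x, ‖fn w x‖ ^ (2 * q) ≤
        gnConst q * (kinetic u + kinetic v) ^ (3 * (q - 1) / 2) * a ^ ((3 - q) / 2) := by
    intro w hw h1 h2
    refine (integral_power_le hw hq hq2).trans ?_
    have := kinetic_nonneg w
    have := mass_nonneg w
    have := kinetic_nonneg u
    have := kinetic_nonneg v
    have h3 : 0 ≤ 3 * (q - 1) / 2 := by linarith
    have h4 : 0 ≤ (3 - q) / 2 := by linarith
    gcongr
  have h1 := e u hu hua (by linarith [kinetic_nonneg v])
  have h2 := e v hv hva (by linarith [kinetic_nonneg u])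
  linarith

lemma kinetic_le_add_mul_rpow (hα : 0 < α) (hβ : 0 < β) (hq : 1 < q) (hq2 : q < 3 / 2) {u v : H1}
    (hu : u ∈ H1r) (hv : v ∈ H1r) {a E : ℝ} (hua : mass u ≤ a) (hva : mass v ≤ a)
    (hE : energy α β q u v ≤ E) : kinetic u + kinetic v ≤ 2 * E +
      (2 * (1 + β) / q * gnConst q * a ^ ((3 - q) / 2)) *
        (kinetic u + kinetic v) ^ (3 * (q - 1) / 2) := by
  have h1 := le_energy hα hβ hq hq2 hu hv
  have h2 : (1 + β) / (2 * q) * ((∫ x, ‖fn u x‖ ^ (2 * q)) + ∫ x, ‖fn v x‖ ^ (2 * q)) ≤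
      (1 + β) / (2 * q) *
        (2 * gnConst q * a ^ ((3 - q) / 2) * (kinetic u + kinetic v) ^ (3 * (q - 1) / 2)) := by
    gcongr
    exact powers_le hq hq2 hu hv hua hva
  have h3 : (2 * (1 + β) / q * gnConst q * a ^ ((3 - q) / 2)) *
        (kinetic u + kinetic v) ^ (3 * (q - 1) / 2) = 2 * ((1 + β) / (2 * q) *
        (2 * gnConst q * a ^ ((3 - q) / 2) * (kinetic u + kinetic v) ^ (3 * (q - 1) / 2))) := by
    field_simp
  rw [h3]
  linarith

/-- Coercivity: the kinetic exponent 3(q-1)/2 in Gagliardo–Nirenberg is below 1, so the kinetic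
energy absorbs the attractive terms. -/
lemma exists_kinetic_le (hα : 0 < α) (hβ : 0 < β) (hq : 1 < q) (hq2 : q < 3 / 2) (a E : ℝ) :
    ∃ K, ∀ u v : H1, u ∈ H1r → v ∈ H1r → mass u ≤ a → mass v ≤ a → energy α β q u v ≤ E →
      kinetic u + kinetic v ≤ K := by
  set k := 2 * (1 + β) / q * gnConst q * a ^ ((3 - q) / 2) with hk
  refine ⟨max (2 * (2 * E)) ((2 * k) ^ (1 / (1 - 3 * (q - 1) / 2))), fun u v hu hv h1 h2 h3 => ?_⟩
  have hC := gnConst_pos hq2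
  have ha : 0 ≤ a := (mass_nonneg u).trans h1
  rcases le_or_le_of_le_add_mul_rpow (add_nonneg (kinetic_nonneg u) (kinetic_nonneg v))
    (by linarith) (by linarith)
    (kinetic_le_add_mul_rpow hα hβ hq hq2 hu hv h1 h2 h3) with h | h
  · exact h.trans (le_max_left _ _)
  · exact h.trans (le_max_right _ _)

lemma exists_le_energy (hα : 0 < α) (hβ : 0 < β) (hq : 1 < q) (hq2 : q < 3 / 2) (a : ℝ) :
    ∃ b, ∀ u v : H1, u ∈ H1r → v ∈ H1r → mass u ≤ a → mass v ≤ a → b ≤ energy α β q u v := by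
  obtain ⟨K, hK⟩ := exists_kinetic_le hα hβ hq hq2 a 0
  have hC := gnConst_pos hq2
  refine ⟨min 0 (-((1 + β) / (2 * q) * (2 * gnConst q * a ^ ((3 - q) / 2) * K ^ (3 * (q - 1) / 2)))),
    fun u v hu hv h1 h2 => ?_⟩
  have ha : 0 ≤ a := (mass_nonneg u).trans h1
  rcases le_or_gt (energy α β q u v) 0 with h | h
  · refine (min_le_right _ _).trans ?_
    have h3 := le_energy hα hβ hq hq2 hu hv
    have hk := add_nonneg (kinetic_nonneg u) (kinetic_nonneg v)
    have h4 : (1 + β) / (2 * q) * ((∫ x, ‖fn u x‖ ^ (2 * q)) + ∫ x, ‖fn v x‖ ^ (2 * q)) ≤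
        (1 + β) / (2 * q) * (2 * gnConst q * a ^ ((3 - q) / 2) * K ^ (3 * (q - 1) / 2)) := by
      gcongr
      refine (powers_le hq hq2 hu hv h1 h2).trans ?_
      have : 0 ≤ 3 * (q - 1) / 2 := by linarith
      gcongr
      exact hK u v hu hv h1 h2 h
    linarith
  · exact (min_le_left _ _).trans h.le

/-- Continuous linear projection to the first component, as an `H¹` function. -/
def fstL : Phase →L[ℂ] H1 := H1r.subtypeL.comp (WithLp.fstL 2 ℂ H1r H1r)

/-- Continuous linear projection to the second component, as an `H¹` function. -/
def sndL : Phase →L[ℂ] H1 := H1r.subtypeL.comp (WithLp.sndL 2 ℂ H1r H1r)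

lemma norm_sq_Phase (w : Phase) :
    ‖w‖ ^ 2 = mass w.fst + kinetic w.fst + (mass w.snd + kinetic w.snd) := by
  rw [← norm_sq_H1, ← norm_sq_H1]
  exact WithLp.prod_norm_sq_eq_of_L2 w

lemma mass_le_norm_sq (w : Phase) : mass w.fst ≤ ‖w‖ ^ 2 ∧ mass w.snd ≤ ‖w‖ ^ 2 ∧
    kinetic w.fst ≤ ‖w‖ ^ 2 ∧ kinetic w.snd ≤ ‖w‖ ^ 2 := by
  rw [norm_sq_Phase]
  have h1 := mass_nonneg w.fst
  have h2 := mass_nonneg w.snd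
  have h3 := kinetic_nonneg w.fst
  have h4 := kinetic_nonneg w.snd
  refine ⟨?_, ?_, ?_, ?_⟩ <;> linarith

lemma coulombD_rho_le {u v : H1} (hu : u ∈ H1r) (hv : v ∈ H1r) :
    coulombD (rho u v) (rho u v) ≤ (mass u + mass v) *
      (18 * kinetic u + mass u + (18 * kinetic v + mass v)) := by
  rw [← integral_rho]
  refine (isDensity_rho hu hv).coulombD_le (isDensity_rho hu hv) fun x => ?_
  rw [rho, (isDensity_dens hu).pot_add (isDensity_dens hv)]
  have h1 := pot_dens_le hu one_pos x
  have h2 := pot_dens_le hv one_pos x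
  simp only [mul_one, div_one] at h1 h2
  linarith

lemma exists_subseq_tendsto_real {f : ℕ → ℝ} {C : ℝ} (hf : ∀ n, |f n| ≤ C) :
    ∃ l, ∃ ns : ℕ → ℕ, StrictMono ns ∧ Tendsto (f ∘ ns) atTop (𝓝 l) := by
  obtain ⟨l, -, ns, hns, hl⟩ := tendsto_subseq_of_bounded
    (Metric.isBounded_closedBall (x := (0 : ℝ)) (r := C)) (x := f)
    (fun n => by simpa using hf n)
  exact ⟨l, ns, hns, hl⟩

set_option maxHeartbeats 1000000 in
/-- Energies of weakly convergent sequences. -/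
lemma exists_subseq_of_energy_le (hα : 0 < α) (hβ : 0 < β) (hq : 1 < q) (hq2 : q < 3 / 2)
    {w : ℕ → Phase} {a₁ a₂ E : ℝ}
    (h1 : ∀ ε > 0, ∀ᶠ n in atTop, mass (w n).fst ≤ a₁ + ε)
    (h2 : ∀ ε > 0, ∀ᶠ n in atTop, mass (w n).snd ≤ a₂ + ε)
    (hE : ∀ ε > 0, ∀ᶠ n in atTop, energyP α β q (w n) ≤ E + ε) :
    ∃ w₀ : Phase, ∃ ns : ℕ → ℕ, StrictMono ns ∧ mass w₀.fst ≤ a₁ ∧ mass w₀.snd ≤ a₂ ∧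
      energyP α β q w₀ ≤ E ∧ (mass w₀.fst = a₁ → mass w₀.snd = a₂ → energyP α β q w₀ = E →
        Tendsto (w ∘ ns) atTop (𝓝 w₀)) := by
  obtain ⟨K, hK⟩ := exists_kinetic_le hα hβ hq hq2 (max (a₁ + 1) (a₂ + 1)) (E + 1)
  obtain ⟨N, hN⟩ := eventually_atTop.mp ((h1 1 one_pos).and ((h2 1 one_pos).and (hE 1 one_pos)))
  set A := max K (max (a₁ + 1) (a₂ + 1)) with hA
  set w' : ℕ → Phase := fun n => w (n + N) with hw'
  have hb : ∀ n, (kinetic (w' n).fst ≤ A ∧ mass (w' n).fst ≤ A) ∧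
      (kinetic (w' n).snd ≤ A ∧ mass (w' n).snd ≤ A) := by
    intro n
    obtain ⟨e1, e2, e3⟩ := hN (n + N) (by omega)
    have e4 := hK (w' n).fst (w' n).snd (w' n).fst.2 (w' n).snd.2 (e1.trans (le_max_left _ _))
      (e2.trans (le_max_right _ _)) e3
    have e5 := kinetic_nonneg (w' n).fst
    have e6 := kinetic_nonneg (w' n).snd
    refine ⟨⟨?_, e1.trans ?_⟩, ?_, e2.trans ?_⟩
    · exact le_trans (by linarith) (le_max_left _ _)
    · exact (le_max_left _ _).trans (le_max_right _ _)
    · exact le_trans (by linarith) (le_max_left _ _)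
    · exact (le_max_right _ _).trans (le_max_right _ _)
  have hA0 : 0 ≤ A := (kinetic_nonneg _).trans (hb 0).1.1
  have hnorm : ∀ n, ‖w' n‖ ≤ Real.sqrt (4 * A) := by
    intro n
    refine Real.le_sqrt_of_sq_le ?_
    rw [norm_sq_Phase]
    obtain ⟨⟨e1, e2⟩, e3, e4⟩ := hb n
    linarith
  obtain ⟨w₀, n1, hn1, hweak⟩ := exists_weakTendsto_subseq hnorm
  -- The masses, the kinetic sum and the Coulomb energy are made to converge separately, so that
  -- each can be compared with its value at the weak limit.
  obtain ⟨l1, n2, hn2, hl1⟩ := exists_subseq_tendsto_real (C := A)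
    (f := fun n => mass (w' (n1 n)).fst) fun n => by
      rw [abs_of_nonneg (mass_nonneg _)]; exact (hb _).1.2
  obtain ⟨l2, n3, hn3, hl2⟩ := exists_subseq_tendsto_real (C := A)
    (f := fun n => mass (w' (n1 (n2 n))).snd) fun n => by
      rw [abs_of_nonneg (mass_nonneg _)]; exact (hb _).2.2
  obtain ⟨k, n4, hn4, hk⟩ := exists_subseq_tendsto_real (C := 2 * A)
    (f := fun n => kinetic (w' (n1 (n2 (n3 n)))).fst + kinetic (w' (n1 (n2 (n3 n)))).snd) fun n => by
      rw [abs_of_nonneg (add_nonneg (kinetic_nonneg _) (kinetic_nonneg _))]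
      linarith [(hb (n1 (n2 (n3 n)))).1.1, (hb (n1 (n2 (n3 n)))).2.1]
  obtain ⟨d, n5, hn5, hd⟩ := exists_subseq_tendsto_real
    (C := (A + A) * (18 * A + A + (18 * A + A)))
    (f := fun n => coulombD (rho (w' (n1 (n2 (n3 (n4 n))))).fst (w' (n1 (n2 (n3 (n4 n))))).snd)
      (rho (w' (n1 (n2 (n3 (n4 n))))).fst (w' (n1 (n2 (n3 (n4 n))))).snd)) fun n => by
      rw [abs_of_nonneg (coulombD_rho_nonneg _ _)]
      refine (coulombD_rho_le (Subtype.property _) (Subtype.property _)).trans ?_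
      obtain ⟨⟨e1, e2⟩, e3, e4⟩ := hb (n1 (n2 (n3 (n4 n))))
      have := mass_nonneg (w' (n1 (n2 (n3 (n4 n))))).fst
      have := mass_nonneg (w' (n1 (n2 (n3 (n4 n))))).snd
      have := kinetic_nonneg (w' (n1 (n2 (n3 (n4 n))))).fst
      have := kinetic_nonneg (w' (n1 (n2 (n3 (n4 n))))).snd
      gcongr
  set ns : ℕ → ℕ := fun n => n1 (n2 (n3 (n4 (n5 n)))) with hns
  have hnsm : StrictMono ns := hn1.comp (hn2.comp (hn3.comp (hn4.comp hn5)))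
  set z : ℕ → Phase := fun n => w' (ns n) with hz
  have hzw : WeakTendsto z w₀ := fun ℓ =>
    (hweak ℓ).comp (hn2.comp (hn3.comp (hn4.comp hn5))).tendsto_atTop
  have tl1 : Tendsto (fun n => mass (z n).fst) atTop (𝓝 l1) :=
    hl1.comp (hn3.comp (hn4.comp hn5)).tendsto_atTop
  have tl2 : Tendsto (fun n => mass (z n).snd) atTop (𝓝 l2) :=
    hl2.comp (hn4.comp hn5).tendsto_atTop
  have tk : Tendsto (fun n => kinetic (z n).fst + kinetic (z n).snd) atTop (𝓝 k) :=
    hk.comp hn5.tendsto_atTop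
  have td : Tendsto (fun n => coulombD (rho (z n).fst (z n).snd) (rho (z n).fst (z n).snd)) atTop
    (𝓝 d) := hd
  have hmono : StrictMono fun n => ns n + N := fun i j hij => Nat.add_lt_add_right (hnsm hij) N
  have w1 : WeakTendsto (fun n => ((z n).fst : H1)) (w₀.fst : H1) := hzw.map fstL
  have w2 : WeakTendsto (fun n => ((z n).snd : H1)) (w₀.snd : H1) := hzw.map sndL
  have a1 := ae_tendsto_of_weakTendsto (fun n => (z n).fst.2) w₀.fst.2 w1
  have a2 := ae_tendsto_of_weakTendsto (fun n => (z n).snd.2) w₀.snd.2 w2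
  have m1 : mass w₀.fst ≤ l1 := by
    rw [mass_eq]
    exact (w1.map valL).norm_sq_le tl1 (Eventually.of_forall fun n => (mass_eq _).ge)
  have m2 : mass w₀.snd ≤ l2 := by
    rw [mass_eq]
    exact (w2.map valL).norm_sq_le tl2 (Eventually.of_forall fun n => (mass_eq _).ge)
  have m3 : l1 ≤ a₁ := le_of_forall_pos_le_add fun ε hε =>
    le_of_tendsto tl1 (hmono.tendsto_atTop.eventually (h1 ε hε))
  have m4 : l2 ≤ a₂ := le_of_forall_pos_le_add fun ε hε =>
    le_of_tendsto tl2 (hmono.tendsto_atTop.eventually (h2 ε hε))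
  have mfull : mass w₀.fst + kinetic w₀.fst + (mass w₀.snd + kinetic w₀.snd) ≤ l1 + l2 + k := by
    rw [← norm_sq_Phase]
    refine hzw.norm_sq_le ((tl1.add tl2).add tk) (Eventually.of_forall fun n => ?_)
    rw [norm_sq_Phase]
    linarith
  have m5 : kinetic w₀.fst + kinetic w₀.snd ≤ k := by
    set T : H1 →L[ℂ] PiLp 2 (fun _ : Fin 3 => L2) := (WithLp.sndL 2 ℂ _ _).comp H1.subtypeL
    have hT : ∀ y, ‖T y‖ ^ 2 = kinetic y := fun y => by
      rw [PiLp.norm_sq_eq_of_L2, kinetic_eq]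
      rfl
    rw [← hT, ← hT]
    refine (w1.map T).norm_sq_add_le (w2.map T) tk (Eventually.of_forall fun n => ?_)
    rw [hT, hT]
  have m6 : coulombD (rho w₀.fst w₀.snd) (rho w₀.fst w₀.snd) ≤ d := by
    refine IsDensity.coulombD_le_of_tendsto (fun n => isDensity_rho (z n).fst.2 (z n).snd.2)
      (isDensity_rho w₀.fst.2 w₀.snd.2) ?_ td fun n => le_rfl
    filter_upwards [a1, a2] with x e1 e2
    exact (e1.norm.pow 2).add (e2.norm.pow 2)
  have t1 := tendsto_integral_power (fun n => (z n).fst.2) w₀.fst.2 hq hq2 (fun n => (hb _).1) a1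
  have t2 := tendsto_integral_power (fun n => (z n).snd.2) w₀.snd.2 hq hq2 (fun n => (hb _).2) a2
  have t3 := tendsto_integral_coupling (fun n => (z n).fst.2) (fun n => (z n).snd.2) w₀.fst.2
    w₀.snd.2 hq hq2 (fun n => (hb _).1) (fun n => (hb _).2) a1 a2
  have te := (((tk.const_mul (1 / 2)).add (td.const_mul (α / 4))).sub
    ((t1.add t2).const_mul (1 / (2 * q)))).sub (t3.const_mul (β / q))
  have hen : ∀ n, energyP α β q (z n) =
      1 / 2 * (kinetic (z n).fst + kinetic (z n).snd) + α / 4 *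
        coulombD (rho (z n).fst (z n).snd) (rho (z n).fst (z n).snd) -
      1 / (2 * q) * ((∫ x, ‖fn (z n).fst x‖ ^ (2 * q)) + ∫ x, ‖fn (z n).snd x‖ ^ (2 * q)) -
      β / q * ∫ x, ‖fn (z n).fst x‖ ^ q * ‖fn (z n).snd x‖ ^ q := by
    intro n
    rw [energyP, energy_eq_coulombD]
    ring
  simp_rw [← hen] at te
  have m7 := le_of_forall_pos_le_add fun ε hε =>
    le_of_tendsto te (hmono.tendsto_atTop.eventually (hE ε hε))
  have m8 : α / 4 * coulombD (rho w₀.fst w₀.snd) (rho w₀.fst w₀.snd) ≤ α / 4 * d := by gcongr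
  refine ⟨w₀, fun n => ns n + N, hmono, m1.trans m3, m2.trans m4, ?_, fun f1 f2 f3 => ?_⟩
  · rw [energyP, energy_eq_coulombD]
    linarith
  · refine hzw.tendsto ?_
    rw [energyP, energy_eq_coulombD] at f3
    have e1 : l1 = mass w₀.fst := le_antisymm (by linarith) m1
    have e2 : l2 = mass w₀.snd := le_antisymm (by linarith) m2
    -- The kinetic and Coulomb terms can each only drop in the limit; as the total energy does not
    -- drop, the kinetic limit is attained. With the masses this gives convergence of norms, hence
    -- strong convergence.
    have e3 : k = kinetic w₀.fst + kinetic w₀.snd := le_antisymm (by linarith) m5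
    rw [norm_sq_Phase]
    simp_rw [norm_sq_Phase]
    have := (tl1.add tl2).add tk
    rw [e1, e2, e3] at this
    refine (this.congr fun n => by ring).trans (le_of_eq ?_)
    congr 1
    ring

lemma tendsto_valL_fst {w : ℕ → Phase} {g : Phase} (h : Tendsto w atTop (𝓝 g)) :
    Tendsto (fun n => valL (w n).fst) atTop (𝓝 (valL g.fst)) :=
  ((valL.comp fstL).continuous.tendsto g).comp h

lemma tendsto_valL_snd {w : ℕ → Phase} {g : Phase} (h : Tendsto w atTop (𝓝 g)) :
    Tendsto (fun n => valL (w n).snd) atTop (𝓝 (valL g.snd)) :=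
  ((valL.comp sndL).continuous.tendsto g).comp h

lemma tendsto_mass {w : ℕ → Phase} {g : Phase} (h : Tendsto w atTop (𝓝 g)) :
    Tendsto (fun n => mass (w n).fst) atTop (𝓝 (mass g.fst)) ∧
    Tendsto (fun n => mass (w n).snd) atTop (𝓝 (mass g.snd)) := by
  simp_rw [mass_eq]
  exact ⟨(tendsto_valL_fst h).norm.pow 2, (tendsto_valL_snd h).norm.pow 2⟩

lemma tendsto_kinetic {w : ℕ → Phase} {g : Phase} (h : Tendsto w atTop (𝓝 g)) :
    Tendsto (fun n => kinetic (w n).fst) atTop (𝓝 (kinetic g.fst)) ∧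
    Tendsto (fun n => kinetic (w n).snd) atTop (𝓝 (kinetic g.snd)) := by
  simp_rw [kinetic_eq]
  constructor
  · exact tendsto_finsetSum _ fun i _ =>
      ((((gradL i).comp fstL).continuous.tendsto g).comp h).norm.pow 2
  · exact tendsto_finsetSum _ fun i _ =>
      ((((gradL i).comp sndL).continuous.tendsto g).comp h).norm.pow 2

lemma tendsto_integral_abs_dens_sub {u : ℕ → H1} {u₀ : H1}
    (h : Tendsto (fun n => valL (u n)) atTop (𝓝 (valL u₀))) :
    Tendsto (fun n => ∫ x, |dens (u n) x - dens u₀ x|) atTop (𝓝 0) := by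
  have c := ((h.sub_const (valL u₀)).norm).mul (h.norm.add_const ‖valL u₀‖)
  rw [sub_self, norm_zero, zero_mul] at c
  exact squeeze_zero (fun n => integral_nonneg fun x => abs_nonneg _)
    (fun n => integral_abs_sq_sub_le (valL (u n)) (valL u₀)) c

set_option maxHeartbeats 1000000 in
/-- Upper semicontinuity of the energy in the norm topology. -/
lemma eventually_energyP_le (hα : 0 < α) (hq : 1 < q) (hq2 : q < 3 / 2)
    {w : ℕ → Phase} {g : Phase} (h : Tendsto w atTop (𝓝 g)) :
    ∀ ε > 0, ∀ᶠ n in atTop, energyP α β q (w n) ≤ energyP α β q g + ε := by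
  have hweak : WeakTendsto w g := fun ℓ => (ℓ.continuous.tendsto g).comp h
  have a1 := ae_tendsto_of_weakTendsto (fun n => (w n).fst.2) g.fst.2 (hweak.map fstL)
  have a2 := ae_tendsto_of_weakTendsto (fun n => (w n).snd.2) g.snd.2 (hweak.map sndL)
  obtain ⟨C, hC⟩ := (h.norm.pow 2).bddAbove_range
  have hCn : ∀ n, ‖w n‖ ^ 2 ≤ C := fun n => hC ⟨n, rfl⟩
  have hb : ∀ n, (kinetic (w n).fst ≤ C ∧ mass (w n).fst ≤ C) ∧
      (kinetic (w n).snd ≤ C ∧ mass (w n).snd ≤ C) := fun n => by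
    obtain ⟨e1, e2, e3, e4⟩ := mass_le_norm_sq (w n)
    have := hCn n
    exact ⟨⟨e3.trans this, e1.trans this⟩, e4.trans this, e2.trans this⟩
  have hC0 : 0 ≤ C := (kinetic_nonneg _).trans (hb 0).1.1
  have t1 := tendsto_integral_power (fun n => (w n).fst.2) g.fst.2 hq hq2 (fun n => (hb n).1) a1
  have t2 := tendsto_integral_power (fun n => (w n).snd.2) g.snd.2 hq hq2 (fun n => (hb n).2) a2
  have t3 := tendsto_integral_coupling (fun n => (w n).fst.2) (fun n => (w n).snd.2) g.fst.2
    g.snd.2 hq hq2 (fun n => (hb n).1) (fun n => (hb n).2) a1 a2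
  have tk : Tendsto (fun n => kinetic (w n).fst + kinetic (w n).snd) atTop
      (𝓝 (kinetic g.fst + kinetic g.snd)) :=
    (tendsto_kinetic h).1.add (tendsto_kinetic h).2
  set σ := rho g.fst g.snd with hσ
  have dσ : IsDensity σ := isDensity_rho g.fst.2 g.snd.2
  set s : ℕ → E3 → ℝ := fun n => rho (w n).fst (w n).snd with hs
  have ds : ∀ n, IsDensity (s n) := fun n => isDensity_rho (w n).fst.2 (w n).snd.2
  -- Since s n ≤ σ + τ n, monotonicity and bilinearity bound the Coulomb energy of s n by that of σ
  -- plus terms linear in ∫ τ n, which tends to 0.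
  set τ : ℕ → E3 → ℝ := fun n x => |s n x - σ x| with hτ
  have dτ : ∀ n, IsDensity (τ n) := fun n => ((ds n).add dσ).mono
    (((ds n).meas.sub dσ.meas).abs) (fun x => abs_nonneg _) (ae_of_all _ fun x => by
      rw [hτ, Pi.add_apply, abs_le]
      have := (ds n).nonneg x
      have := dσ.nonneg x
      constructor <;> linarith)
  have hpot : ∀ u v : H1, u ∈ H1r → v ∈ H1r → ∀ x, pot (rho u v) x ≤
      (18 * kinetic u + mass u) + (18 * kinetic v + mass v) := by
    intro u v hu hv x
    rw [rho, (isDensity_dens hu).pot_add (isDensity_dens hv)]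
    have h1 := pot_dens_le hu one_pos x
    have h2 := pot_dens_le hv one_pos x
    simp only [mul_one, div_one] at h1 h2
    linarith
  obtain ⟨B, hB⟩ := dσ.bdd
  -- 38 = 18 + 1 + 18 + 1 collects the kinetic and mass contributions of both components to the
  -- potential of s n; B bounds the potential of σ.
  set M := 38 * C + B with hM
  have hτM : ∀ n x, pot (τ n) x ≤ M := by
    intro n x
    refine (((ds n).add dσ).pot_mono (dτ n) (ae_of_all _ fun x => ?_) x).trans ?_
    · rw [hτ, Pi.add_apply, abs_le]
      have := (ds n).nonneg x
      have := dσ.nonneg x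
      constructor <;> linarith
    · rw [(ds n).pot_add dσ]
      have e1 := hpot _ _ (w n).fst.2 (w n).snd.2 x
      obtain ⟨⟨e2, e3⟩, e4, e5⟩ := hb n
      have := hB x
      linarith
  have hint : Tendsto (fun n => ∫ x, τ n x) atTop (𝓝 0) := by
    have hi : ∀ a b : H1, Integrable fun x => |dens a x - dens b x| := fun a b =>
      ((integrable_norm_sq a).sub (integrable_norm_sq b)).abs
    have c3 := (tendsto_integral_abs_dens_sub (tendsto_valL_fst h)).add
      (tendsto_integral_abs_dens_sub (tendsto_valL_snd h))
    rw [add_zero] at c3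
    refine squeeze_zero (fun n => integral_nonneg fun x => abs_nonneg _) (fun n => ?_) c3
    rw [← integral_add (hi _ _) (hi _ _)]
    refine integral_mono (dτ n).integrable ((hi _ _).add (hi _ _)) fun x => ?_
    refine le_trans (le_of_eq ?_) (abs_add_le _ _)
    simp only [hτ, hs, hσ, rho, Pi.add_apply]
    congr 1
    ring
  have hD : ∀ n, coulombD (s n) (s n) ≤ coulombD σ σ + (2 * B + M) * ∫ x, τ n x := by
    intro n
    have e1 : coulombD (s n) (s n) ≤ coulombD (σ + τ n) (σ + τ n) := by
      have hle : ∀ᵐ x, s n x ≤ (σ + τ n) x := ae_of_all _ fun x => by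
        rw [Pi.add_apply, hτ]
        linarith [le_abs_self (s n x - σ x)]
      exact (ds n).coulombD_mono (ds n) (dσ.add (dτ n)) (dσ.add (dτ n)) hle hle
    rw [dσ.coulombD_add_self (dτ n), dσ.coulombD_comm (dτ n)] at e1
    have e2 := (dτ n).coulombD_le dσ hB
    have e3 := (dτ n).coulombD_le (dτ n) (hτM n)
    linarith
  have te := (((tk.const_mul (1 / 2)).add (((hint.const_mul (2 * B + M)).const_add
    (coulombD σ σ)).const_mul (α / 4))).sub
    ((t1.add t2).const_mul (1 / (2 * q)))).sub (t3.const_mul (β / q))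
  intro ε hε
  filter_upwards [te.eventually_lt_const (lt_add_of_pos_right _ hε)] with n hn
  have e4 : α / 4 * coulombD (s n) (s n) ≤ α / 4 * (coulombD σ σ + (2 * B + M) * ∫ x, τ n x) :=
    mul_le_mul_of_nonneg_left (hD n) (by positivity)
  rw [energyP, energyP, energy_eq_coulombD, energy_eq_coulombD]
  linarith

/-! ### Relaxed minimizers and the stability argument. -/

/-- `(u, v)` minimizes the energy among radial pairs with masses at most `a₁`, `a₂`. -/
structure IsMin (α β q a₁ a₂ : ℝ) (u v : H1) : Prop where
  fst_mem : u ∈ H1r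
  snd_mem : v ∈ H1r
  mass_fst : mass u ≤ a₁
  mass_snd : mass v ≤ a₂
  le : ∀ u' v' : H1, u' ∈ H1r → v' ∈ H1r → mass u' ≤ a₁ → mass v' ≤ a₂ →
    energy α β q u v ≤ energy α β q u' v'

lemma IsMin.swap {a₁ a₂ : ℝ} {u v : H1} (h : IsMin α β q a₁ a₂ u v) : IsMin α β q a₂ a₁ v u :=
  ⟨h.snd_mem, h.fst_mem, h.mass_snd, h.mass_fst, fun u' v' h1 h2 h3 h4 => by
    rw [energy_comm, energy_comm _ _ _ u']; exact h.le v' u' h2 h1 h4 h3⟩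

lemma mass_zero : mass 0 = 0 := by rw [mass_eq]; simp

/-- The direct method works because the relaxed constraints survive weak limits, whereas equality of
masses need not. -/
lemma exists_isMin (hα : 0 < α) (hβ : 0 < β) (hq : 1 < q) (hq2 : q < 3 / 2) {a₁ a₂ : ℝ}
    (ha₁ : 0 ≤ a₁) (ha₂ : 0 ≤ a₂) : ∃ w : Phase, IsMin α β q a₁ a₂ w.fst w.snd := by
  set s : Set ℝ := energyP α β q '' {w | mass w.fst ≤ a₁ ∧ mass w.snd ≤ a₂}
  have hne : s.Nonempty := ⟨_, 0, ⟨by simpa [mass_zero] using ha₁, by simpa [mass_zero] using ha₂⟩, rfl⟩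
  have hbdd : BddBelow s := by
    obtain ⟨b, hb⟩ := exists_le_energy hα hβ hq hq2 (max a₁ a₂)
    refine ⟨b, ?_⟩
    rintro _ ⟨w, ⟨h1, h2⟩, rfl⟩
    exact hb _ _ w.fst.2 w.snd.2 (h1.trans (le_max_left _ _)) (h2.trans (le_max_right _ _))
  obtain ⟨e, -, he, hes⟩ := exists_seq_tendsto_sInf hne hbdd
  choose w hw hwe using hes
  obtain ⟨w₀, -, -, h1, h2, h3, -⟩ := exists_subseq_of_energy_le hα hβ hq hq2 (w := w)
    (a₁ := a₁) (a₂ := a₂) (E := sInf s)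
    (fun ε hε => Eventually.of_forall fun n => (hw n).1.trans (by linarith))
    (fun ε hε => Eventually.of_forall fun n => (hw n).2.trans (by linarith))
    (fun ε hε => by
      filter_upwards [he.eventually_lt_const (lt_add_of_pos_right _ hε)] with n hn
      rw [hwe]; exact hn.le)
  refine ⟨w₀, w₀.fst.2, w₀.snd.2, h1, h2, fun u' v' hu hv h4 h5 => h3.trans ?_⟩
  exact csInf_le hbdd ⟨WithLp.toLp 2 (⟨u', hu⟩, ⟨v', hv⟩), ⟨h4, h5⟩, rfl⟩

/-- If all minimizers under the relaxed mass constraints have full masses, then the set of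
constrained minimizers is non-empty and orbitally stable. -/
theorem nonempty_and_orbitallyStable (hα : 0 < α) (hβ : 0 < β) (hq : 1 < q) (hq2 : q < 3 / 2)
    (hloc : LocalTheory α β q) {a₁ a₂ : ℝ} (ha₁ : 0 ≤ a₁) (ha₂ : 0 ≤ a₂)
    (hsat : ∀ u v : H1, IsMin α β q a₁ a₂ u v → mass u = a₁ ∧ mass v = a₂) :
    (G α β q a₁ a₂).Nonempty ∧ OrbitallyStable α β q a₁ a₂ := by
  obtain ⟨g₀, hg₀⟩ := exists_isMin hα hβ hq hq2 ha₁ ha₂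
  have hg₀S : g₀ ∈ S a₁ a₂ := hsat _ _ hg₀
  have hleast : IsLeast (energyP α β q '' S a₁ a₂) (energyP α β q g₀) := by
    refine ⟨⟨g₀, hg₀S, rfl⟩, ?_⟩
    rintro _ ⟨w, hw, rfl⟩
    exact hg₀.le _ _ w.fst.2 w.snd.2 hw.1.le hw.2.le
  have hm : m α β q a₁ a₂ = energyP α β q g₀ := hleast.csInf_eq
  have hG : (G α β q a₁ a₂).Nonempty := ⟨g₀, hg₀S, hm.symm⟩
  -- Compactness of minimizing sequences, even when the constraints hold only asymptotically: the
  -- weak limit is a relaxed minimizer, saturation restores its masses, and then convergence is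
  -- strong.
  have hlim : ∀ w : ℕ → Phase, (∀ ε > 0, ∀ᶠ n in atTop, mass (w n).fst ≤ a₁ + ε) →
      (∀ ε > 0, ∀ᶠ n in atTop, mass (w n).snd ≤ a₂ + ε) →
      (∀ ε > 0, ∀ᶠ n in atTop, energyP α β q (w n) ≤ m α β q a₁ a₂ + ε) →
      ∃ g ∈ G α β q a₁ a₂, ∃ ns : ℕ → ℕ, StrictMono ns ∧ Tendsto (w ∘ ns) atTop (𝓝 g) := by
    intro w h1 h2 h3
    obtain ⟨w₀, ns, hns, e1, e2, e3, e4⟩ := exists_subseq_of_energy_le hα hβ hq hq2 h1 h2 h3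
    have hmin : IsMin α β q a₁ a₂ w₀.fst w₀.snd := by
      refine ⟨w₀.fst.2, w₀.snd.2, e1, e2, fun u' v' hu hv h4 h5 => e3.trans ?_⟩
      rw [hm]
      exact hg₀.le u' v' hu hv h4 h5
    obtain ⟨f1, f2⟩ := hsat _ _ hmin
    have f3 : energyP α β q w₀ = m α β q a₁ a₂ :=
      le_antisymm e3 (by rw [hm]; exact hg₀.le _ _ w₀.fst.2 w₀.snd.2 e1 e2)
    exact ⟨w₀, ⟨⟨f1, f2⟩, f3⟩, ns, hns, e4 f1 f2 f3⟩
  refine ⟨hG, ?_⟩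
  -- Conservation and coercivity bound the norm of a solution, which excludes blow-up at a finite
  -- time.
  have hglobal : ∀ w : Phase, ∃ Ψ : ℝ → Phase, IsSolution α β q ⊤ Ψ ∧ Ψ 0 = w := by
    intro w
    obtain ⟨T, hT0, Ψ, hΨ, hΨ0, hblow⟩ := hloc.exists_maximal w
    by_cases hT : T = ⊤
    · exact ⟨Ψ, hT ▸ hΨ, hΨ0⟩
    exfalso
    obtain ⟨K, hK⟩ := exists_kinetic_le hα hβ hq hq2 (max (mass w.fst) (mass w.snd)) (energyP α β q w)
    have hbd : ∀ t ∈ timeInterval T, ‖Ψ t‖ ^ 2 ≤ mass w.fst + mass w.snd + K := by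
      intro t ht
      have e1 := hloc.mass_fst T Ψ hΨ t ht
      have e2 := hloc.mass_snd T Ψ hΨ t ht
      have e3 := hloc.energy_eq T Ψ hΨ t ht
      rw [hΨ0] at e1 e2 e3
      have e4 := hK (Ψ t).fst (Ψ t).snd (Ψ t).fst.2 (Ψ t).snd.2 (e1.le.trans (le_max_left _ _))
        (e2.le.trans (le_max_right _ _)) e3.le
      rw [norm_sq_Phase]
      linarith
    lift T to ℝ using ⟨hT, (bot_lt_iff_ne_bot.mp (lt_trans (by simp) hT0))⟩
    have hT0' : 0 < T := by exact_mod_cast hT0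
    have hb := hblow hT
    rw [EReal.toReal_coe] at hb
    have h1 : ∀ᶠ t in 𝓝[<] T, t ∈ timeInterval (T : EReal) := by
      have : ∀ᶠ t in 𝓝[<] T, t ∈ Ioo 0 T := Ioo_mem_nhdsLT hT0'
      filter_upwards [this] with t ht
      exact ⟨ht.1.le, by exact_mod_cast ht.2⟩
    obtain ⟨t, ht1, ht2⟩ := (h1.and (hb.eventually_gt_atTop
      (Real.sqrt (mass w.fst + mass w.snd + K)))).exists
    exact absurd (Real.le_sqrt_of_sq_le (hbd t ht1)) (not_le.mpr ht2)
  intro ε hε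
  by_contra hcon
  push Not at hcon
  have hbad : ∀ n : ℕ, ∃ w : Phase, Metric.infDist w (G α β q a₁ a₂) < 1 / ((n : ℝ) + 1) ∧
      ∃ z : Phase, mass z.fst = mass w.fst ∧ mass z.snd = mass w.snd ∧
        energyP α β q z = energyP α β q w ∧ ε ≤ Metric.infDist z (G α β q a₁ a₂) := by
    intro n
    obtain ⟨w, hw, h⟩ := hcon (1 / ((n : ℝ) + 1)) (by positivity)
    obtain ⟨T, Ψ, hΨ, hΨ0, t, ht, -, hd⟩ := h (hglobal w)
    refine ⟨w, hw, Ψ t, ?_, ?_, ?_, hd⟩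
    · rw [hloc.mass_fst T Ψ hΨ t ht, hΨ0]
    · rw [hloc.mass_snd T Ψ hΨ t ht, hΨ0]
    · rw [hloc.energy_eq T Ψ hΨ t ht, hΨ0]
  choose w hw z hz1 hz2 hz3 hz4 using hbad
  have hg : ∀ n, ∃ g ∈ G α β q a₁ a₂, dist (w n) g < 1 / ((n : ℝ) + 1) := fun n =>
    (Metric.infDist_lt_iff hG).mp (hw n)
  choose g hgG hgd using hg
  -- The nearby points of G form a minimizing sequence themselves, so they converge along a
  -- subsequence, and the data w converge with them.
  obtain ⟨g', hg'G, ns, hns, hlim1⟩ := hlim g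
    (fun ε hε => Eventually.of_forall fun n => by rw [(hgG n).1.1]; linarith)
    (fun ε hε => Eventually.of_forall fun n => by rw [(hgG n).1.2]; linarith)
    (fun ε hε => Eventually.of_forall fun n => by rw [(hgG n).2]; linarith)
  have hwlim : Tendsto (w ∘ ns) atTop (𝓝 g') := by
    have hd : Tendsto (fun n => dist ((g ∘ ns) n) ((w ∘ ns) n)) atTop (𝓝 0) := by
      refine squeeze_zero (fun n => dist_nonneg) (fun n => ?_)
        (tendsto_one_div_add_atTop_nhds_zero_nat.comp hns.tendsto_atTop)
      rw [dist_comm]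
      exact (hgd (ns n)).le
    exact (tendsto_iff_of_dist hd).mp hlim1
  obtain ⟨tm1, tm2⟩ := tendsto_mass hwlim
  -- By conservation the escaped states z have the masses and energies of the data, so they too
  -- accumulate at a point of G, although they stay at distance at least ε.
  obtain ⟨z', hz'G, ns', hns', hlim2⟩ := hlim (z ∘ ns)
    (fun ε hε => by
      filter_upwards [tm1.eventually_lt_const (lt_add_of_pos_right _ hε)] with n hn
      rw [Function.comp_apply, hz1, ← hg'G.1.1]; exact hn.le)
    (fun ε hε => by
      filter_upwards [tm2.eventually_lt_const (lt_add_of_pos_right _ hε)] with n hn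
      rw [Function.comp_apply, hz2, ← hg'G.1.2]; exact hn.le)
    (fun ε hε => by
      filter_upwards [eventually_energyP_le (β := β) hα hq hq2 hwlim ε hε] with n hn
      rw [Function.comp_apply, hz3, ← hg'G.2]; exact hn)
  have hd := tendsto_iff_dist_tendsto_zero.mp hlim2
  obtain ⟨n, hn⟩ := (hd.eventually_lt_const hε).exists
  exact absurd ((Metric.infDist_le_dist_of_mem hz'G).trans_lt hn) (not_lt.mpr (hz4 _))

end Variational

/-! ### A family of radial test functions -/

lemma IsTest.scale {φ : E3 → ℝ} (hφ : IsTest φ) (κ : ℝ) {R : ℝ} (hR : 0 < R) :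
    IsTest fun x => κ * φ (R⁻¹ • x) := by
  refine ⟨contDiff_const.mul (hφ.1.comp (contDiff_const_smul _)), ?_⟩
  exact (hφ.2.comp_homeomorph (Homeomorph.smulOfNeZero R⁻¹ (inv_ne_zero hR.ne'))).mul_left

lemma partialDeriv_scale {φ : E3 → ℝ} (hφ : IsTest φ) (κ R : ℝ) (i : Fin 3) :
    (partialDeriv i fun x => κ * φ (R⁻¹ • x)) = fun x => κ * R⁻¹ * partialDeriv i φ (R⁻¹ • x) := by
  ext x
  have hd : DifferentiableAt ℝ φ (R⁻¹ • x) := (hφ.1.differentiable (by simp)).differentiableAt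
  have h := (hd.hasFDerivAt.comp x ((hasFDerivAt_id x).const_smul R⁻¹)).const_mul κ
  have h' : HasFDerivAt (fun x => κ * φ (R⁻¹ • x)) _ x := h
  rw [partialDeriv, h'.fderiv]
  simp [partialDeriv]
  ring

lemma IsTest.partialDeriv {φ : E3 → ℝ} (hφ : IsTest φ) (i : Fin 3) :
    IsTest (HartreeFock.partialDeriv i φ) :=
  ⟨(hφ.1.fderiv_right (m := ∞) (by simp)).clm_apply contDiff_const,
    hφ.hasCompactSupport_partialDeriv i⟩

lemma integral_scale (f : E3 → ℝ) {R : ℝ} (hR : 0 < R) :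
    ∫ x, f (R⁻¹ • x) = R ^ 3 * ∫ x, f x := by
  rw [Measure.integral_comp_inv_smul_of_nonneg _ _ hR.le, finrank_euclideanSpace, Fintype.card_fin,
    smul_eq_mul]

/-- A smooth radial cutoff. -/
def cutoff (x : E3) : ℝ := Real.smoothTransition (2 - ‖x‖ ^ 2)

lemma isTest_cutoff : IsTest cutoff := by
  refine ⟨Real.smoothTransition.contDiff.comp (contDiff_const.sub (contDiff_norm_sq ℝ)),
    HasCompactSupport.of_support_subset_isCompact (isCompact_closedBall (0 : E3) 2) fun x hx => ?_⟩
  by_contra h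
  rw [mem_closedBall_zero_iff, not_le] at h
  exact hx (Real.smoothTransition.zero_of_nonpos (by nlinarith))

lemma cutoff_nonneg (x : E3) : 0 ≤ cutoff x := Real.smoothTransition.nonneg _

lemma cutoff_eq_one {x : E3} (hx : ‖x‖ ≤ 1) : cutoff x = 1 :=
  Real.smoothTransition.one_of_one_le (by nlinarith [norm_nonneg x])

/-- The `p`-th moment of the cutoff. -/
def cutoffPow (p : ℝ) : ℝ := ∫ x, |cutoff x| ^ p

/-- The Dirichlet integral of the cutoff. -/
def cutoffKin : ℝ := kinetic (ofTest isTest_cutoff)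

/-- The sum of the norms of the pure second derivatives of the cutoff. -/
def cutoffHess : ℝ := ∑ i, √(∫ x, partialDeriv i (partialDeriv i cutoff) x ^ 2)

lemma cutoffKin_nonneg : 0 ≤ cutoffKin := kinetic_nonneg _

lemma cutoffPow_pos {p : ℝ} (hp : 0 < p) : 0 < cutoffPow p := by
  have hc : Continuous fun x => |cutoff x| ^ p :=
    isTest_cutoff.1.continuous.abs.rpow_const fun x => Or.inr hp.le
  have hs : HasCompactSupport fun x => |cutoff x| ^ p :=
    isTest_cutoff.2.comp_left (g := fun t => |t| ^ p) (by simp [Real.zero_rpow hp.ne'])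
  refine hc.integral_pos_of_hasCompactSupport_nonneg_nonzero hs (x := 0) (fun x => by positivity) ?_
  rw [cutoff_eq_one (by simp)]
  simp

lemma integral_cutoff_sq : ∫ x, cutoff x ^ 2 = cutoffPow 2 := by
  refine integral_congr_ae (ae_of_all _ fun x => ?_)
  simp only
  rw [Real.rpow_two, sq_abs]

/-- The test function `κ η(x / R)`, `η` the cutoff, as an element of `H¹`. -/
def bump (κ : ℝ) {R : ℝ} (hR : 0 < R) : H1 := ofTest (isTest_cutoff.scale κ hR)

section Bump

variable (κ : ℝ) {R : ℝ} (hR : 0 < R)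

lemma fn_bump : ∀ᵐ x, fn (bump κ hR) x = (κ * cutoff (R⁻¹ • x) : ℝ) := fn_ofTest _

lemma bump_mem : bump κ hR ∈ H1r := by
  refine ⟨fun r => (κ * Real.smoothTransition (2 - (R⁻¹ * r) ^ 2) : ℝ), ?_⟩
  filter_upwards [fn_bump κ hR] with x hx
  rw [hx, cutoff, norm_smul, Real.norm_eq_abs, abs_of_pos (inv_pos.mpr hR)]

lemma mass_bump : mass (bump κ hR) = κ ^ 2 * R ^ 3 * cutoffPow 2 := by
  rw [bump, mass_ofTest, mul_assoc, ← integral_cutoff_sq, ← integral_scale _ hR, ← integral_const_mul]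
  simp only [mul_pow]

lemma kinetic_bump : kinetic (bump κ hR) = κ ^ 2 * R * cutoffKin := by
  rw [bump, kinetic_ofTest, cutoffKin, kinetic_ofTest, Finset.mul_sum]
  refine Finset.sum_congr rfl fun i _ => ?_
  rw [partialDeriv_scale isTest_cutoff]
  have h := integral_scale (fun x => partialDeriv i cutoff x ^ 2) hR
  simp only [mul_pow]
  rw [integral_const_mul, h]
  field_simp

lemma power_bump {κ : ℝ} (hκ : 0 ≤ κ) (p : ℝ) :
    ∫ x, ‖fn (bump κ hR) x‖ ^ p = κ ^ p * R ^ 3 * cutoffPow p := by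
  rw [bump, power_ofTest, mul_assoc, cutoffPow, ← integral_scale _ hR, ← integral_const_mul]
  refine integral_congr_ae (ae_of_all _ fun x => ?_)
  simp only
  rw [abs_mul, abs_of_nonneg hκ, Real.mul_rpow hκ (abs_nonneg _)]

/-- The free length in `pot_dens_le` is taken to be the width R of the bump, which gives both terms
the same size κ²R². -/
lemma pot_bump_le (x : E3) :
    pot (dens (bump κ hR)) x ≤ κ ^ 2 * R ^ 2 * (18 * cutoffKin + cutoffPow 2) := by
  refine (pot_dens_le (bump_mem κ hR) hR x).trans (le_of_eq ?_)
  rw [mass_bump, kinetic_bump]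
  field_simp

end Bump

/-! ### Joining profiles -/

section Variational

variable {α β q : ℝ}

lemma coulombD_add_self_le {ρ τ : E3 → ℝ} (hρ : IsDensity ρ) (hτ : IsDensity τ) {P : ℝ}
    (hP : ∀ x, pot τ x ≤ P) :
    coulombD (ρ + τ) (ρ + τ) ≤ coulombD ρ ρ + (2 * (∫ x, ρ x) + ∫ x, τ x) * P := by
  rw [hρ.coulombD_add_self hτ]
  have h1 := hρ.coulombD_le hτ hP
  have h2 := hτ.coulombD_le hτ hP
  linarith

/-- Superadditivity of t ↦ t^q applied to the squares: joining densities can only raise the power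
integral. -/
lemma add_rpow_le_rpow_add_half {s t : ℝ} (hq : 1 < q) :
    |s| ^ (2 * q) + |t| ^ (2 * q) ≤ √(s ^ 2 + t ^ 2) ^ (2 * q) := by
  have h := Real.add_rpow_le_rpow_add (sq_nonneg |s|) (sq_nonneg |t|) hq.le
  rw [← Real.rpow_natCast, ← Real.rpow_natCast, ← Real.rpow_mul (abs_nonneg _),
    ← Real.rpow_mul (abs_nonneg _)] at h
  rw [Real.rpow_mul (Real.sqrt_nonneg _), Real.rpow_two, Real.sq_sqrt (by positivity)]
  simpa using h

/-- Adding the density of `w` to the first component. -/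
lemma exists_energy_join_le (hα : 0 < α) (hq : 1 < q) (hq2 : q < 3 / 2) {u v w : H1}
    (hu : u ∈ H1r) (hv : v ∈ H1r) (hw : w ∈ H1r) {P : ℝ} (hP : ∀ x, pot (dens w) x ≤ P) :
    ∃ U ∈ H1r, (∀ᵐ x, ‖fn U x‖ ^ 2 = ‖fn u x‖ ^ 2 + ‖fn w x‖ ^ 2) ∧ mass U = mass u + mass w ∧
      energy α β q U v ≤ energy α β q u v + 1 / 2 * kinetic w +
        α / 4 * ((2 * (mass u + mass v) + mass w) * P) - 1 / (2 * q) * (∫ x, ‖fn w x‖ ^ (2 * q)) -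
        β / q * ((∫ x, ‖fn U x‖ ^ q * ‖fn v x‖ ^ q) - ∫ x, ‖fn u x‖ ^ q * ‖fn v x‖ ^ q) := by
  obtain ⟨U, hU, hUf, hUk⟩ := exists_join hu hw
  have hdens : ∀ᵐ x, dens U x = dens u x + dens w x := by
    filter_upwards [hUf] with x hx
    rw [dens, dens, dens, hx, Complex.norm_real, Real.norm_eq_abs, sq_abs, Real.sq_sqrt (by positivity)]
  refine ⟨U, hU, hdens, ?_, ?_⟩
  · rw [← integral_dens, integral_congr_ae hdens,
      integral_add (isDensity_dens hu).integrable (isDensity_dens hw).integrable]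
    rfl
  have hD : coulombD (rho U v) (rho U v) ≤ coulombD (rho u v) (rho u v) +
      (2 * (mass u + mass v) + mass w) * P := by
    have hle : ∀ᵐ x, rho U v x ≤ (rho u v + dens w) x := by
      filter_upwards [hdens] with x hx
      simp only [rho, Pi.add_apply]
      linarith
    have d1 := isDensity_rho hU hv
    have d2 := (isDensity_rho hu hv).add (isDensity_dens hw)
    refine (d1.coulombD_mono d1 d2 d2 hle hle).trans ?_
    rw [← integral_rho, ← integral_dens w]
    exact coulombD_add_self_le (isDensity_rho hu hv) (isDensity_dens hw) hP
  have hpow : (∫ x, ‖fn u x‖ ^ (2 * q)) + ∫ x, ‖fn w x‖ ^ (2 * q) ≤ ∫ x, ‖fn U x‖ ^ (2 * q) := by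
    rw [← integral_add (integrable_power hu hq hq2) (integrable_power hw hq hq2)]
    refine integral_mono_ae ((integrable_power hu hq hq2).add (integrable_power hw hq hq2))
      (integrable_power hU hq hq2) ?_
    filter_upwards [hUf] with x hx
    have := add_rpow_le_rpow_add_half (s := ‖fn u x‖) (t := ‖fn w x‖) hq
    rwa [abs_norm, abs_norm, ← abs_of_nonneg (Real.sqrt_nonneg (_ + _)), ← Real.norm_eq_abs,
      ← Complex.norm_real, ← hx] at this
  have e1 : α / 4 * coulombD (rho U v) (rho U v) ≤ α / 4 * (coulombD (rho u v) (rho u v) +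
      (2 * (mass u + mass v) + mass w) * P) := by gcongr
  have e2 : 1 / (2 * q) * ((∫ x, ‖fn u x‖ ^ (2 * q)) + ∫ x, ‖fn w x‖ ^ (2 * q)) ≤
    1 / (2 * q) * ∫ x, ‖fn U x‖ ^ (2 * q) := by gcongr
  rw [energy_eq_coulombD, energy_eq_coulombD]
  linarith

lemma integral_coupling_mono (hq : 1 < q) (hq2 : q < 3 / 2) {u v U : H1} (hu : u ∈ H1r)
    (hv : v ∈ H1r) (hU : U ∈ H1r) (h : ∀ᵐ x, ‖fn u x‖ ^ 2 ≤ ‖fn U x‖ ^ 2) :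
    ∫ x, ‖fn u x‖ ^ q * ‖fn v x‖ ^ q ≤ ∫ x, ‖fn U x‖ ^ q * ‖fn v x‖ ^ q := by
  refine integral_mono_ae (integrable_coupling hu hv hq hq2) (integrable_coupling hU hv hq hq2) ?_
  filter_upwards [h] with x hx
  have : ‖fn u x‖ ≤ ‖fn U x‖ := le_of_sq_le_sq hx (norm_nonneg _)
  gcongr

/-- For `q < 4/3` minimizers saturate the mass constraints. -/
theorem IsMin.mass_eq_of_lt_four_thirds (hα : 0 < α) (hβ : 0 < β) (hq : 1 < q) (hq3 : q < 4 / 3)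
    {a₁ a₂ : ℝ} {u v : H1} (h : IsMin α β q a₁ a₂ u v) : mass u = a₁ := by
  have hq2 : q < 3 / 2 := by linarith
  by_contra hne
  have hlt : mass u < a₁ := lt_of_le_of_ne h.mass_fst hne
  have hp2 : 0 < cutoffPow 2 := cutoffPow_pos two_pos
  have hp : 0 < cutoffPow (2 * q) := cutoffPow_pos (by linarith)
  -- With κ²R³ = e the bump carries exactly the missing mass, whatever its width R.
  set e := (a₁ - mass u) / cutoffPow 2 with he
  have he0 : 0 < e := div_pos (by linarith) hp2
  set A := 1 / 2 * (e * cutoffKin) + α / 4 * ((2 * (mass u + mass v) + (a₁ - mass u)) *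
    (e * (18 * cutoffKin + cutoffPow 2))) with hA
  set B := 1 / (2 * q) * (e ^ q * cutoffPow (2 * q)) with hB
  have hB0 : 0 < B := by positivity
  -- Minimality requires the gain, of order R^{3-3q}, not to exceed the kinetic cost O(R⁻²) plus the
  -- Coulomb cost O(R⁻¹). After multiplication by R the cost is bounded for R ≥ 1, while the gain
  -- grows since 4 - 3q > 0.
  have key : ∀ R : ℝ, 1 ≤ R → B * R ^ (4 - 3 * q) ≤ A := by
    intro R hR1
    have hR : 0 < R := by linarith
    set κ := √(e / R ^ 3) with hκ
    have hκ2 : κ ^ 2 = e / R ^ 3 := Real.sq_sqrt (by positivity)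
    have hκ0 : 0 ≤ κ := Real.sqrt_nonneg _
    have hm : mass (bump κ hR) = a₁ - mass u := by
      rw [mass_bump, hκ2, he]; field_simp
    obtain ⟨U, hU, hUd, hUm, hUe⟩ := exists_energy_join_le hα hq hq2 h.fst_mem h.snd_mem
      (bump_mem κ hR) (pot_bump_le κ hR)
    have hcoup : 0 ≤ β / q * ((∫ x, ‖fn U x‖ ^ q * ‖fn v x‖ ^ q) -
        ∫ x, ‖fn u x‖ ^ q * ‖fn v x‖ ^ q) := by
      refine mul_nonneg (by positivity) (sub_nonneg.mpr
        (integral_coupling_mono hq hq2 h.fst_mem h.snd_mem hU ?_))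
      filter_upwards [hUd] with x hx
      rw [hx]
      exact le_add_of_nonneg_right (sq_nonneg _)
    have hmin := h.le U v hU h.snd_mem (by rw [hUm, hm]; linarith) h.mass_snd
    rw [hm, kinetic_bump, power_bump hR hκ0, Real.rpow_mul hκ0, Real.rpow_two, hκ2] at hUe
    have hk := cutoffKin_nonneg
    have e1 : e / R ^ 3 * R * cutoffKin ≤ e * cutoffKin / R := by
      have : e / R ^ 3 * R * cutoffKin = e * cutoffKin / R / R := by field_simp
      rw [this]
      exact div_le_self (by positivity) hR1
    have e2 : e / R ^ 3 * R ^ 2 * (18 * cutoffKin + cutoffPow 2) =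
      e * (18 * cutoffKin + cutoffPow 2) / R := by field_simp
    have e3 : (e / R ^ 3) ^ q * R ^ 3 * cutoffPow (2 * q) =
        e ^ q * cutoffPow (2 * q) * R ^ (4 - 3 * q) / R := by
      have : (4 : ℝ) - 3 * q = 3 + 1 - 3 * q := by ring
      rw [Real.div_rpow he0.le (by positivity), ← Real.rpow_natCast, ← Real.rpow_mul hR.le, this,
        Real.rpow_sub hR, Real.rpow_add hR, Real.rpow_one]
      push_cast
      field_simp
    rw [e2, e3] at hUe
    have e4 : B * R ^ (4 - 3 * q) / R ≤ A / R := by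
      rw [hA, hB]
      have t1 : 1 / (2 * q) * (e ^ q * cutoffPow (2 * q)) * R ^ (4 - 3 * q) / R =
        1 / (2 * q) * (e ^ q * cutoffPow (2 * q) * R ^ (4 - 3 * q) / R) := by ring
      have t2 : (1 / 2 * (e * cutoffKin) + α / 4 * ((2 * (mass u + mass v) + (a₁ - mass u)) *
        (e * (18 * cutoffKin + cutoffPow 2)))) / R = 1 / 2 * (e * cutoffKin / R) + α / 4 *
        ((2 * (mass u + mass v) + (a₁ - mass u)) * (e * (18 * cutoffKin + cutoffPow 2) / R)) := by
        ring
      rw [t1, t2]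
      linarith
    exact (div_le_div_iff_of_pos_right hR).mp e4
  have hlim : Tendsto (fun R : ℝ => B * R ^ (4 - 3 * q)) atTop atTop :=
    (tendsto_rpow_atTop (by linarith)).const_mul_atTop hB0
  obtain ⟨R, hR1, hR2⟩ := ((eventually_ge_atTop 1).and (hlim.eventually_gt_atTop A)).exists
  exact absurd (key R hR1) (not_le.mpr hR2)

end Variational

/-! ### Variations of minimizers that leave a mass constraint slack -/

/-- The tangent at x lies below the convex power; this is Bernoulli's inequality after scaling by x.
-/
lemma add_mul_rpow_le {x y p : ℝ} (hx : 0 ≤ x) (hy : 0 ≤ y) (hp : 1 < p) :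
    x ^ p + p * x ^ (p - 1) * y ≤ (x + y) ^ p := by
  rcases hx.eq_or_lt with rfl | hx0
  · rw [Real.zero_rpow (by linarith), Real.zero_rpow (by linarith)]
    simp only [mul_zero, zero_mul, zero_add, add_zero]
    positivity
  · have h := one_add_mul_self_le_rpow_one_add (s := y / x) (by
      have : 0 ≤ y / x := by positivity
      linarith) hp.le
    have e : (x + y) ^ p = x ^ p * (1 + y / x) ^ p := by
      rw [← Real.mul_rpow hx (by positivity)]
      congr 1
      field_simp
    have e2 : x ^ p + p * x ^ (p - 1) * y = x ^ p * (1 + p * (y / x)) := by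
      rw [Real.rpow_sub_one hx0.ne']
      field_simp
    rw [e, e2]
    gcongr

/-- By concavity an increment is at least the slope at the right endpoint times its length. That
endpoint is positive even when x = 0, where the slope at x would be infinite. -/
lemma mul_rpow_le_add_rpow_sub {x h p : ℝ} (hx : 0 ≤ x) (hh : 0 < h) (hp0 : 0 < p) (hp : p < 1) :
    p * h * (x + h) ^ (p - 1) ≤ (x + h) ^ p - x ^ p := by
  have hs : 0 < x + h := by linarith
  have h1 := rpow_one_add_le_one_add_mul_self (s := -(h / (x + h))) (by
    rw [neg_le_neg_iff, div_le_one hs]; linarith) hp0.le hp.le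
  have e : x ^ p = (x + h) ^ p * (1 + -(h / (x + h))) ^ p := by
    rw [← Real.mul_rpow hs.le]
    · congr 1
      field_simp
      ring
    · have : h / (x + h) ≤ 1 := by rw [div_le_one hs]; linarith
      linarith
  have h2 : (x + h) ^ p * (1 + -(h / (x + h))) ^ p ≤ (x + h) ^ p * (1 + p * -(h / (x + h))) := by
    gcongr
  rw [e, Real.rpow_sub_one hs.ne']
  have e3 : (x + h) ^ p * (1 + p * -(h / (x + h))) = (x + h) ^ p - p * h * ((x + h) ^ p / (x + h)) := by
    ring
  linarith

lemma rpow_le_one_add_rpow {x p r : ℝ} (hx : 0 ≤ x) (hp : 0 ≤ p) (hpr : p ≤ r) :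
    x ^ p ≤ 1 + x ^ r := by
  rcases le_total x 1 with h | h
  · have := Real.rpow_le_one hx h hp
    have : 0 ≤ x ^ r := by positivity
    linarith
  · have := Real.rpow_le_rpow_of_exponent_le h hpr
    linarith

section Variational

variable {α β q : ℝ}

/-- The nonlinear term of the first variation of the energy in the first component. -/
def forcing (β q : ℝ) (u v : H1) (x : E3) : ℝ :=
  ‖fn u x‖ ^ (2 * q - 1) + β * (‖fn v x‖ ^ q * ‖fn u x‖ ^ (q - 1))

lemma forcing_nonneg (hβ : 0 < β) (u v : H1) (x : E3) : 0 ≤ forcing β q u v x := by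
  unfold forcing; positivity

lemma measurable_forcing (u v : H1) : Measurable (forcing β q u v) :=
  ((measurable_fn u).norm.pow_const _).add
    ((((measurable_fn v).norm.pow_const _).mul ((measurable_fn u).norm.pow_const _)).const_mul β)

lemma forcing_le (hβ : 0 < β) (hq : 1 < q) (u v : H1) (x : E3) : forcing β q u v x ≤
    (1 + β) * (1 + ‖fn u x‖ ^ (2 * q) + ‖fn v x‖ ^ (2 * q)) := by
  have h1 := rpow_le_one_add_rpow (norm_nonneg (fn u x)) (p := 2 * q - 1) (r := 2 * q)
    (by linarith) (by linarith)
  have h2 := rpow_le_one_add_rpow (norm_nonneg (fn u x)) (p := 2 * (q - 1)) (r := 2 * q)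
    (by linarith) (by linarith)
  have h3 : ‖fn v x‖ ^ q * ‖fn u x‖ ^ (q - 1) ≤
      1 + ‖fn u x‖ ^ (2 * q) + ‖fn v x‖ ^ (2 * q) := by
    have e : ∀ y : ℝ, 0 ≤ y → ∀ p : ℝ, y ^ (2 * p) = (y ^ p) ^ 2 := fun y hy p => by
      rw [mul_comm, Real.rpow_mul hy, Real.rpow_two]
    rw [e _ (norm_nonneg _)] at h2
    have h4 := e _ (norm_nonneg (fn v x)) q
    nlinarith [sq_nonneg (‖fn v x‖ ^ q - ‖fn u x‖ ^ (q - 1)), sq_nonneg (‖fn v x‖ ^ q),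
      sq_nonneg (‖fn u x‖ ^ (q - 1))]
  have h5 : 0 ≤ ‖fn v x‖ ^ (2 * q) := by positivity
  unfold forcing
  have h6 : β * (‖fn v x‖ ^ q * ‖fn u x‖ ^ (q - 1)) ≤
      β * (1 + ‖fn u x‖ ^ (2 * q) + ‖fn v x‖ ^ (2 * q)) := by gcongr
  linarith

lemma integrable_mul_forcing (hβ : 0 < β) (hq : 1 < q) (hq2 : q < 3 / 2) {u v : H1}
    (hu : u ∈ H1r) (hv : v ∈ H1r) {k : E3 → ℝ} (hk : Measurable k) (hk0 : ∀ x, 0 ≤ k x)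
    (hk1 : ∀ x, k x ≤ 1) (hki : Integrable k) :
    Integrable fun x => k x * forcing β q u v x := by
  refine Integrable.mono' ((hki.add ((integrable_power hu hq hq2).add
    (integrable_power hv hq hq2))).const_mul (1 + β))
    (hk.mul (measurable_forcing u v)).aestronglyMeasurable (ae_of_all _ fun x => ?_)
  have h1 := forcing_le hβ hq u v x
  have h0 := forcing_nonneg (q := q) hβ u v x
  rw [Real.norm_eq_abs, abs_of_nonneg (mul_nonneg (hk0 x) h0)]
  have h2 : 0 ≤ ‖fn u x‖ ^ (2 * q) + ‖fn v x‖ ^ (2 * q) := by positivity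
  simp only [Pi.add_apply]
  calc k x * forcing β q u v x ≤ k x * ((1 + β) * (1 + ‖fn u x‖ ^ (2 * q) + ‖fn v x‖ ^ (2 * q))) :=
        mul_le_mul_of_nonneg_left h1 (hk0 x)
    _ = (1 + β) * (k x + k x * (‖fn u x‖ ^ (2 * q) + ‖fn v x‖ ^ (2 * q))) := by ring
    _ ≤ _ := by
      have := mul_le_mul_of_nonneg_right (hk1 x) h2
      rw [one_mul] at this
      gcongr

/-- The part of the second component where it dominates the first is controlled. -/
lemma IsMin.setIntegral_power_le (hα : 0 < α) (hβ : 0 < β) (hq : 1 < q) (hq2 : q < 3 / 2)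
    {a₁ a₂ : ℝ} {u v : H1} (h : IsMin α β q a₁ a₂ u v) (hlt : mass u < a₁) {P : ℝ}
    (hP : ∀ x, pot (rho u v) x ≤ P) {θ : ℝ} (hθ : 0 < θ) (hθ1 : θ ≤ 1) :
    ∫ x in {x | ‖fn u x‖ < θ * ‖fn v x‖}, ‖fn v x‖ ^ (2 * q) ≤
      4 / β * θ ^ (2 - q) * (1 / 2 * kinetic v + 3 * α / 4 * ((mass u + mass v) * P)) := by
  have hu := h.fst_mem
  have hv := h.snd_mem
  have hmu := mass_nonneg u
  have hmv := mass_nonneg v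
  have hP0 : 0 ≤ P := (pot_nonneg (isDensity_rho hu hv).nonneg 0).trans (hP 0)
  -- The competitor adds s|v|² to |u|². The slack in the first mass allows a small s > 0, and s ≤ θ²
  -- keeps the new density below 2θ²|v|² on the set in question; s cancels at the end.
  obtain ⟨s, hs0, hsθ, hsm⟩ : ∃ s : ℝ, 0 < s ∧ s ≤ θ ^ 2 ∧ mass u + s * mass v ≤ a₁ := by
    have h1 : Tendsto (fun s : ℝ => mass u + s * mass v) (𝓝[>] 0) (𝓝 (mass u + 0 * mass v)) :=
      (Continuous.tendsto (by fun_prop) 0).mono_left nhdsWithin_le_nhds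
    rw [zero_mul, add_zero] at h1
    obtain ⟨s, e1, e2, e3⟩ := (((h1.eventually_lt_const hlt)).and
      ((Ioo_mem_nhdsGT (by positivity : 0 < θ ^ 2)))).exists
    exact ⟨s, e2, e3.le, e1.le⟩
  have hs1 : s ≤ 1 := hsθ.trans (by nlinarith)
  set w : H1 := ((√s : ℝ) : ℂ) • v with hw
  have hwr : w ∈ H1r := H1r.smul_mem _ hv
  have hwn : ∀ᵐ x, ‖fn w x‖ ^ 2 = s * ‖fn v x‖ ^ 2 := by
    filter_upwards [Lp.coeFn_smul ((√s : ℝ) : ℂ) (valL v)] with x hx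
    have : fn w x = ((√s : ℝ) : ℂ) • fn v x := hx
    rw [this, norm_smul, Complex.norm_real, Real.norm_eq_abs, mul_pow, sq_abs, Real.sq_sqrt hs0.le]
  have hwk : kinetic w = s * kinetic v := by
    rw [kinetic_eq, kinetic_eq, Finset.mul_sum]
    refine Finset.sum_congr rfl fun i _ => ?_
    rw [hw, map_smul, norm_smul, Complex.norm_real, Real.norm_eq_abs, mul_pow, sq_abs,
      Real.sq_sqrt hs0.le]
  have hwm : mass w = s * mass v := by
    rw [mass_eq, mass_eq, hw, map_smul, norm_smul, Complex.norm_real, Real.norm_eq_abs, mul_pow,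
      sq_abs, Real.sq_sqrt hs0.le]
  have hwP : ∀ x, pot (dens w) x ≤ s * P := by
    intro x
    have d := isDensity_rho hu hv
    refine (((d.smul hs0.le)).pot_mono (isDensity_dens hwr) ?_ x).trans ?_
    · filter_upwards [hwn] with y hy
      simp only [dens, rho, Pi.add_apply, Pi.smul_apply, smul_eq_mul, hy]
      nlinarith [mul_nonneg hs0.le (sq_nonneg ‖fn u y‖)]
    · rw [IsDensity.pot_smul]
      exact mul_le_mul_of_nonneg_left (hP x) hs0.le
  obtain ⟨U, hU, hUd, hUm, hUe⟩ := exists_energy_join_le (β := β) hα hq hq2 hu hv hwr hwP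
  have hmin := h.le U v hU hv (by rw [hUm, hwm]; exact hsm) h.mass_snd
  have hA : MeasurableSet {x | ‖fn u x‖ < θ * ‖fn v x‖} :=
    measurableSet_lt (measurable_fn u).norm ((measurable_fn v).norm.const_mul θ)
  -- On that set the slope of t ↦ t^{q/2} is at least (q/2)(2θ²|v|²)^{q/2-1}; since 2^{q/2-1} ≥ 1/2,
  -- the constant is q/4. Elsewhere the coupling merely does not decrease.
  have hgain : s * (q / 4 * θ ^ (q - 2)) * (∫ x in {x | ‖fn u x‖ < θ * ‖fn v x‖}, ‖fn v x‖ ^ (2 * q)) ≤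
      (∫ x, ‖fn U x‖ ^ q * ‖fn v x‖ ^ q) - ∫ x, ‖fn u x‖ ^ q * ‖fn v x‖ ^ q := by
    rw [← integral_sub (integrable_coupling hU hv hq hq2) (integrable_coupling hu hv hq hq2),
      ← integral_indicator hA, ← integral_const_mul]
    refine integral_mono_ae (((integrable_power hv hq hq2).indicator hA).const_mul _)
      ((integrable_coupling hU hv hq hq2).sub (integrable_coupling hu hv hq hq2)) ?_
    filter_upwards [hUd, hwn] with x hx1 hx2
    rw [hx2] at hx1
    have hUq : ‖fn U x‖ ^ q = (‖fn u x‖ ^ 2 + s * ‖fn v x‖ ^ 2) ^ (q / 2) := by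
      rw [← hx1, ← Real.rpow_natCast, ← Real.rpow_mul (norm_nonneg _)]
      congr 1
      push_cast; ring
    have huq : ‖fn u x‖ ^ q = (‖fn u x‖ ^ 2) ^ (q / 2) := by
      rw [← Real.rpow_natCast, ← Real.rpow_mul (norm_nonneg _)]
      congr 1
      push_cast; ring
    rw [← sub_mul]
    by_cases hx : x ∈ {x | ‖fn u x‖ < θ * ‖fn v x‖}
    · rw [indicator_of_mem hx]
      replace hx : ‖fn u x‖ < θ * ‖fn v x‖ := hx
      have hv0 : 0 < ‖fn v x‖ := by
        by_contra hcon
        have : ‖fn v x‖ = 0 := le_antisymm (not_lt.mp hcon) (norm_nonneg _)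
        rw [this, mul_zero] at hx
        exact absurd hx (not_lt.mpr (norm_nonneg _))
      have hh : 0 < s * ‖fn v x‖ ^ 2 := by positivity
      have h1 := mul_rpow_le_add_rpow_sub (sq_nonneg ‖fn u x‖) hh (p := q / 2) (by linarith)
        (by linarith)
      rw [← hUq, ← huq] at h1
      have h2 : ‖fn u x‖ ^ 2 + s * ‖fn v x‖ ^ 2 ≤ 2 * (θ * ‖fn v x‖) ^ 2 := by
        have : ‖fn u x‖ ^ 2 ≤ (θ * ‖fn v x‖) ^ 2 := by gcongr
        have : s * ‖fn v x‖ ^ 2 ≤ θ ^ 2 * ‖fn v x‖ ^ 2 := by gcongr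
        nlinarith
      have h3 : (2 * (θ * ‖fn v x‖) ^ 2) ^ (q / 2 - 1) ≤
          (‖fn u x‖ ^ 2 + s * ‖fn v x‖ ^ 2) ^ (q / 2 - 1) :=
        Real.rpow_le_rpow_of_nonpos (by positivity) h2 (by linarith)
      have h4 : (2 * (θ * ‖fn v x‖) ^ 2) ^ (q / 2 - 1) =
          2 ^ (q / 2 - 1) * (θ ^ (q - 2) * ‖fn v x‖ ^ (q - 2)) := by
        rw [Real.mul_rpow (by norm_num) (by positivity), ← Real.rpow_natCast,
          ← Real.rpow_mul (by positivity), Real.mul_rpow hθ.le hv0.le]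
        congr 3 <;> (push_cast; ring)
      have h5 : (1 : ℝ) / 2 ≤ 2 ^ (q / 2 - 1) := by
        have := Real.rpow_le_rpow_of_exponent_le (x := 2) (by norm_num)
          (by linarith : (-1 : ℝ) ≤ q / 2 - 1)
        rw [Real.rpow_neg_one] at this
        linarith
      have h6 : ‖fn v x‖ ^ (2 * q) = ‖fn v x‖ ^ 2 * ‖fn v x‖ ^ (q - 2) * ‖fn v x‖ ^ q := by
        rw [← Real.rpow_natCast, ← Real.rpow_add hv0, ← Real.rpow_add hv0]
        congr 1
        push_cast; ring
      rw [h6]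
      calc s * (q / 4 * θ ^ (q - 2)) * (‖fn v x‖ ^ 2 * ‖fn v x‖ ^ (q - 2) * ‖fn v x‖ ^ q)
          = (q / 2 * (s * ‖fn v x‖ ^ 2) * (1 / 2 * (θ ^ (q - 2) * ‖fn v x‖ ^ (q - 2)))) *
            ‖fn v x‖ ^ q := by ring
        _ ≤ (q / 2 * (s * ‖fn v x‖ ^ 2) * (‖fn u x‖ ^ 2 + s * ‖fn v x‖ ^ 2) ^ (q / 2 - 1)) *
            ‖fn v x‖ ^ q := by
          gcongr
          refine le_trans ?_ h3
          rw [h4]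
          gcongr
        _ ≤ _ := by gcongr
    · rw [indicator_of_notMem hx, mul_zero, hUq, huq]
      refine mul_nonneg (sub_nonneg.mpr ?_) (by positivity)
      gcongr
      exact le_add_of_nonneg_right (by positivity)
  rw [hwk, hwm] at hUe
  set X := ∫ x in {x | ‖fn u x‖ < θ * ‖fn v x‖}, ‖fn v x‖ ^ (2 * q) with hX
  have hpw : 0 ≤ 1 / (2 * q) * ∫ x, ‖fn w x‖ ^ (2 * q) :=
    mul_nonneg (by positivity) (integral_nonneg fun x => by positivity)
  have hg2 : β / q * (s * (q / 4 * θ ^ (q - 2)) * X) ≤ β / q *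
      ((∫ x, ‖fn U x‖ ^ q * ‖fn v x‖ ^ q) - ∫ x, ‖fn u x‖ ^ q * ‖fn v x‖ ^ q) := by gcongr
  have e1 : β / q * (s * (q / 4 * θ ^ (q - 2)) * X) = s * (β / 4 * θ ^ (q - 2) * X) := by
    field_simp
  have e2 : α / 4 * ((2 * (mass u + mass v) + s * mass v) * (s * P)) ≤
      s * (3 * α / 4 * ((mass u + mass v) * P)) := by
    have t1 : s * mass v ≤ mass u + mass v := by nlinarith
    have t2 : 2 * (mass u + mass v) + s * mass v ≤ 3 * (mass u + mass v) := by linarith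
    calc α / 4 * ((2 * (mass u + mass v) + s * mass v) * (s * P))
        ≤ α / 4 * (3 * (mass u + mass v) * (s * P)) := by gcongr
      _ = _ := by ring
  have e3 : s * (β / 4 * θ ^ (q - 2) * X) ≤
      s * (1 / 2 * kinetic v + 3 * α / 4 * ((mass u + mass v) * P)) := by
    rw [← e1]; linarith
  have e4 := le_of_mul_le_mul_left e3 hs0
  have e5 : θ ^ (2 - q) * θ ^ (q - 2) = 1 := by
    rw [← Real.rpow_add hθ]; simp
  calc X = 4 / β * θ ^ (2 - q) * (β / 4 * θ ^ (q - 2) * X) := by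
        rw [show 4 / β * θ ^ (2 - q) * (β / 4 * θ ^ (q - 2) * X) =
          (4 / β * (β / 4)) * (θ ^ (2 - q) * θ ^ (q - 2)) * X by ring, e5]
        field_simp
    _ ≤ _ := by gcongr

/-- A minimizer may be replaced by one whose first component is non-negative. -/
lemma IsMin.exists_nonneg (hα : 0 < α) {a₁ a₂ : ℝ} {u v : H1} (h : IsMin α β q a₁ a₂ u v) :
    ∃ u', IsMin α β q a₁ a₂ u' v ∧ mass u' = mass u ∧ ∀ᵐ x, fn u' x = (‖fn u' x‖ : ℂ) := by
  -- Joining u with 0 gives |u| without increasing the kinetic energy; all other terms depend only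
  -- on |u|.
  obtain ⟨U, hU, hUf, hUk⟩ := exists_join h.fst_mem (H1r.zero_mem)
  have h0 : ∀ᵐ x, fn 0 x = 0 := Lp.coeFn_zero ℂ 2 (volume : Measure E3)
  have hf : ∀ᵐ x, fn U x = (‖fn u x‖ : ℂ) := by
    filter_upwards [hUf, h0] with x hx hx0
    rw [hx, hx0, norm_zero, zero_pow two_ne_zero, add_zero, Real.sqrt_sq (norm_nonneg _)]
  have hn : ∀ᵐ x, ‖fn U x‖ = ‖fn u x‖ := by
    filter_upwards [hf] with x hx
    rw [hx, Complex.norm_real, norm_norm]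
  have hm : mass U = mass u := integral_congr_ae (by filter_upwards [hn] with x hx; simp only [hx])
  have hk0 : kinetic 0 = 0 := by rw [kinetic_eq]; simp
  have he : energy α β q U v ≤ energy α β q u v := by
    have dU := isDensity_rho hU h.snd_mem
    have du := isDensity_rho h.fst_mem h.snd_mem
    have hr : ∀ᵐ x, rho U v x ≤ rho u v x := by
      filter_upwards [hn] with x hx
      simp only [rho, dens, Pi.add_apply, hx, le_refl]
    have hD := dU.coulombD_mono dU du du hr hr
    have hD' : α / 4 * coulombD (rho U v) (rho U v) ≤ α / 4 * coulombD (rho u v) (rho u v) := by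
      gcongr
    have e1 : ∫ x, ‖fn U x‖ ^ (2 * q) = ∫ x, ‖fn u x‖ ^ (2 * q) :=
      integral_congr_ae (by filter_upwards [hn] with x hx; simp only [hx])
    have e2 : ∫ x, ‖fn U x‖ ^ q * ‖fn v x‖ ^ q = ∫ x, ‖fn u x‖ ^ q * ‖fn v x‖ ^ q :=
      integral_congr_ae (by filter_upwards [hn] with x hx; simp only [hx])
    rw [energy_eq_coulombD, energy_eq_coulombD, e1, e2]
    linarith
  refine ⟨U, ⟨hU, h.snd_mem, hm.trans_le h.mass_fst, h.mass_snd, fun u' v' h1 h2 h3 h4 =>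
    he.trans (h.le u' v' h1 h2 h3 h4)⟩, hm, ?_⟩
  filter_upwards [hf, hn] with x hx hx'
  rw [hx', hx]

/-- A second integration by parts moves the derivative from u to φ, so the cross term is controlled
by the mass of u instead of its kinetic energy. -/
lemma norm_integral_partialDeriv_smul_grad_le (u : H1) {φ : E3 → ℝ} (hφ : IsTest φ) (i : Fin 3) :
    ‖∫ x, partialDeriv i φ x • grad u i x‖ ≤
      √(∫ x, partialDeriv i (partialDeriv i φ) x ^ 2) * √(mass u) := by
  have h1 := isWeakPartial_gradL u i _ (hφ.partialDeriv i)
  have h2 := norm_pairing_le _ ((hφ.partialDeriv i).memLp_partialDeriv i) (valL u)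
  rw [h1, norm_neg] at h2
  rw [mass_eq, Real.sqrt_sq (norm_nonneg _)]
  exact h2

lemma re_inner_gradL_ofTest (u : H1) {φ : E3 → ℝ} (hφ : IsTest φ) (i : Fin 3) :
    (inner ℂ (gradL i u) (gradL i (ofTest hφ))).re =
      (∫ x, partialDeriv i φ x • grad u i x).re := by
  have hs : (inner ℂ (gradL i u) (gradL i (ofTest hφ)) : ℂ).re =
      (inner ℂ (gradL i (ofTest hφ)) (gradL i u) : ℂ).re := inner_re_symm (𝕜 := ℂ) _ _
  rw [hs, MeasureTheory.L2.inner_def]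
  congr 1
  refine integral_congr_ae ?_
  filter_upwards [grad_ofTest hφ i] with x hx
  have e : gradL i (ofTest hφ) x = (partialDeriv i φ x : ℂ) := hx
  rw [e, RCLike.inner_apply, Complex.conj_ofReal, Complex.real_smul, mul_comm]
  rfl

/-- The second derivatives of a cutoff of width R have squared L² norm proportional to R⁻⁴R³ = R⁻¹.
The term of first order in s is therefore O(R^{-1/2}), small for wide cutoffs. -/
lemma kinetic_add_smul_bump_le (u : H1) {s R : ℝ} (hs : 0 ≤ s) (hR : 0 < R) :
    kinetic (u + (s : ℂ) • bump 1 hR) ≤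
      kinetic u + 2 * s * (√(mass u) * cutoffHess / √R) + s ^ 2 * kinetic (bump 1 hR) := by
  have hi : ∀ i : Fin 3, ‖gradL i (u + (s : ℂ) • bump 1 hR)‖ ^ 2 ≤ ‖gradL i u‖ ^ 2 +
      2 * s * (√(mass u) * √(∫ x, partialDeriv i (partialDeriv i cutoff) x ^ 2) / √R) +
      s ^ 2 * ‖gradL i (bump 1 hR)‖ ^ 2 := by
    intro i
    rw [map_add, map_smul, norm_add_sq (𝕜 := ℂ), inner_smul_right, norm_smul, Complex.norm_real,
      Real.norm_eq_abs, mul_pow, sq_abs]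
    have h1 : RCLike.re ((s : ℂ) * inner ℂ (gradL i u) (gradL i (bump 1 hR))) =
        s * (inner ℂ (gradL i u) (gradL i (bump 1 hR))).re := Complex.re_ofReal_mul _ _
    rw [h1, bump, re_inner_gradL_ofTest]
    have h2 := (Complex.re_le_norm _).trans (norm_integral_partialDeriv_smul_grad_le u
      (isTest_cutoff.scale 1 hR) i)
    have h3 : √(∫ x, partialDeriv i (partialDeriv i fun x => 1 * cutoff (R⁻¹ • x)) x ^ 2) =
        √(∫ x, partialDeriv i (partialDeriv i cutoff) x ^ 2) / √R := by
      rw [partialDeriv_scale isTest_cutoff, partialDeriv_scale (isTest_cutoff.partialDeriv i),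
        ← Real.sqrt_div' _ hR.le]
      have h := integral_scale (fun x => partialDeriv i (partialDeriv i cutoff) x ^ 2) hR
      congr 1
      simp only [mul_pow]
      rw [integral_const_mul, h]
      field_simp
    rw [h3] at h2
    have h4 := mul_le_mul_of_nonneg_left h2 hs
    have h5 : √(∫ x, partialDeriv i (partialDeriv i cutoff) x ^ 2) / √R * √(mass u) =
      √(mass u) * √(∫ x, partialDeriv i (partialDeriv i cutoff) x ^ 2) / √R := by ring
    rw [h5] at h4
    linarith
  rw [kinetic_eq, kinetic_eq, kinetic_eq]
  refine (Finset.sum_le_sum fun i _ => hi i).trans (le_of_eq ?_)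
  rw [Finset.sum_add_distrib, Finset.sum_add_distrib, ← Finset.mul_sum, ← Finset.mul_sum,
    ← Finset.sum_div, ← Finset.mul_sum]
  rfl

/-- The first variation in the direction of a cutoff. -/
lemma IsMin.setIntegral_forcing_le (hα : 0 < α) (hβ : 0 < β) (hq : 1 < q) (hq2 : q < 3 / 2)
    {a₁ a₂ : ℝ} {u v : H1} (h : IsMin α β q a₁ a₂ u v) (hlt : mass u < a₁)
    (hpos : ∀ᵐ x, fn u x = (‖fn u x‖ : ℂ)) {P : ℝ} (hP : ∀ x, pot (rho u v) x ≤ P) {R τ : ℝ}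
    (hR : 0 < R) (hτ : 0 < τ) :
    ∫ x in Metric.ball 0 R, forcing β q u v x ≤ √(mass u) * cutoffHess / √R +
      α / 2 * ((mass u + mass v) * (τ * P + R ^ 2 * (18 * cutoffKin + cutoffPow 2) / τ)) := by
  have hu := h.fst_mem
  have hv := h.snd_mem
  set w := bump 1 hR with hw
  have hwr : w ∈ H1r := bump_mem 1 hR
  set k : E3 → ℝ := fun x => 1 * cutoff (R⁻¹ • x) with hk
  have hkt : IsTest k := isTest_cutoff.scale 1 hR
  have hk0 : ∀ x, 0 ≤ k x := fun x => by rw [hk]; simpa using cutoff_nonneg _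
  have hk1 : ∀ x, k x ≤ 1 := fun x => by
    rw [hk]; simpa [cutoff] using Real.smoothTransition.le_one _
  have hwf : ∀ᵐ x, fn w x = (k x : ℂ) := fn_bump 1 hR
  have hki : Integrable k := hkt.1.continuous.integrable_of_hasCompactSupport hkt.2
  have hJi := integrable_mul_forcing hβ hq hq2 hu hv hkt.1.continuous.measurable hk0 hk1 hki
  set J := ∫ x, k x * forcing β q u v x with hJ
  have hu0 := measurable_fn u
  have hv0 := measurable_fn v
  have hkm : Measurable k := hkt.1.continuous.measurable
  have i1 : Integrable fun x => k x * ‖fn u x‖ ^ (2 * q - 1) := by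
    refine hJi.mono' (by fun_prop) (ae_of_all _ fun x => ?_)
    have := hk0 x
    rw [Real.norm_eq_abs, abs_of_nonneg (by positivity)]
    refine mul_le_mul_of_nonneg_left (le_add_of_nonneg_right (by positivity)) this
  have i2 : Integrable fun x => k x * (‖fn v x‖ ^ q * ‖fn u x‖ ^ (q - 1)) := by
    refine (hJi.div_const β).mono' (by fun_prop) (ae_of_all _ fun x => ?_)
    have := hk0 x
    rw [Real.norm_eq_abs, abs_of_nonneg (by positivity), le_div_iff₀ hβ, mul_assoc]
    refine mul_le_mul_of_nonneg_left ?_ this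
    rw [forcing, mul_comm β]
    exact le_add_of_nonneg_left (by positivity)
  have hJ2 : J = (∫ x, k x * ‖fn u x‖ ^ (2 * q - 1)) +
      β * ∫ x, k x * (‖fn v x‖ ^ q * ‖fn u x‖ ^ (q - 1)) := by
    rw [hJ, ← integral_const_mul, ← integral_add i1 (i2.const_mul β)]
    refine integral_congr_ae (ae_of_all _ fun x => ?_)
    simp only [forcing]
    ring
  have hball : ∫ x in Metric.ball 0 R, forcing β q u v x ≤ J := by
    rw [← integral_indicator Metric.isOpen_ball.measurableSet]
    refine integral_mono_of_nonneg (ae_of_all _ fun x => indicator_nonneg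
      (fun x _ => forcing_nonneg hβ u v x) x) hJi (ae_of_all _ fun x => ?_)
    by_cases hx : x ∈ Metric.ball (0 : E3) R
    · have hx' : ‖R⁻¹ • x‖ ≤ 1 := by
        rw [mem_ball_zero_iff] at hx
        rw [norm_smul, norm_inv, Real.norm_eq_abs, abs_of_pos hR, inv_mul_le_iff₀ hR]
        linarith
      simp only [indicator_of_mem hx, hk, cutoff_eq_one hx', one_mul, le_refl]
    · rw [indicator_of_notMem hx]
      exact mul_nonneg (hk0 x) (forcing_nonneg hβ u v x)
  refine hball.trans ?_
  set C := 18 * cutoffKin + cutoffPow 2 with hC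
  set Dρ := coulombD (rho u v) (rho u v) with hDρ
  set Dw := coulombD (rho u v) (dens w) with hDw
  set Dww := coulombD (dens w) (dens w) with hDww
  have dρ := isDensity_rho hu hv
  have dw := isDensity_dens hwr
  have hDρ1 : Dρ ≤ (mass u + mass v) * P := by
    rw [← integral_rho]; exact dρ.coulombD_le dρ hP
  have hDw1 : Dw ≤ (mass u + mass v) * (R ^ 2 * C) := by
    rw [← integral_rho]
    refine dρ.coulombD_le dw fun x => (pot_bump_le 1 hR x).trans (le_of_eq ?_)
    ring
  set X := √(mass u) * cutoffHess / √R with hX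
  -- Gs collects the bump's own kinetic term and the Coulomb increment, divided by s; at s = 0 only
  -- α/2 (τ Dρ + Dw/τ) survives.
  set Gs : ℝ → ℝ := fun s => s / 2 * kinetic w + α / 4 * ((2 * τ + s * τ ^ 2) * Dρ +
    2 * (1 + s * τ) * (1 / τ + s) * Dw + s * (1 / τ + s) ^ 2 * Dww) with hGs
  have hstep : ∀ s : ℝ, 0 < s → mass (u + (s : ℂ) • w) ≤ a₁ → J ≤ X + Gs s := by
    intro s hs hsm
    set U := u + (s : ℂ) • w with hU
    have hUr : U ∈ H1r := H1r.add_mem hu (H1r.smul_mem _ hwr)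
    -- The positivity of u enters here: the moduli add exactly, so the expansion in s concerns real
    -- powers only.
    have hUn : ∀ᵐ x, ‖fn U x‖ = ‖fn u x‖ + s * k x := by
      filter_upwards [Lp.coeFn_add (valL u) ((s : ℂ) • valL w), Lp.coeFn_smul (s : ℂ) (valL w),
        hpos, hwf] with x h1 h2 h3 h4
      have e : fn U x = fn u x + (s : ℂ) • fn w x := by
        refine h1.trans ?_
        rw [Pi.add_apply, h2]
        rfl
      rw [e, h3, h4, smul_eq_mul, ← Complex.ofReal_mul, Complex.norm_real, norm_norm,
        ← Complex.ofReal_add, Complex.norm_real, Real.norm_eq_abs, abs_of_nonneg]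
      have := hk0 x
      positivity
    have hmin := h.le U v hUr hv hsm h.mass_snd
    have hkin := kinetic_add_smul_bump_le u hs.le hR
    have hco : coulombD (rho U v) (rho U v) ≤ (1 + s * τ) ^ 2 * Dρ +
        2 * ((1 + s * τ) * (s / τ + s ^ 2)) * Dw + (s / τ + s ^ 2) ^ 2 * Dww := by
      have d1 : IsDensity ((1 + s * τ) • rho u v) := dρ.smul (by positivity)
      have d2 : IsDensity ((s / τ + s ^ 2) • dens w) := dw.smul (by positivity)
      have dU := isDensity_rho hUr hv
      have hle : ∀ᵐ x, rho U v x ≤ ((1 + s * τ) • rho u v + (s / τ + s ^ 2) • dens w) x := by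
        filter_upwards [hUn, hwf] with x h1 h2
        simp only [rho, dens, Pi.add_apply, Pi.smul_apply, smul_eq_mul]
        rw [h1, h2, Complex.norm_real, Real.norm_eq_abs, sq_abs]
        -- Young's inequality with free parameter τ replaces the mixed density by densities already
        -- controlled, so that no potential of u k has to be estimated.
        have h3 : 2 * ‖fn u x‖ * k x ≤ τ * ‖fn u x‖ ^ 2 + k x ^ 2 / τ := by
          have := sq_nonneg (τ * ‖fn u x‖ - k x)
          rw [← sub_nonneg]
          have e : τ * ‖fn u x‖ ^ 2 + k x ^ 2 / τ - 2 * ‖fn u x‖ * k x =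
            (τ * ‖fn u x‖ - k x) ^ 2 / τ := by field_simp; ring
          rw [e]; positivity
        have h4 := mul_le_mul_of_nonneg_left h3 hs.le
        have h5 : 0 ≤ s * τ * ‖fn v x‖ ^ 2 := by positivity
        have h6 : s * (τ * ‖fn u x‖ ^ 2 + k x ^ 2 / τ) =
          s * τ * ‖fn u x‖ ^ 2 + s / τ * k x ^ 2 := by ring
        nlinarith
      refine (dU.coulombD_mono dU (d1.add d2) (d1.add d2) hle hle).trans (le_of_eq ?_)
      have hs1 : ∀ (c d : ℝ) (f g : E3 → ℝ), coulombD (c • f) (d • g) = c * d * coulombD f g := by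
        intro c d f g
        rw [coulombD, coulombD, ← integral_const_mul]
        refine integral_congr_ae (ae_of_all _ fun x => ?_)
        simp only [Pi.smul_apply, smul_eq_mul, IsDensity.pot_smul]
        ring
      rw [d1.coulombD_add_self d2, hs1, hs1, hs1]
      ring
    have hpow : (∫ x, ‖fn u x‖ ^ (2 * q)) + 2 * q * s * (∫ x, k x * ‖fn u x‖ ^ (2 * q - 1)) ≤
        ∫ x, ‖fn U x‖ ^ (2 * q) := by
      rw [← integral_const_mul, ← integral_add (integrable_power hu hq hq2) (i1.const_mul _)]
      refine integral_mono_ae ((integrable_power hu hq hq2).add (i1.const_mul _))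
        (integrable_power hUr hq hq2) ?_
      filter_upwards [hUn] with x hx
      rw [hx]
      refine le_trans (le_of_eq ?_) (add_mul_rpow_le (norm_nonneg (fn u x))
        (mul_nonneg hs.le (hk0 x)) (p := 2 * q) (by linarith))
      ring
    have hcoup : (∫ x, ‖fn u x‖ ^ q * ‖fn v x‖ ^ q) +
        q * s * (∫ x, k x * (‖fn v x‖ ^ q * ‖fn u x‖ ^ (q - 1))) ≤
        ∫ x, ‖fn U x‖ ^ q * ‖fn v x‖ ^ q := by
      rw [← integral_const_mul, ← integral_add (integrable_coupling hu hv hq hq2) (i2.const_mul _)]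
      refine integral_mono_ae ((integrable_coupling hu hv hq hq2).add (i2.const_mul _))
        (integrable_coupling hUr hv hq hq2) ?_
      filter_upwards [hUn] with x hx
      rw [hx]
      refine le_trans (le_of_eq ?_) (mul_le_mul_of_nonneg_right (add_mul_rpow_le
        (norm_nonneg (fn u x)) (mul_nonneg hs.le (hk0 x)) hq) (by positivity))
      ring
    rw [energy_eq_coulombD, energy_eq_coulombD] at hmin
    have f1 : α / 4 * coulombD (rho U v) (rho U v) ≤ α / 4 * ((1 + s * τ) ^ 2 * Dρ +
        2 * ((1 + s * τ) * (s / τ + s ^ 2)) * Dw + (s / τ + s ^ 2) ^ 2 * Dww) := by gcongr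
    have f2 := mul_le_mul_of_nonneg_left hpow (by positivity : 0 ≤ 1 / (2 * q))
    have f3 := mul_le_mul_of_nonneg_left hcoup (by positivity : 0 ≤ β / q)
    have f4 : 1 / (2 * q) * ((∫ x, ‖fn u x‖ ^ (2 * q)) +
        2 * q * s * (∫ x, k x * ‖fn u x‖ ^ (2 * q - 1))) = 1 / (2 * q) * (∫ x, ‖fn u x‖ ^ (2 * q)) +
        s * ∫ x, k x * ‖fn u x‖ ^ (2 * q - 1) := by field_simp
    have f5 : β / q * ((∫ x, ‖fn u x‖ ^ q * ‖fn v x‖ ^ q) +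
        q * s * (∫ x, k x * (‖fn v x‖ ^ q * ‖fn u x‖ ^ (q - 1)))) =
        β / q * (∫ x, ‖fn u x‖ ^ q * ‖fn v x‖ ^ q) +
        s * (β * ∫ x, k x * (‖fn v x‖ ^ q * ‖fn u x‖ ^ (q - 1))) := by field_simp
    rw [f4] at f2
    rw [f5] at f3
    have f6 : s * (X + Gs s) = 1 / 2 * (2 * s * X + s ^ 2 * kinetic w) + (α / 4 * ((1 + s * τ) ^ 2 * Dρ +
        2 * ((1 + s * τ) * (s / τ + s ^ 2)) * Dw + (s / τ + s ^ 2) ^ 2 * Dww) - α / 4 * Dρ) := by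
      rw [hGs]
      field_simp
      ring
    have f7 : s * J ≤ s * (X + Gs s) := by
      rw [f6, hJ2]
      linarith
    exact le_of_mul_le_mul_left f7 hs
  -- Only s > 0 is available, and the slack admits all small such s. The one-sided limit gives an
  -- inequality in which no Lagrange multiplier appears.
  have hlim : Tendsto (fun s => X + Gs s) (𝓝[>] 0) (𝓝 (X + Gs 0)) :=
    (Continuous.tendsto (by rw [hGs]; fun_prop) 0).mono_left nhdsWithin_le_nhds
  have hev : ∀ᶠ s : ℝ in 𝓝[>] 0, mass (u + (s : ℂ) • w) ≤ a₁ := by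
    have hc : Continuous fun s : ℝ => mass (u + (s : ℂ) • w) := by
      simp_rw [mass_eq, map_add, map_smul]
      fun_prop
    have h1 := (hc.tendsto 0).mono_left (nhdsWithin_le_nhds (s := Ioi 0))
    rw [Complex.ofReal_zero, zero_smul, add_zero] at h1
    filter_upwards [h1.eventually_lt_const hlt] with s hs using hs.le
  have hfin : J ≤ X + Gs 0 := ge_of_tendsto hlim (by
    filter_upwards [hev, self_mem_nhdsWithin] with s h1 h2 using hstep s h2 h1)
  refine hfin.trans ?_
  have hG0 : Gs 0 = α / 2 * (τ * Dρ + Dw / τ) := by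
    rw [hGs]; field_simp; ring
  rw [hG0]
  have e1 : τ * Dρ ≤ τ * ((mass u + mass v) * P) := by gcongr
  have e2 : Dw / τ ≤ (mass u + mass v) * (R ^ 2 * C) / τ := by gcongr
  have e3 : α / 2 * (τ * Dρ + Dw / τ) ≤
      α / 2 * (τ * ((mass u + mass v) * P) + (mass u + mass v) * (R ^ 2 * C) / τ) := by gcongr
  refine add_le_add le_rfl (e3.trans (le_of_eq ?_))
  ring

end Variational

/-! ### Saturation of the mass constraints for small masses -/

section Variational

variable {α β q : ℝ}

/-- A pointwise case distinction. Between the radii δ and R both moduli are at most μ, so |u|^{2q} ≤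
μ|u|^{2q-1}. Where |u| ≥ θ|v|, also |v|^{2q} ≤ μθ^{1-q}|u|^{q-1}|v|^q. Both right sides are
controlled by the forcing; where |u| < θ|v|, the power of v is charged to its own integral. -/
lemma integral_power_add_le (hβ : 0 < β) (hq : 1 < q) (hq2 : q < 3 / 2) {u v : H1} (hu : u ∈ H1r)
    (hv : v ∈ H1r) {δ R μ θ : ℝ} (hδ : 0 < δ) (hμ : 0 ≤ μ) (hθ : 0 < θ)
    (hdec : decayConst * (kinetic u + kinetic v) / δ ≤ μ ^ 2) :
    (∫ x, ‖fn u x‖ ^ (2 * q)) + ∫ x, ‖fn v x‖ ^ (2 * q) ≤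
      ((∫ x in Metric.ball 0 δ, ‖fn u x‖ ^ (2 * q)) + ∫ x in Metric.ball 0 δ, ‖fn v x‖ ^ (2 * q)) +
      ((∫ x in (Metric.ball 0 R)ᶜ, ‖fn u x‖ ^ (2 * q)) +
        ∫ x in (Metric.ball 0 R)ᶜ, ‖fn v x‖ ^ (2 * q)) +
      (∫ x in {x | ‖fn u x‖ < θ * ‖fn v x‖}, ‖fn v x‖ ^ (2 * q)) +
      μ * (1 + θ ^ (1 - q) / β) * ∫ x in Metric.ball 0 R, forcing β q u v x := by
  have hA : MeasurableSet {x | ‖fn u x‖ < θ * ‖fn v x‖} :=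
    measurableSet_lt (measurable_fn u).norm ((measurable_fn v).norm.const_mul θ)
  have hB : ∀ r, MeasurableSet (Metric.ball (0 : E3) r) := fun r => Metric.isOpen_ball.measurableSet
  have iu := integrable_power hu hq hq2
  have iv := integrable_power hv hq hq2
  have hind : Integrable ((Metric.ball (0 : E3) R).indicator fun _ => (1 : ℝ)) :=
    (integrable_indicator_iff (hB R)).mpr (integrableOn_const measure_ball_lt_top.ne)
  have iF : Integrable ((Metric.ball (0 : E3) R).indicator (forcing β q u v)) := by
    have := integrable_mul_forcing hβ hq hq2 hu hv (measurable_const.indicator (hB R))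
      (fun x => indicator_nonneg (fun _ _ => zero_le_one) x)
      (fun x => indicator_le_self' (fun _ _ => zero_le_one) x) hind
    refine this.congr (ae_of_all _ fun x => ?_)
    by_cases hx : x ∈ Metric.ball (0 : E3) R
    · simp only [indicator_of_mem hx, one_mul]
    · simp only [indicator_of_notMem hx, zero_mul]
  have hadd : ∀ {f g : E3 → ℝ}, Integrable f → Integrable g → Integrable fun x => f x + g x :=
    fun hf hg => hf.add hg
  have j1 := hadd (iu.indicator (hB δ)) (iv.indicator (hB δ))
  have j2 := hadd (iu.indicator (hB R).compl) (iv.indicator (hB R).compl)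
  have j3 := hadd j1 j2
  have j4 := hadd j3 (iv.indicator hA)
  have j5 := iF.const_mul (μ * (1 + θ ^ (1 - q) / β))
  rw [← integral_indicator (hB δ), ← integral_indicator (hB δ), ← integral_indicator (hB R).compl,
    ← integral_indicator (hB R).compl, ← integral_indicator hA, ← integral_indicator (hB R),
    ← integral_const_mul, ← integral_add iu iv,
    ← integral_add (iu.indicator (hB δ)) (iv.indicator (hB δ)),
    ← integral_add (iu.indicator (hB R).compl) (iv.indicator (hB R).compl),
    ← integral_add j1 j2, ← integral_add j3 (iv.indicator hA), ← integral_add j4 j5]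
  refine integral_mono_ae (hadd iu iv) (hadd j4 j5) ?_
  filter_upwards [ae_norm_sq_le hu, ae_norm_sq_le hv] with x hxu hxv
  have pu : 0 ≤ ‖fn u x‖ ^ (2 * q) := by positivity
  have pv : 0 ≤ ‖fn v x‖ ^ (2 * q) := by positivity
  have pF := forcing_nonneg (q := q) hβ u v x
  have n1 : ∀ (s : Set E3) (f : E3 → ℝ), (∀ x, 0 ≤ f x) → 0 ≤ s.indicator f x := fun s f hf =>
    indicator_nonneg (fun x _ => hf x) x
  have m1 := n1 (Metric.ball 0 δ) (fun x => ‖fn u x‖ ^ (2 * q)) fun x => by positivity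
  have m2 := n1 (Metric.ball 0 δ) (fun x => ‖fn v x‖ ^ (2 * q)) fun x => by positivity
  have m3 := n1 (Metric.ball 0 R)ᶜ (fun x => ‖fn u x‖ ^ (2 * q)) fun x => by positivity
  have m4 := n1 (Metric.ball 0 R)ᶜ (fun x => ‖fn v x‖ ^ (2 * q)) fun x => by positivity
  have m5 := n1 {x | ‖fn u x‖ < θ * ‖fn v x‖} (fun x => ‖fn v x‖ ^ (2 * q)) fun x => by positivity
  have m6 := mul_nonneg (by positivity : 0 ≤ μ * (1 + θ ^ (1 - q) / β))
    (n1 (Metric.ball 0 R) (forcing β q u v) (forcing_nonneg hβ u v))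
  by_cases h1 : x ∈ Metric.ball (0 : E3) δ
  · rw [indicator_of_mem h1] at m1 m2 ⊢
    rw [indicator_of_mem h1]
    linarith
  by_cases h2 : x ∈ Metric.ball (0 : E3) R
  swap
  · rw [← mem_compl_iff] at h2
    rw [indicator_of_mem h2] at m3 m4
    rw [indicator_of_mem h2 fun x => ‖fn u x‖ ^ (2 * q), indicator_of_mem h2]
    linarith
  have hxδ : δ ≤ ‖x‖ := by simpa using h1
  have hle : ∀ w : H1, kinetic w ≤ kinetic u + kinetic v →
      ‖fn w x‖ ^ 2 ≤ decayConst * kinetic w / ‖x‖ → ‖fn w x‖ ≤ μ := by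
    intro w hw h
    refine le_of_sq_le_sq (h.trans (le_trans ?_ hdec)) hμ
    have := decayConst_pos
    have := kinetic_nonneg w
    have := kinetic_nonneg u
    have := kinetic_nonneg v
    gcongr
  have hu' := hle u (by linarith [kinetic_nonneg v]) hxu
  have hv' := hle v (by linarith [kinetic_nonneg u]) hxv
  have hsplit : ∀ y : ℝ, 0 ≤ y → ∀ p : ℝ, 1 < p → y ^ p = y ^ (p - 1) * y := fun y hy p hp => by
    conv_lhs => rw [show p = (p - 1) + 1 by ring]
    rw [Real.rpow_add_of_nonneg hy (by linarith) zero_le_one, Real.rpow_one]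
  have ku : ‖fn u x‖ ^ (2 * q) ≤ μ * forcing β q u v x := by
    rw [hsplit _ (norm_nonneg _) _ (by linarith), mul_comm]
    refine mul_le_mul hu' ?_ (by positivity) hμ
    exact le_add_of_nonneg_right (by positivity)
  rw [indicator_of_mem h2] at m6 ⊢
  have eF : μ * (1 + θ ^ (1 - q) / β) * forcing β q u v x = μ * forcing β q u v x +
    μ * (θ ^ (1 - q) / β * forcing β q u v x) := by ring
  have pF2 : 0 ≤ μ * (θ ^ (1 - q) / β * forcing β q u v x) := by positivity
  by_cases h3 : x ∈ {x | ‖fn u x‖ < θ * ‖fn v x‖}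
  · rw [indicator_of_mem h3] at m5 ⊢
    linarith
  · have h3' : θ * ‖fn v x‖ ≤ ‖fn u x‖ := not_lt.mp h3
    have kv : ‖fn v x‖ ^ (2 * q) ≤ μ * (θ ^ (1 - q) / β * forcing β q u v x) := by
      have h4 : ‖fn v x‖ ^ (q - 1) ≤ θ ^ (1 - q) * ‖fn u x‖ ^ (q - 1) := by
        have h5 : ‖fn v x‖ ≤ θ⁻¹ * ‖fn u x‖ := by
          rw [inv_mul_eq_div, le_div_iff₀ hθ, mul_comm]; exact h3'
        refine (Real.rpow_le_rpow (norm_nonneg _) h5 (by linarith)).trans (le_of_eq ?_)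
        rw [Real.mul_rpow (by positivity) (norm_nonneg _), Real.inv_rpow hθ.le, ← Real.rpow_neg hθ.le]
        congr 2
        ring
      have h6 : ‖fn v x‖ ^ (2 * q) = ‖fn v x‖ * (‖fn v x‖ ^ (q - 1) * ‖fn v x‖ ^ q) := by
        rw [hsplit _ (norm_nonneg _) _ (by linarith), ← Real.rpow_add_of_nonneg (norm_nonneg _)
          (by linarith) (by linarith), mul_comm]
        congr 2
        ring
      rw [h6]
      refine mul_le_mul hv' ?_ (by positivity) hμ
      calc ‖fn v x‖ ^ (q - 1) * ‖fn v x‖ ^ q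
          ≤ θ ^ (1 - q) * ‖fn u x‖ ^ (q - 1) * ‖fn v x‖ ^ q := by gcongr
        _ = θ ^ (1 - q) / β * (β * (‖fn v x‖ ^ q * ‖fn u x‖ ^ (q - 1))) := by field_simp
        _ ≤ _ := by
          gcongr
          exact le_add_of_nonneg_left (by positivity)
    linarith

/-! ### The natural scale, and estimates at that scale. -/

/-- The natural length scale `L` of the problem with mass `a`. -/
structure IsScale (q a L : ℝ) : Prop where
  mass_pos : 0 < a
  pos : 0 < L
  rel : a ^ (q - 1) * L ^ (5 - 3 * q) = 1

/-- A function of mass a spread over length L has power integral of order a^q L^{3-3q} and kinetic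
energy of order a/L²; the scale relation says that these are equal. -/
lemma IsScale.mass_rpow_mul {a L : ℝ} (h : IsScale q a L) : a ^ q * L ^ (3 - 3 * q) = a / L ^ 2 := by
  obtain ⟨ha, hL, hr⟩ := h
  have e1 : a ^ q = a ^ (q - 1) * a := by rw [Real.rpow_sub_one ha.ne']; field_simp
  have e2 : L ^ (3 - 3 * q) = L ^ (5 - 3 * q) / L ^ 2 := by
    rw [← Real.rpow_natCast L 2, ← Real.rpow_sub hL]
    congr 1
    push_cast; ring
  calc a ^ q * L ^ (3 - 3 * q) = (a ^ (q - 1) * L ^ (5 - 3 * q)) * a / L ^ 2 := by rw [e1, e2]; ring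
    _ = _ := by rw [hr, one_mul]

lemma IsScale.div_sq_rpow_mul {a L : ℝ} (h : IsScale q a L) :
    (a / L ^ 2) ^ q * L ^ (3 - q) = a / L ^ 2 := by
  obtain ⟨ha, hL, -⟩ := id h
  refine Eq.trans ?_ h.mass_rpow_mul
  rw [Real.div_rpow ha.le (by positivity), ← Real.rpow_natCast, ← Real.rpow_mul hL.le,
    div_mul_eq_mul_div, mul_div_assoc, ← Real.rpow_sub hL]
  congr 2
  push_cast; ring

lemma IsScale.div_rpow_mul {a L : ℝ} (h : IsScale q a L) :
    (a / L ^ 2 / L) ^ (q - 1) * a = a / L ^ 2 := by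
  obtain ⟨ha, hL, -⟩ := id h
  have e : a / L ^ 2 / L = a / L ^ 3 := by field_simp
  refine Eq.trans ?_ h.mass_rpow_mul
  rw [e, Real.div_rpow ha.le (by positivity), ← Real.rpow_natCast,
    ← Real.rpow_mul hL.le, Real.rpow_sub_one ha.ne']
  have e2 : L ^ (3 - 3 * q) = (L ^ (((3 : ℕ) : ℝ) * (q - 1)))⁻¹ := by
    rw [← Real.rpow_neg hL.le]
    congr 1
    push_cast; ring
  rw [e2]
  field_simp

lemma IsScale.mass_rpow_half {a L : ℝ} (h : IsScale q a L) :
    a ^ ((3 - q) / 2) = (a / L ^ 2) ^ ((5 - 3 * q) / 2) := by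
  obtain ⟨ha, hL, hr⟩ := h
  have e1 : (L ^ 2) ^ ((5 - 3 * q) / 2) = L ^ (5 - 3 * q) := by
    rw [← Real.rpow_natCast, ← Real.rpow_mul hL.le]
    congr 1
    push_cast; ring
  have e2 : a ^ ((3 - q) / 2) = a ^ ((5 - 3 * q) / 2) * a ^ (q - 1) := by
    rw [← Real.rpow_add ha]
    congr 1
    ring
  rw [Real.div_rpow ha.le (by positivity), e1, e2, eq_div_iff (by positivity), mul_assoc, hr, mul_one]

lemma energy_zero (hq : 1 < q) : energy α β q 0 0 = 0 := by
  have h0 : ∀ᵐ x, fn 0 x = 0 := Lp.coeFn_zero ℂ 2 (volume : Measure E3)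
  have hk0 : kinetic 0 = 0 := by rw [kinetic_eq]; simp
  have e1 : ∫ x, ‖fn 0 x‖ ^ (2 * q) = 0 := integral_eq_zero_of_ae (by
    filter_upwards [h0] with x hx
    rw [hx, norm_zero, Real.zero_rpow (by linarith)]
    rfl)
  have e2 : ∫ x, ‖fn 0 x‖ ^ q * ‖fn 0 x‖ ^ q = 0 := integral_eq_zero_of_ae (by
    filter_upwards [h0] with x hx
    rw [hx, norm_zero, Real.zero_rpow (by linarith), mul_zero]
    rfl)
  have e3 : coulombD (rho 0 0) (rho 0 0) = 0 := integral_eq_zero_of_ae (by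
    filter_upwards [h0] with x hx
    simp [rho, dens, hx])
  rw [energy_eq_coulombD, e1, e2, e3, hk0]
  ring

/-- Small masses have negative energy, of the natural order. -/
lemma exists_energy_le_neg (hα : 0 < α) (hβ : 0 < β) (hq : 1 < q) (hq2 : q < 3 / 2) :
    ∃ c > 0, ∃ ε > 0, ∀ a L : ℝ, IsScale q a L → α * a * L ≤ ε →
      ∃ U ∈ H1r, mass U = a ∧ energy α β q U 0 ≤ -(c * (a / L ^ 2)) := by
  have hm := cutoffPow_pos two_pos
  have hp : 0 < cutoffPow (2 * q) := cutoffPow_pos (by linarith)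
  have hk := cutoffKin_nonneg
  set A := 1 / 2 * (cutoffKin / cutoffPow 2) with hA
  set B := (18 * cutoffKin + cutoffPow 2) / (4 * cutoffPow 2) with hB
  set D := 1 / (2 * q) * ((cutoffPow 2)⁻¹ ^ q * cutoffPow (2 * q)) with hD
  have hB0 : 0 < B := by positivity
  have hD0 : 0 < D := by positivity
  have hlim : Tendsto (fun ς : ℝ => D / 4 * ς ^ (5 - 3 * q)) atTop atTop :=
    (tendsto_rpow_atTop (by linarith)).const_mul_atTop (by positivity)
  -- A bump of width ςL has kinetic cost Aς⁻² and gain Dς^{3-3q} in units of a/L². Since 5 - 3q > 0,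
  -- a large ς makes the cost at most a quarter of the gain.
  obtain ⟨ς, hς1, hςA⟩ := ((eventually_ge_atTop 1).and (hlim.eventually_ge_atTop A)).exists
  have hς : 0 < ς := by linarith
  set y := ς ^ (3 - 3 * q) with hy
  have hy0 : 0 < y := by positivity
  -- The smallness of αaL keeps the Coulomb cost below another quarter of the gain D y, so half of
  -- the gain is left.
  refine ⟨D / 2 * y, by positivity, D / 4 * y / B, by positivity, fun a L h hε => ?_⟩
  have ha := h.mass_pos
  have hL := h.pos
  have hR : 0 < ς * L := by positivity
  set κ := √(a / (cutoffPow 2 * (ς * L) ^ 3)) with hκ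
  have hκ2 : κ ^ 2 = a / (cutoffPow 2 * (ς * L) ^ 3) := Real.sq_sqrt (by positivity)
  have hκ0 : 0 ≤ κ := Real.sqrt_nonneg _
  obtain ⟨U, hU, -, hUm, hUe⟩ := exists_energy_join_le (β := β) hα hq hq2 H1r.zero_mem H1r.zero_mem
    (bump_mem κ hR) (pot_bump_le κ hR)
  have hmb : mass (bump κ hR) = a := by
    rw [mass_bump, hκ2]; field_simp
  have hcoup : 0 ≤ β / q * ((∫ x, ‖fn U x‖ ^ q * ‖fn 0 x‖ ^ q) - ∫ x, ‖fn 0 x‖ ^ q * ‖fn 0 x‖ ^ q) := by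
    have h0 : ∀ᵐ x, fn 0 x = 0 := Lp.coeFn_zero ℂ 2 (volume : Measure E3)
    refine mul_nonneg (by positivity) (sub_nonneg.mpr
      (integral_coupling_mono hq hq2 H1r.zero_mem H1r.zero_mem hU ?_))
    filter_upwards [h0] with x hx
    rw [hx, norm_zero, zero_pow two_ne_zero]
    exact sq_nonneg _
  refine ⟨U, hU, by rw [hUm, hmb, mass_zero, zero_add], ?_⟩
  rw [energy_zero hq, hmb, mass_zero, kinetic_bump, power_bump hR hκ0, Real.rpow_mul hκ0, Real.rpow_two,
    hκ2] at hUe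
  have e1 : 1 / 2 * (a / (cutoffPow 2 * (ς * L) ^ 3) * (ς * L) * cutoffKin) =
      A / ς ^ 2 * (a / L ^ 2) := by
    rw [hA]; field_simp
  have e2 : α / 4 * ((2 * (0 + 0) + a) * (a / (cutoffPow 2 * (ς * L) ^ 3) * (ς * L) ^ 2 *
      (18 * cutoffKin + cutoffPow 2))) = α * a * L * (B / ς) * (a / L ^ 2) := by
    rw [hB]; field_simp; ring
  have e3 : 1 / (2 * q) * ((a / (cutoffPow 2 * (ς * L) ^ 3)) ^ q * (ς * L) ^ 3 * cutoffPow (2 * q)) =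
      D * y * (a / L ^ 2) := by
    have f1 : a / (cutoffPow 2 * (ς * L) ^ 3) = a * (cutoffPow 2)⁻¹ / (ς * L) ^ 3 := by field_simp
    have f2 : ((ς * L) ^ 3) ^ q = (ς * L) ^ (3 * q) := by
      rw [← Real.rpow_natCast, ← Real.rpow_mul hR.le]
      congr 1
    have f3 : (ς * L) ^ 3 / (ς * L) ^ (3 * q) = y * L ^ (3 - 3 * q) := by
      rw [hy, ← Real.mul_rpow hς.le hL.le, Real.rpow_sub hR]
      congr 1
      norm_cast
    rw [f1, Real.div_rpow (by positivity) (by positivity), Real.mul_rpow ha.le (by positivity), f2, hD,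
      ← h.mass_rpow_mul]
    calc 1 / (2 * q) * (a ^ q * (cutoffPow 2)⁻¹ ^ q / (ς * L) ^ (3 * q) * (ς * L) ^ 3 *
          cutoffPow (2 * q)) = 1 / (2 * q) * (a ^ q * (cutoffPow 2)⁻¹ ^ q *
          ((ς * L) ^ 3 / (ς * L) ^ (3 * q)) * cutoffPow (2 * q)) := by ring
      _ = _ := by rw [f3]; ring
  rw [e1, e2, e3] at hUe
  have e4 : A / ς ^ 2 ≤ D / 4 * y := by
    rw [div_le_iff₀ (by positivity)]
    refine hςA.trans (le_of_eq ?_)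
    rw [mul_assoc, hy, ← Real.rpow_natCast, ← Real.rpow_add hς]
    congr 2
    push_cast; ring
  have e5 : α * a * L * (B / ς) ≤ D / 4 * y := by
    rw [le_div_iff₀ hB0] at hε
    have : B / ς ≤ B := div_le_self hB0.le hς1
    calc α * a * L * (B / ς) ≤ α * a * L * B := by gcongr
      _ ≤ _ := hε
  have hT : 0 ≤ a / L ^ 2 := by positivity
  have e6 := mul_le_mul_of_nonneg_right e4 hT
  have e7 := mul_le_mul_of_nonneg_right e5 hT
  have e8 : 0 ≤ D / 2 * y * (a / L ^ 2) := by positivity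
  linarith

/-- Natural bound for the kinetic energy at negative energies. -/
lemma exists_kinetic_le_of_energy_nonpos (hα : 0 < α) (hβ : 0 < β) (hq : 1 < q) (hq2 : q < 3 / 2) :
    ∃ C > 0, ∀ a L : ℝ, IsScale q a L → ∀ u v : H1, u ∈ H1r → v ∈ H1r → mass u ≤ a → mass v ≤ a →
      energy α β q u v ≤ 0 → kinetic u + kinetic v ≤ C * (a / L ^ 2) := by
  have hC := gnConst_pos hq2
  set k := 2 * (1 + β) / q * gnConst q with hk
  have hk0 : 0 < k := by positivity
  refine ⟨(2 * k) ^ (1 / (1 - 3 * (q - 1) / 2)), by positivity, fun a L h u v hu hv h1 h2 h3 => ?_⟩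
  have ha := h.mass_pos
  have hL := h.pos
  have h4 := kinetic_le_add_mul_rpow hα hβ hq hq2 hu hv h1 h2 h3
  have hT : 0 < a / L ^ 2 := by positivity
  -- The exponent 1/(1 - 3(q-1)/2) = 2/(5-3q) is inverse to that in `IsScale.mass_rpow_half`, so the
  -- bound is linear in a/L².
  have e : (2 * (2 * (1 + β) / q * gnConst q * a ^ ((3 - q) / 2))) ^ (1 / (1 - 3 * (q - 1) / 2)) =
      (2 * k) ^ (1 / (1 - 3 * (q - 1) / 2)) * (a / L ^ 2) := by
    have hs : (5 - 3 * q) / 2 * (1 / (1 - 3 * (q - 1) / 2)) = 1 := by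
      have : 1 - 3 * (q - 1) / 2 = (5 - 3 * q) / 2 := by ring
      rw [this]
      exact mul_one_div_cancel (by linarith)
    rw [h.mass_rpow_half, ← mul_assoc, Real.mul_rpow (by positivity) (by positivity),
      ← Real.rpow_mul hT.le, hs, Real.rpow_one]
  rcases le_or_le_of_le_add_mul_rpow (add_nonneg (kinetic_nonneg u) (kinetic_nonneg v))
    (by linarith) (by linarith) h4 with h5 | h5
  · have : 0 ≤ (2 * k) ^ (1 / (1 - 3 * (q - 1) / 2)) * (a / L ^ 2) := by positivity
    linarith
  · rwa [e] at h5

lemma exists_mul_rpow_lt (E : ℝ) {p η : ℝ} (hp : 0 < p) (hη : 0 < η) :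
    ∃ x : ℝ, 0 < x ∧ x ≤ 1 ∧ E * x ^ p < η := by
  have h : Tendsto (fun x : ℝ => E * x ^ p) (𝓝[>] 0) (𝓝 (E * 0 ^ p)) :=
    (((Real.continuousAt_rpow_const 0 p (Or.inr hp.le)).tendsto).mono_left
      nhdsWithin_le_nhds).const_mul E
  rw [Real.zero_rpow hp.ne', mul_zero] at h
  obtain ⟨x, h1, h2⟩ := ((h.eventually_lt_const hη).and (Ioc_mem_nhdsGT one_pos)).exists
  exact ⟨x, h2.1, h2.2, h1⟩

/-- In units of a/L² the bound depends only on the ratio κ of the radius to L and vanishes as κ → 0,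
uniformly in a. The counterpart outside a ball vanishes as the ratio K tends to infinity. -/
lemma integral_power_ball_le_scale (hq : 1 < q) (hq2 : q < 3 / 2) {a L : ℝ} (hs : IsScale q a L)
    {u : H1} (hu : u ∈ H1r) {C : ℝ} (hC : 0 < C) (hk : kinetic u ≤ C * (a / L ^ 2)) {κ : ℝ}
    (hκ : 0 < κ) : ∫ x in Metric.ball 0 (κ * L), ‖fn u x‖ ^ (2 * q) ≤
      (decayConst * C) ^ q * (sphereArea / (3 - q)) * κ ^ (3 - q) * (a / L ^ 2) := by
  have ha := hs.mass_pos
  have hL := hs.pos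
  have hc := decayConst_pos
  have hA := sphereArea_pos
  have hku := kinetic_nonneg u
  have h3 : 0 < 3 - q := by linarith
  refine (integral_power_ball_le hu hq hq2 (mul_pos hκ hL)).trans ?_
  calc (decayConst * kinetic u) ^ q * (sphereArea * ((κ * L) ^ (3 - q) / (3 - q)))
      ≤ (decayConst * (C * (a / L ^ 2))) ^ q * (sphereArea * ((κ * L) ^ (3 - q) / (3 - q))) := by
        gcongr
    _ = (decayConst * C) ^ q * (sphereArea / (3 - q)) * κ ^ (3 - q) *
        ((a / L ^ 2) ^ q * L ^ (3 - q)) := by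
      rw [← mul_assoc decayConst, Real.mul_rpow (by positivity) (by positivity),
        Real.mul_rpow hκ.le hL.le]
      ring
    _ = _ := by rw [hs.div_sq_rpow_mul]

lemma integral_power_compl_ball_le_scale (hq : 1 < q) (hq2 : q < 3 / 2) {a L : ℝ}
    (hs : IsScale q a L) {u : H1} (hu : u ∈ H1r) (hm : mass u ≤ a) {C : ℝ} (hC : 0 < C)
    (hk : kinetic u ≤ C * (a / L ^ 2)) {K : ℝ} (hK : 0 < K) :
    ∫ x in (Metric.ball 0 (K * L))ᶜ, ‖fn u x‖ ^ (2 * q) ≤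
      (decayConst * C) ^ (q - 1) * K ^ (1 - q) * (a / L ^ 2) := by
  have ha := hs.mass_pos
  have hL := hs.pos
  have hc := decayConst_pos
  have hku := kinetic_nonneg u
  have hmu := mass_nonneg u
  have h1 : 0 < q - 1 := by linarith
  refine (integral_power_compl_ball_le hu hq hq2 (mul_pos hK hL)).trans ?_
  calc (decayConst * kinetic u / (K * L)) ^ (q - 1) * mass u
      ≤ (decayConst * (C * (a / L ^ 2)) / (K * L)) ^ (q - 1) * a := by gcongr
    _ = (decayConst * C) ^ (q - 1) * K⁻¹ ^ (q - 1) * ((a / L ^ 2 / L) ^ (q - 1) * a) := by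
      rw [← mul_assoc _ _ a, ← Real.mul_rpow (by positivity) (by positivity),
        ← Real.mul_rpow (by positivity) (by positivity)]
      congr 2
      field_simp
    _ = _ := by
      rw [hs.div_rpow_mul, Real.inv_rpow hK.le, ← Real.rpow_neg hK.le]
      congr 3
      ring

/-- Minimizers of small mass saturate the mass constraints. -/
lemma exists_scale_mass_eq (hα : 0 < α) (hβ : 0 < β) (hq : 1 < q) (hq2 : q < 3 / 2) :
    ∃ ε > 0, ∀ a L : ℝ, IsScale q a L → α * a * L ≤ ε → ∀ a₁ a₂ : ℝ, 0 ≤ a₁ → 0 ≤ a₂ →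
      a₁ ≤ a → a₂ ≤ a → (a = a₁ ∨ a = a₂) →
      ∀ u v : H1, IsMin α β q a₁ a₂ u v → mass u = a₁ := by
  obtain ⟨c₀, hc₀, ε₀, hε₀, hneg⟩ := exists_energy_le_neg (q := q) hα hβ hq hq2
  obtain ⟨C₁, hC₁, hkin⟩ := exists_kinetic_le_of_energy_nonpos (q := q) hα hβ hq hq2
  have hc := decayConst_pos
  have hk := cutoffKin_nonneg
  have hm := cutoffPow_pos two_pos
  have hH : 0 ≤ cutoffHess := Finset.sum_nonneg fun i _ => Real.sqrt_nonneg _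
  set c₂ := 2 * q / (1 + β) * c₀ with hc₂
  have hc₂0 : 0 < c₂ := by positivity
  set C₂ := 18 * C₁ + 2 with hC₂
  set C₅ := C₂ + (18 * cutoffKin + cutoffPow 2) with hC₅
  have hC₅0 : 0 < C₅ := by positivity
  set E₁ := (decayConst * C₁) ^ q * (sphereArea / (3 - q)) with hE₁
  set E₂ := (decayConst * C₁) ^ (q - 1) with hE₂
  set E₃ := 4 / β * (1 / 2 * C₁ + 3 / 2 * C₂) with hE₃
  -- The order of choices matters: κ and θ fix N, then K is taken large in terms of N, and ε small
  -- in terms of N and K. Five errors of at most c₂/8 each stay below c₂.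
  obtain ⟨κ, hκ, -, hκE⟩ := exists_mul_rpow_lt (2 * E₁) (p := 3 - q) (η := c₂ / 8) (by linarith)
    (by positivity)
  obtain ⟨θ, hθ, hθ1, hθE⟩ := exists_mul_rpow_lt E₃ (p := 2 - q) (η := c₂ / 8) (by linarith)
    (by positivity)
  set N := √(decayConst * C₁ / κ) * (1 + θ ^ (1 - q) / β) with hN
  have hN0 : 0 < N := by positivity
  have hK1 : Tendsto (fun K : ℝ => 2 * E₂ * K ^ (-(q - 1))) atTop (𝓝 (2 * E₂ * 0)) :=
    (tendsto_rpow_neg_atTop (by linarith)).const_mul _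
  have hK2 : Tendsto (fun K : ℝ => N * (cutoffHess / √K)) atTop (𝓝 (N * 0)) :=
    (tendsto_const_nhds.div_atTop Real.tendsto_sqrt_atTop).const_mul _
  rw [mul_zero] at hK1 hK2
  obtain ⟨K, ⟨hKE, hKH⟩, hK⟩ := (((hK1.eventually_lt_const (by positivity : 0 < c₂ / 8)).and
    (hK2.eventually_lt_const (by positivity : 0 < c₂ / 8))).and (eventually_gt_atTop 0)).exists
  refine ⟨min ε₀ (min 1 (c₂ / (8 * (N * (K * C₅))))), by positivity,
    fun a L hs hε a₁ a₂ ha₁ ha₂ h1 h2 h12 u₀ v hmin₀ => ?_⟩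
  by_contra hne
  have hlt₀ : mass u₀ < a₁ := lt_of_le_of_ne hmin₀.mass_fst hne
  obtain ⟨u, hmin, hmu, hpos⟩ := hmin₀.exists_nonneg hα
  have hlt : mass u < a₁ := by rw [hmu]; exact hlt₀
  have hu := hmin.fst_mem
  have hv := hmin.snd_mem
  have ha := hs.mass_pos
  have hL := hs.pos
  have hua : mass u ≤ a := hmin.mass_fst.trans h1
  have hva : mass v ≤ a := hmin.mass_snd.trans h2
  have hmu0 := mass_nonneg u
  have hmv0 := mass_nonneg v
  set ε := α * a * L with hεdef
  have hεpos : 0 < ε := by positivity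
  have hε1 : ε ≤ 1 := hε.trans ((min_le_right _ _).trans (min_le_left _ _))
  have hε2 : ε * (8 * (N * (K * C₅))) ≤ c₂ := by
    rw [← le_div_iff₀ (by positivity)]
    exact hε.trans ((min_le_right _ _).trans (min_le_right _ _))
  set T := a / L ^ 2 with hT
  have hT0 : 0 < T := by positivity
  have hen : energy α β q u v ≤ -(c₀ * T) := by
    obtain ⟨U, hU, hUm, hUe⟩ := hneg a L hs (hε.trans (min_le_left _ _))
    -- The competitor of energy -c₀T puts all of its mass a into the component whose allowance is a
    -- and leaves the other one zero.
    rcases h12 with h12 | h12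
    · exact (hmin.le U 0 hU H1r.zero_mem (by rw [hUm, h12]) (by rw [mass_zero]; exact ha₂)).trans hUe
    · refine (hmin.le 0 U H1r.zero_mem hU (by rw [mass_zero]; exact ha₁) (by rw [hUm, h12])).trans ?_
      rw [energy_comm]
      exact hUe
  have hkuv : kinetic u + kinetic v ≤ C₁ * T := hkin a L hs u v hu hv hua hva (by
    have : 0 < c₀ * T := by positivity
    linarith)
  have hku0 := kinetic_nonneg u
  have hkv0 := kinetic_nonneg v
  have hku : kinetic u ≤ C₁ * T := by linarith
  have hkv : kinetic v ≤ C₁ * T := by linarith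
  have hlow : c₂ * T ≤ (∫ x, ‖fn u x‖ ^ (2 * q)) + ∫ x, ‖fn v x‖ ^ (2 * q) := by
    have h := le_energy hα hβ hq hq2 hu hv
    have h' : c₀ * T ≤ (1 + β) / (2 * q) *
        ((∫ x, ‖fn u x‖ ^ (2 * q)) + ∫ x, ‖fn v x‖ ^ (2 * q)) := by linarith
    calc c₂ * T = 2 * q / (1 + β) * (c₀ * T) := by rw [hc₂]; ring
      _ ≤ 2 * q / (1 + β) * ((1 + β) / (2 * q) *
        ((∫ x, ‖fn u x‖ ^ (2 * q)) + ∫ x, ‖fn v x‖ ^ (2 * q))) := by gcongr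
      _ = _ := by field_simp
  have hP : ∀ x, pot (rho u v) x ≤ C₂ * (a / L) := by
    intro x
    rw [rho, (isDensity_dens hu).pot_add (isDensity_dens hv)]
    have f1 := pot_dens_le hu hL x
    have f2 := pot_dens_le hv hL x
    have f3 : 18 * (kinetic u + kinetic v) * L ≤ 18 * (C₁ * T) * L := by gcongr
    have f4 : 18 * (C₁ * T) * L = 18 * C₁ * (a / L) := by rw [hT]; field_simp
    have f5 : mass u / L ≤ a / L := by gcongr
    have f6 : mass v / L ≤ a / L := by gcongr
    rw [hC₂]
    linarith
  have hμv : ∫ x in {x | ‖fn u x‖ < θ * ‖fn v x‖}, ‖fn v x‖ ^ (2 * q) ≤ E₃ * θ ^ (2 - q) * T := by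
    refine (hmin.setIntegral_power_le hα hβ hq hq2 hlt hP hθ hθ1).trans ?_
    have f1 : 3 * α / 4 * ((mass u + mass v) * (C₂ * (a / L))) ≤ 3 / 2 * C₂ * T := by
      calc 3 * α / 4 * ((mass u + mass v) * (C₂ * (a / L)))
          ≤ 3 * α / 4 * ((a + a) * (C₂ * (a / L))) := by gcongr
        _ = 3 / 2 * C₂ * (ε * T) := by rw [hεdef, hT]; field_simp; ring
        _ ≤ 3 / 2 * C₂ * (1 * T) := by gcongr
        _ = _ := by ring
    calc 4 / β * θ ^ (2 - q) * (1 / 2 * kinetic v + 3 * α / 4 * ((mass u + mass v) * (C₂ * (a / L))))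
        ≤ 4 / β * θ ^ (2 - q) * (1 / 2 * (C₁ * T) + 3 / 2 * C₂ * T) := by gcongr
      _ = _ := by rw [hE₃]; ring
  set σ := √(a / L) with hσ
  have hσ0 : 0 < σ := by positivity
  have hσ2 : σ ^ 2 = a / L := Real.sq_sqrt (by positivity)
  have haσ : a = σ ^ 2 * L := by rw [hσ2]; field_simp
  -- σ = √(a/L) is the potential scale's square root. The Young parameter τ = KL/σ gives τP and R²/τ
  -- the same size KLσ at R = KL.
  have hJ : ∫ x in Metric.ball 0 (K * L), forcing β q u v x ≤
      σ * (cutoffHess / √K + ε * (K * C₅)) := by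
    refine (hmin.setIntegral_forcing_le hα hβ hq hq2 hlt hpos hP (mul_pos hK hL)
      (by positivity : 0 < K * L / σ)).trans ?_
    have f1 : √(mass u) * cutoffHess / √(K * L) ≤ σ * (cutoffHess / √K) := by
      have e : √a = σ * √L := by
        rw [hσ, ← Real.sqrt_mul (by positivity)]
        congr 1
        field_simp
      have hsL : √L ≠ 0 := by positivity
      calc √(mass u) * cutoffHess / √(K * L) ≤ √a * cutoffHess / √(K * L) := by gcongr
        _ = _ := by rw [e, Real.sqrt_mul hK.le]; field_simp
    have f2 : K * L / σ * (C₂ * (a / L)) + (K * L) ^ 2 * (18 * cutoffKin + cutoffPow 2) / (K * L / σ) =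
        K * L * σ * C₅ := by
      rw [← hσ2, hC₅]; field_simp
    rw [f2]
    calc √(mass u) * cutoffHess / √(K * L) + α / 2 * ((mass u + mass v) * (K * L * σ * C₅))
        ≤ σ * (cutoffHess / √K) + α / 2 * ((a + a) * (K * L * σ * C₅)) := by gcongr
      _ = _ := by rw [hεdef]; ring
  set μ := √(decayConst * (C₁ * T) / (κ * L)) with hμ
  -- μ is the pointwise bound for u and v outside radius κL. Its product with the size σ of the
  -- forcing integral is a constant times T, so N does not depend on a or L.
  have hμσ : μ * σ = √(decayConst * C₁ / κ) * T := by
    rw [hμ, hσ, ← Real.sqrt_mul (by positivity)]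
    have e : decayConst * (C₁ * T) / (κ * L) * (a / L) = decayConst * C₁ / κ * T ^ 2 := by
      rw [hT]; field_simp
    rw [e, Real.sqrt_mul (by positivity), Real.sqrt_sq hT0.le]
  have hmain := integral_power_add_le (R := K * L) hβ hq hq2 hu hv (mul_pos hκ hL)
    (Real.sqrt_nonneg (decayConst * (C₁ * T) / (κ * L))) hθ (by
      rw [Real.sq_sqrt (by positivity)]
      gcongr)
  have hb1 := integral_power_ball_le_scale hq hq2 hs hu hC₁ hku hκ
  have hb2 := integral_power_ball_le_scale hq hq2 hs hv hC₁ hkv hκ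
  have hb3 := integral_power_compl_ball_le_scale hq hq2 hs hu hua hC₁ hku hK
  have hb4 := integral_power_compl_ball_le_scale hq hq2 hs hv hva hC₁ hkv hK
  have hb5 : μ * (1 + θ ^ (1 - q) / β) * (∫ x in Metric.ball 0 (K * L), forcing β q u v x) ≤
      (N * (cutoffHess / √K) + ε * (N * (K * C₅))) * T := by
    calc μ * (1 + θ ^ (1 - q) / β) * (∫ x in Metric.ball 0 (K * L), forcing β q u v x)
        ≤ μ * (1 + θ ^ (1 - q) / β) * (σ * (cutoffHess / √K + ε * (K * C₅))) := by gcongr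
      _ = (μ * σ) * (1 + θ ^ (1 - q) / β) * (cutoffHess / √K + ε * (K * C₅)) := by ring
      _ = _ := by rw [hμσ, hN]; ring
  rw [show -(q - 1) = 1 - q by ring] at hKE
  have hsum : c₂ * T ≤ (2 * E₁ * κ ^ (3 - q) + 2 * E₂ * K ^ (1 - q) + E₃ * θ ^ (2 - q) +
      (N * (cutoffHess / √K) + ε * (N * (K * C₅)))) * T := by
    linarith
  have hfin := le_of_mul_le_mul_right hsum hT0
  linarith

/-- For masses below a threshold, minimizers saturate the mass constraints. -/
theorem exists_threshold (hα : 0 < α) (hβ : 0 < β) (hq : 1 < q) (hq2 : q < 3 / 2) :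
    ∃ ρ > 0, ∀ a₁ a₂ : ℝ, 0 < a₁ → a₁ < ρ → 0 < a₂ → a₂ < ρ →
      ∀ u v : H1, IsMin α β q a₁ a₂ u v → mass u = a₁ ∧ mass v = a₂ := by
  obtain ⟨ε, hε, H⟩ := exists_scale_mass_eq (q := q) hα hβ hq hq2
  have h5 : 0 < 5 - 3 * q := by linarith
  -- L = a^r solves the scale relation, and 1 + r = (6 - 4q)/(5 - 3q) is positive because q < 3/2;
  -- hence aL tends to 0 with a.
  set r := -((q - 1) / (5 - 3 * q)) with hr
  have hr1 : 0 < 1 + r := by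
    rw [hr, ← sub_eq_add_neg, sub_pos, div_lt_one h5]; linarith
  have hlim : Tendsto (fun a : ℝ => α * a ^ (1 + r)) (𝓝[>] 0) (𝓝 (α * 0 ^ (1 + r))) :=
    (((Real.continuousAt_rpow_const 0 (1 + r) (Or.inr hr1.le)).tendsto).mono_left
      nhdsWithin_le_nhds).const_mul α
  rw [Real.zero_rpow hr1.ne', mul_zero] at hlim
  obtain ⟨ρ, hρ, hρε⟩ := (mem_nhdsGT_iff_exists_Ioo_subset).mp (hlim.eventually_lt_const hε)
  refine ⟨ρ, hρ, fun a₁ a₂ h1 h1ρ h2 h2ρ u v hmin => ?_⟩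
  set a := max a₁ a₂ with ha
  have ha0 : 0 < a := lt_max_of_lt_left h1
  have haρ : a < ρ := max_lt h1ρ h2ρ
  have hs : IsScale q a (a ^ r) := by
    refine ⟨ha0, by positivity, ?_⟩
    rw [← Real.rpow_mul ha0.le, ← Real.rpow_add ha0, hr]
    have : q - 1 + -((q - 1) / (5 - 3 * q)) * (5 - 3 * q) = 0 := by
      rw [neg_mul, div_mul_cancel₀ _ h5.ne', add_neg_cancel]
    rw [this, Real.rpow_zero]
  have hsε : α * a * a ^ r ≤ ε := by
    have h : α * a ^ (1 + r) < ε := hρε ⟨ha0, haρ⟩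
    rw [Real.rpow_add ha0, Real.rpow_one, ← mul_assoc] at h
    exact h.le
  have hor : a = a₁ ∨ a = a₂ := max_choice a₁ a₂
  exact ⟨H a _ hs hsε a₁ a₂ h1.le h2.le (le_max_left _ _) (le_max_right _ _) hor u v hmin,
    H a _ hs hsε a₂ a₁ h2.le h1.le (le_max_right _ _) (le_max_left _ _) hor.symm v u hmin.swap⟩

end Variational

end HartreeFock

end

theorem theorem1p2 (α β q : ℝ) (hα : 0 < α) (hβ : 0 < β) (hq₁ : 1 < q) (hq₂ : q < 3 / 2)
    (hloc : HartreeFock.LocalTheory α β q) :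
    (q < 4 / 3 → ∀ a₁ a₂ : ℝ, 0 < a₁ → 0 < a₂ →
      (HartreeFock.G α β q a₁ a₂).Nonempty ∧ HartreeFock.OrbitallyStable α β q a₁ a₂) ∧
    (4 / 3 ≤ q → ∃ ρ₁ > 0, ∃ ρ₂ > 0, ∀ a₁ a₂ : ℝ, 0 < a₁ → a₁ < ρ₁ → 0 < a₂ → a₂ < ρ₂ →
      (HartreeFock.G α β q a₁ a₂).Nonempty ∧ HartreeFock.OrbitallyStable α β q a₁ a₂) := by
  refine ⟨fun hq a₁ a₂ h₁ h₂ => ?_, fun _ => ?_⟩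
  · exact HartreeFock.nonempty_and_orbitallyStable hα hβ hq₁ hq₂ hloc h₁.le h₂.le fun u v h =>
      ⟨h.mass_eq_of_lt_four_thirds hα hβ hq₁ hq, h.swap.mass_eq_of_lt_four_thirds hα hβ hq₁ hq⟩
  · obtain ⟨ρ, hρ, H⟩ := HartreeFock.exists_threshold hα hβ hq₁ hq₂
    exact ⟨ρ, hρ, ρ, hρ, fun a₁ a₂ h₁ h₁ρ h₂ h₂ρ =>
      HartreeFock.nonempty_and_orbitallyStable hα hβ hq₁ hq₂ hloc h₁.le h₂.le
        (H a₁ a₂ h₁ h₁ρ h₂ h₂ρ)⟩
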